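/- Let $\mathbb F$ be $\mathbb R$ or $\mathbb C$ and $1<q\le\infty$. A finite set $A\subset\mathbb N$ is a greedy set of $f\in\mathbb F^{\mathbb N}$ if $|f(n)|\ge|f(k)|$ for all $n\in A$, $k\in\mathbb N\setminus A$; $\mathcal G(f)$ is the collection of greedy sets of $f$, directed by inclusion. For finite $A$ put $\beta(f,A)=\sup_I\bigl|\sum_{n\in I\setminus A}f(n)\bigr|$, the supremum over all finite integer intervals $I\subset\mathbb N$, and let $\|f\|_{\mathbb B}=\sup_{A\in\mathcal G(f)}\beta(f,A)$ and $\mathbb B_0=\{f\in c_0:\lim_{A\in\mathcal G(f)}\beta(f,A)=0\}$. Let $f^*$ be the nonincreasing rearrangement of $|f|$, $\|f\|_{1,q}=\bigl\|(m^{1-1/q}f^*(m))_{m=1}^\infty\bigr\|_{\ell_q}$, and let $\mathbb S_q=\ell_{1,q}=\{f:\|f\|_{1,q}<\infty\}$ if $q<\infty$, and $\mathbb S_\infty=\{f\in\ell_{1,\infty}:\lim_m m f^*(m)=0\}$, the closed linear span of the unit vectors in $\ell_{1,\infty}$. Then $\mathbb X=\mathbb B_0\cap\mathbb S_q$ is a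 vector space, and $\|f\|=\max\{\|f\|_{\mathbb B},\|f\|_{1,q}\}$ is a (finite) quasi-norm on it for which $\mathbb X$ is a quasi-Banach space, locally $p$-convex for every $0<p<1$. The unit vector system $\mathcal X=(e_n)_{n=1}^\infty$ is a Schauder basis of $\mathbb X$ that is almost greedy, that is, it is a complete, semi-normalized, $M$-bounded minimal system and there is $C\ge 1$ with $\|f-S_A f\|\le C\|f-S_B f\|$ whenever $f\in\mathbb X$, $A\in\mathcal G(f)$ and $B\subset\mathbb N$ is finite with $|B|\le|A|$, where $S_A$ denotes the coordinate projection onto $A$; in particular it is quasi-greedy, that is, $\sup\{\|f-S_Af\|:\|f\|\le1,\ A\in\mathcal G(f)\}<\infty$. Let $J:\mathbb X\to\widehat{\mathbb X}$ be the Banach envelope of $\mathbb X$ (the linear contraction into a Banach space through which every continuous linear map $T$ from $\mathbb X$ into a Banach space factors uniquely, by a continuous linear map of norm at most $\|T\|$), which exists. Then $\widehat{\mathcal X}=(J(e_n))_{n=1}^\infty$ is a semi-normalized Schauder basis of $\widehat{\mathbb X}$ that is democratic (there is $C$ with $\|\sum_{n\in A}J(e_n)\|\le C\|\sum_{n\in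 B}J(e_n)\|$ for all finite $A,B$ with $|A|\le|B|$), but is not unconditional for constant coefficients: there is no $C$ with $\|\sum_{n\in A}\varepsilon_nJ(e_n)\|\le C\|\sum_{n\in B}\varepsilon_nJ(e_n)\|$ for all finite $A\subset B\subset\mathbb N$ and all scalars with $|\varepsilon_n|=1$. Hence $\widehat{\mathcal X}$ is not quasi-greedy. Moreover $$\Bigl\|\sum_{n\in A}e_n\Bigr\|_{\mathbb X}\approx\Bigl\|\sum_{n\in A}J(e_n)\Bigr\|_{\widehat{\mathbb X}}\approx|A|$$ for finite $A\subset\mathbb N$, with constants independent of $A$. In particular, a quasi-greedy basis of a quasi-Banach space need not remain quasi-greedy in the Banach envelope. -/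

import Mathlib

open Filter Topology
open scoped ENNReal

universe u v

noncomputable section

namespace TGA

/-! ### Quasi-Banach spaces, presented by their quasi-norm -/

section QuasiNorm

variable (𝕜 : Type u) [RCLike 𝕜] {X : Type v} [AddCommGroup X] [Module 𝕜 X]

/-- `N` is a quasi-norm on the vector space `X`. -/
structure IsQuasiNorm (N : X → ℝ) : Prop where
  nonneg : ∀ f, 0 ≤ N f
  pos : ∀ f, f ≠ 0 → 0 < N f
  smul : ∀ (t : 𝕜) (f : X), N (t • f) = ‖t‖ * N f
  add : ∃ κ : ℝ, ∀ f g : X, N (f + g) ≤ κ * (N f + N g)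

/-- `(X, N)` is a complete quasi-normed space. -/
structure IsQuasiBanach (N : X → ℝ) : Prop extends IsQuasiNorm 𝕜 N where
  complete : ∀ u : ℕ → X,
    (∀ ε : ℝ, 0 < ε → ∃ n₀, ∀ m n, n₀ ≤ m → n₀ ≤ n → N (u m - u n) < ε) →
      ∃ f : X, Tendsto (fun n => N (u n - f)) atTop (𝓝 0)

/-- Absolutely `p`-convex sets. -/
def AbsolutelyPConvex (p : ℝ) (D : Set X) : Prop :=
  ∀ (n : ℕ) (f : Fin n → X) (t : Fin n → 𝕜), (∀ j, f j ∈ D) →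
    ∑ j, ‖t j‖ ^ p ≤ 1 → ∑ j, t j • f j ∈ D

/-- `(X, N)` is locally `p`-convex: the origin has a bounded absolutely `p`-convex
neighbourhood. -/
def LocallyPConvex (N : X → ℝ) (p : ℝ) : Prop :=
  ∃ D : Set X, AbsolutelyPConvex 𝕜 p D ∧
    (∃ r : ℝ, 0 < r ∧ ∀ f, N f ≤ r → f ∈ D) ∧ ∃ R : ℝ, ∀ f ∈ D, N f ≤ R

/-! ### Bases -/

/-- `x` is a Schauder basis: every vector has a unique convergent expansion. -/
def IsSchauderBasis (N : X → ℝ) (x : ℕ → X) : Prop :=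
  ∀ f : X, ∃! a : ℕ → 𝕜,
    Tendsto (fun m : ℕ => N (f - ∑ n ∈ Finset.range m, a n • x n)) atTop (𝓝 0)

/-- `x` is a complete, semi-normalized, `M`-bounded minimal system, with (necessarily unique)
continuous coordinate functionals `xs`. -/
structure IsWBasis (N : X → ℝ) (x : ℕ → X) (xs : ℕ → X →ₗ[𝕜] 𝕜) : Prop where
  continuous : ∀ n, ∃ C : ℝ, ∀ f, ‖xs n f‖ ≤ C * N f
  biorthogonal : ∀ n k, xs n (x k) = if n = k then 1 else 0
  complete : ∀ f : X, ∀ ε : ℝ, 0 < ε → ∃ g ∈ Submodule.span 𝕜 (Set.range x), N (f - g) < ε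
  seminormalized : ∃ c C : ℝ, 0 < c ∧ ∀ n, c ≤ N (x n) ∧ N (x n) ≤ C
  mbounded : ∃ C : ℝ, ∀ n f, N (xs n f • x n) ≤ C * N f

variable {𝕜} in
/-- The finite set `A` is a greedy set of the sequence `a`. -/
def IsGreedySet (a : ℕ → 𝕜) (A : Finset ℕ) : Prop :=
  ∀ n ∈ A, ∀ k, k ∉ A → ‖a k‖ ≤ ‖a n‖

variable {𝕜} in
/-- Coordinate projection onto the finite set `A`. -/
def coordProj (x : ℕ → X) (xs : ℕ → X →ₗ[𝕜] 𝕜) (A : Finset ℕ) (f : X) : X :=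
  ∑ n ∈ A, xs n f • x n

/-- Quasi-greedy bases. -/
def IsQuasiGreedy (N : X → ℝ) (x : ℕ → X) : Prop :=
  ∃ xs : ℕ → X →ₗ[𝕜] 𝕜, IsWBasis 𝕜 N x xs ∧
    ∃ C : ℝ, ∀ f, N f ≤ 1 → ∀ A, IsGreedySet (fun n => xs n f) A →
      N (f - coordProj x xs A f) ≤ C

/-- Almost greedy bases. -/
def IsAlmostGreedy (N : X → ℝ) (x : ℕ → X) : Prop :=
  ∃ xs : ℕ → X →ₗ[𝕜] 𝕜, IsWBasis 𝕜 N x xs ∧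
    ∃ C : ℝ, 1 ≤ C ∧ ∀ f A, IsGreedySet (fun n => xs n f) A →
      ∀ B : Finset ℕ, B.card ≤ A.card →
        N (f - coordProj x xs A f) ≤ C * N (f - coordProj x xs B f)

/-- Democratic sequences. -/
def IsDemocratic {X : Type v} [AddCommGroup X] (N : X → ℝ) (x : ℕ → X) : Prop :=
  ∃ C : ℝ, ∀ A B : Finset ℕ, A.card ≤ B.card → N (∑ n ∈ A, x n) ≤ C * N (∑ n ∈ B, x n)

/-- Sequences that are unconditional for constant coefficients. -/
def IsUnconditionalForConstCoeffs (N : X → ℝ) (x : ℕ → X) : Prop :=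
  ∃ C : ℝ, 1 ≤ C ∧ ∀ A B : Finset ℕ, A ⊆ B → ∀ ε : ℕ → 𝕜, (∀ n ∈ B, ‖ε n‖ = 1) →
    N (∑ n ∈ A, ε n • x n) ≤ C * N (∑ n ∈ B, ε n • x n)

/-- `‖1_A[x]‖ ≈ |A|` for finite `A`. -/
def IndicatorsLinear {X : Type v} [AddCommGroup X] (N : X → ℝ) (x : ℕ → X) : Prop :=
  ∃ c C : ℝ, 0 < c ∧ ∀ A : Finset ℕ,
    c * (A.card : ℝ) ≤ N (∑ n ∈ A, x n) ∧ N (∑ n ∈ A, x n) ≤ C * (A.card : ℝ)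

/-- The Banach space `E` with the linear map `J : X → E` is the Banach envelope of `(X, N)`:
`J` is a contraction, and every continuous linear map `T` from `X` to a Banach space factors
uniquely through `J` by a continuous linear map whose norm is at most that of `T`. -/
structure IsBanachEnvelope {X : Type u} [AddCommGroup X] [Module 𝕜 X] (N : X → ℝ)
    {E : Type u} [NormedAddCommGroup E] [NormedSpace 𝕜 E] [CompleteSpace E]
    (J : X →ₗ[𝕜] E) : Prop where
  contraction : ∀ f, ‖J f‖ ≤ N f
  universal : ∀ (Y : Type u) [NormedAddCommGroup Y] [NormedSpace 𝕜 Y] [CompleteSpace Y]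
    (T : X →ₗ[𝕜] Y) (C : ℝ), 0 ≤ C → (∀ f, ‖T f‖ ≤ C * N f) →
      ∃ That : E →L[𝕜] Y, (∀ f, That (J f) = T f) ∧ ‖That‖ ≤ C ∧
        ∀ S : E →L[𝕜] Y, (∀ f, S (J f) = T f) → S = That

end QuasiNorm

/-! ### The concrete sequence spaces (sequences are indexed from `0`) -/

section SequenceSpaces

variable {𝕜 : Type u} [RCLike 𝕜]

/-- `β(f, A) = sup_I |∑_{n ∈ I \ A} f n|` over the finite intervals `I`. -/
def beta (f : ℕ → 𝕜) (A : Finset ℕ) : ℝ≥0∞ :=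
  ⨆ (a : ℕ) (b : ℕ), ‖∑ n ∈ Finset.Icc a b \ A, f n‖ₑ

/-- The gauge `‖f‖_B`, the supremum of `β(f, A)` over the greedy sets `A` of `f`. -/
def normB (f : ℕ → 𝕜) : ℝ≥0∞ :=
  ⨆ (A : Finset ℕ) (_ : IsGreedySet f A), beta f A

variable (𝕜) in
/-- The space `B₀`: null sequences with `lim β(f, A) = 0` along the greedy sets of `f`, directed
by inclusion. -/
def spaceB0 : Set (ℕ → 𝕜) :=
  {f | Tendsto f atTop (𝓝 0) ∧
    Tendsto (fun A : {A : Finset ℕ // IsGreedySet f A} => beta f A) atTop (𝓝 0)}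

/-- Nonincreasing rearrangement of `|f|`: `rearr f m` is the `(m+1)`-st largest value. -/
def rearr (f : ℕ → 𝕜) (m : ℕ) : ℝ≥0∞ :=
  sInf {s : ℝ≥0∞ | {n : ℕ | s < ‖f n‖ₑ}.encard ≤ (m : ℕ∞)}

/-- The Lorentz gauge `‖f‖_{1,q}`. -/
def lorentzNorm (q : ℝ≥0∞) (f : ℕ → 𝕜) : ℝ≥0∞ :=
  if q = ∞ then ⨆ m : ℕ, ((m : ℝ≥0∞) + 1) * rearr f m
  else (∑' m : ℕ, (((m : ℝ≥0∞) + 1) ^ (1 - 1 / q.toReal) * rearr f m) ^ q.toReal) ^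
    (1 / q.toReal)

variable (𝕜) in
/-- The Lorentz space `ℓ_{1,q}` if `q < ∞`, and the separable part `h_{1,∞}` of `ℓ_{1,∞}` if
`q = ∞`. -/
def lorentzSpace (q : ℝ≥0∞) : Set (ℕ → 𝕜) :=
  {f | lorentzNorm q f < ∞ ∧
    (q = ∞ → Tendsto (fun m : ℕ => ((m : ℝ≥0∞) + 1) * rearr f m) atTop (𝓝 0))}

end SequenceSpaces

end TGA

end

noncomputable section

namespace TGA

/-! ### Power sums and a weighted Hardy inequality -/

section Sums

open Finset

/-! The gauge `normB` is awkward for sums, since the greedy sets of a sum are unrelated to those of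
its summands. It is replaced by `truncNorm`, built on sums over the pieces {n ∈ I : |f n| ≤ t} of
intervals I. For a null sequence the level sets {|f| > t}, t > 0, are greedy; conversely a greedy
set with smallest modulus t differs from {|f| > t} only in entries of modulus exactly t, and their
number times t is at most the weak-ℓ₁ gauge. Hence `gauge` and `truncGauge` are equivalent
(`exists_gauge_le`).

The same principle, that discarding k entries of modulus at most t costs k·t and that k·t is
controlled by the weak-ℓ₁ gauge, carries the rest. It gives p-convexity of the truncated sums
(`exists_truncNorm_sum_rpow_le`) and the comparison of a greedy residual with any residual of no
larger cardinality (`truncNorm_greedy_le`). The Lorentz part is p-convex because Hardy's inequality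
allows p-averages in place of the rearrangement, and Minkowski's inequality applies to those. Both
parts are lower semicontinuous under coordinatewise convergence, which yields completeness. Finally
𝔹₀ ∩ 𝕊_q is the closure of the finitely supported sequences (`coe_approxSpace`), which gives
linearity and convergence of the expansions.

In the envelope, sums over intervals remain functionals of norm at most 1, so indicators keep norm
|A|. Averaging, however, makes alternating sums small. Let H be the N-th harmonic sum. The sequence
c₀, -c₀, c₁, -c₁, … with c a permutation of 1, 1/2, …, 1/N has quasi-norm O(H^(1/q)), because its
pairs cancel inside every truncated interval. The N cyclic permutations add up to H times ∑ (-1)^n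
e_n over n < 2N, so in the envelope this vector has norm O(N · H^(1/q - 1)) = o(N), while its even
half has norm N. This excludes unconditionality for constant coefficients, a property that every
quasi-greedy basis has. -/

theorem natCast_succ_rpow (m : ℕ) (e : ℝ) :
    ((m : ℝ≥0∞) + 1) ^ e = ENNReal.ofReal (((m : ℝ) + 1) ^ e) := by
  rw [← ENNReal.ofReal_rpow_of_pos (by positivity), ENNReal.ofReal_add (by positivity) (by simp)]
  simp

theorem natCast_succ_ne_top (m : ℕ) : (m : ℝ≥0∞) + 1 ≠ ∞ := by simp

theorem natCast_succ_ne_zero (m : ℕ) : (m : ℝ≥0∞) + 1 ≠ 0 := by simp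

/-- Telescoping: Bernoulli's inequality for the exponent 1 - δ at -1/(n+1) bounds each term by an
increment of (1 - δ)⁻¹ n^(1-δ). -/
theorem sum_rpow_neg_le {δ : ℝ} (h0 : 0 < δ) (h1 : δ < 1) (n : ℕ) :
    ∑ i ∈ range n, ((i : ℝ) + 1) ^ (-δ) ≤ (1 - δ)⁻¹ * (n : ℝ) ^ (1 - δ) := by
  have h2 : 0 < 1 - δ := by linarith
  induction n with
  | zero => simp [Real.zero_rpow h2.ne']
  | succ n ih =>
    rw [sum_range_succ]
    have hx : (0 : ℝ) < (n : ℝ) + 1 := by positivity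
    have key : (n : ℝ) ^ (1 - δ) ≤ ((n : ℝ) + 1) ^ (1 - δ) - (1 - δ) * ((n : ℝ) + 1) ^ (-δ) := by
      have hs : (-1 : ℝ) ≤ -((n : ℝ) + 1)⁻¹ := by
        rw [neg_le_neg_iff]; exact inv_le_one_of_one_le₀ (by linarith [n.cast_nonneg (α := ℝ)])
      have hb := rpow_one_add_le_one_add_mul_self hs h2.le (by linarith)
      have e1 : (n : ℝ) = ((n : ℝ) + 1) * (1 + -((n : ℝ) + 1)⁻¹) := by field_simp; ring
      have e2 : ((n : ℝ) + 1) ^ (-δ) = ((n : ℝ) + 1) ^ (1 - δ) * ((n : ℝ) + 1)⁻¹ := by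
        rw [← Real.rpow_neg_one, ← Real.rpow_add hx]; ring_nf
      calc (n : ℝ) ^ (1 - δ)
          = ((n : ℝ) + 1) ^ (1 - δ) * (1 + -((n : ℝ) + 1)⁻¹) ^ (1 - δ) := by
            conv_lhs => rw [e1]
            rw [Real.mul_rpow hx.le (by linarith)]
        _ ≤ ((n : ℝ) + 1) ^ (1 - δ) * (1 + (1 - δ) * -((n : ℝ) + 1)⁻¹) := by gcongr
        _ = _ := by rw [e2]; ring
    have : ((n : ℝ) + 1) ^ (-δ)
        ≤ (1 - δ)⁻¹ * (((n : ℝ) + 1) ^ (1 - δ) - (n : ℝ) ^ (1 - δ)) := by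
      rw [inv_mul_eq_div, le_div_iff₀ h2]; linarith
    push_cast
    linarith

/-- Telescoping again, with Bernoulli's inequality at -1/(M+2). The factor 2 pays for replacing
1/(M+1) by 1/(M+2). -/
theorem sum_Ico_rpow_neg_le {η : ℝ} (h0 : 0 < η) (h1 : η ≤ 1) (i M : ℕ) (hM : i ≤ M) :
    ∑ m ∈ Ico i M, ((m : ℝ) + 1) ^ (-1 - η) ≤
      2 / η * (((i : ℝ) + 1) ^ (-η) - ((M : ℝ) + 1) ^ (-η)) := by
  induction M, hM using Nat.le_induction with
  | base => simp
  | succ M hM ih =>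
    rw [sum_Ico_succ_top hM]
    have hx : (0 : ℝ) < (M : ℝ) + 1 := by positivity
    have hy : (0 : ℝ) < (M : ℝ) + 1 + 1 := by positivity
    have hs : (-1 : ℝ) ≤ -((M : ℝ) + 1 + 1)⁻¹ := by
      rw [neg_le_neg_iff]; exact inv_le_one_of_one_le₀ (by linarith)
    have hb := rpow_one_add_le_one_add_mul_self hs h0.le h1
    have e1 : (1 + -((M : ℝ) + 1 + 1)⁻¹) = ((M : ℝ) + 1) / ((M : ℝ) + 1 + 1) := by
      field_simp; ring
    rw [e1, Real.div_rpow hx.le hy.le] at hb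
    have e2 : ((M : ℝ) + 1 + 1) ^ (-η)
        = ((M : ℝ) + 1) ^ (-η) * (((M : ℝ) + 1) ^ η / ((M : ℝ) + 1 + 1) ^ η) := by
      rw [Real.rpow_neg hx.le, Real.rpow_neg hy.le]
      have := (Real.rpow_pos_of_pos hx η).ne'
      field_simp
    have e3 : ((M : ℝ) + 1) ^ (-1 - η) = ((M : ℝ) + 1) ^ (-η) * ((M : ℝ) + 1)⁻¹ := by
      rw [← Real.rpow_neg_one, ← Real.rpow_add hx]; ring_nf
    have hp := Real.rpow_pos_of_pos hx (-η)
    have h3 : ((M : ℝ) + 1)⁻¹ ≤ 2 * ((M : ℝ) + 1 + 1)⁻¹ := by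
      rw [← div_eq_mul_inv, inv_eq_one_div, div_le_div_iff₀ hx hy]; linarith
    have key : ((M : ℝ) + 1) ^ (-1 - η)
        ≤ 2 / η * (((M : ℝ) + 1) ^ (-η) - ((M : ℝ) + 1 + 1) ^ (-η)) := by
      rw [e2, e3, div_mul_eq_mul_div, le_div_iff₀ h0]
      calc ((M : ℝ) + 1) ^ (-η) * ((M : ℝ) + 1)⁻¹ * η
          ≤ ((M : ℝ) + 1) ^ (-η) * (2 * ((M : ℝ) + 1 + 1)⁻¹) * η := by gcongr
        _ = 2 * (((M : ℝ) + 1) ^ (-η) * (η * ((M : ℝ) + 1 + 1)⁻¹)) := by ring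
        _ ≤ 2 * (((M : ℝ) + 1) ^ (-η) *
              (1 - ((M : ℝ) + 1) ^ η / ((M : ℝ) + 1 + 1) ^ η)) := by
            gcongr; linarith
        _ = _ := by ring
    push_cast
    linarith

theorem ennreal_sum_rpow_neg_le {δ : ℝ} (h0 : 0 < δ) (h1 : δ < 1) (n : ℕ) :
    ∑ i ∈ range n, ((i : ℝ≥0∞) + 1) ^ (-δ) ≤
      ENNReal.ofReal (1 - δ)⁻¹ * (n : ℝ≥0∞) ^ (1 - δ) := by
  have h2 : 0 < 1 - δ := by linarith
  simp_rw [natCast_succ_rpow]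
  rw [← ENNReal.ofReal_sum_of_nonneg fun i _ => by positivity, ← ENNReal.ofReal_natCast n,
    ENNReal.ofReal_rpow_of_nonneg (by positivity) h2.le, ← ENNReal.ofReal_mul (by positivity)]
  exact ENNReal.ofReal_le_ofReal (sum_rpow_neg_le h0 h1 n)

theorem ennreal_tsum_tail_rpow_le {η : ℝ} (h0 : 0 < η) (h1 : η ≤ 1) (i : ℕ) :
    ∑' m : ℕ, (if i ≤ m then ((m : ℝ≥0∞) + 1) ^ (-1 - η) else 0) ≤
      ENNReal.ofReal (2 / η) * ((i : ℝ≥0∞) + 1) ^ (-η) := by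
  refine ENNReal.tsum_le_of_sum_range_le fun M => ?_
  rcases le_total M i with hM | hM
  · rw [sum_eq_zero]
    · exact zero_le
    · intro m hm
      rw [if_neg]
      have := mem_range.1 hm
      omega
  · have : ∑ m ∈ range M, (if i ≤ m then ((m : ℝ≥0∞) + 1) ^ (-1 - η) else 0)
        = ∑ m ∈ Ico i M, ((m : ℝ≥0∞) + 1) ^ (-1 - η) := by
      rw [← sum_filter]
      congr 1
      ext m
      simp [and_comm]
    rw [this]
    simp_rw [natCast_succ_rpow]
    rw [← ENNReal.ofReal_sum_of_nonneg fun i _ => by positivity,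
      ← ENNReal.ofReal_mul (by positivity)]
    refine ENNReal.ofReal_le_ofReal ((sum_Ico_rpow_neg_le h0 h1 i M hM).trans ?_)
    gcongr
    have : 0 < ((M : ℝ) + 1) ^ (-η) := by positivity
    linarith

/-- Jensen's inequality for finite weighted sums. -/
theorem rpow_sum_mul_le {ι : Type*} (s : Finset ι) {R : ℝ} (hR : 1 ≤ R) (w z : ι → ℝ≥0∞) :
    (∑ i ∈ s, w i * z i) ^ R ≤ (∑ i ∈ s, w i) ^ (R - 1) * ∑ i ∈ s, w i * z i ^ R := by
  have hR0 : R ≠ 0 := by linarith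
  refine (ENNReal.rpow_le_rpow (ENNReal.inner_le_weight_mul_Lp_of_nonneg s hR w z)
    (by linarith)).trans_eq ?_
  rw [ENNReal.mul_rpow_of_nonneg _ _ (by linarith), ← ENNReal.rpow_mul, ← ENNReal.rpow_mul,
    inv_mul_cancel₀ hR0, ENNReal.rpow_one, sub_mul, inv_mul_cancel₀ hR0, one_mul]

/-- A weighted Hardy inequality. -/
theorem hardy {q R : ℝ} (hq : 1 < q) (hR : q < R) :
    ∃ C : ℝ≥0∞, C ≠ ∞ ∧ ∀ a : ℕ → ℝ≥0∞,
      ∑' m : ℕ, ((m : ℝ≥0∞) + 1) ^ (q - 1) * (((m : ℝ≥0∞) + 1)⁻¹ * ∑ i ∈ range (m + 1), a i) ^ R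
        ≤ C * ∑' m : ℕ, ((m : ℝ≥0∞) + 1) ^ (q - 1) * a m ^ R := by
  obtain ⟨η, hη0, hη1, hηR⟩ : ∃ η : ℝ, 0 < η ∧ η ≤ 1 ∧ η < R - q :=
    ⟨min 1 ((R - q) / 2), lt_min one_pos (by linarith), min_le_left _ _,
      (min_le_right _ _).trans_lt (by linarith)⟩
  have hR1 : 0 < R - 1 := by linarith
  -- Jensen's inequality is used with the weights (i+1)^(-δ). Since δ(R-1) = q-1+η, the power of m+1
  -- left over is -1-η. After exchanging the sums, its tail from i on is of order (i+1)^(-η), which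
  -- turns (i+1)^(q-1+η) back into (i+1)^(q-1). The bound η < R - q is what makes δ < 1.
  set δ : ℝ := (q - 1 + η) / (R - 1) with hδ
  have hδ0 : 0 < δ := div_pos (by linarith) hR1
  have hδ1 : δ < 1 := (div_lt_one hR1).2 (by linarith)
  have hδR : δ * (R - 1) = q - 1 + η := div_mul_cancel₀ _ hR1.ne'
  set C₁ : ℝ≥0∞ := ENNReal.ofReal (1 - δ)⁻¹ with hC₁
  set C₂ : ℝ≥0∞ := ENNReal.ofReal (2 / η) with hC₂
  refine ⟨C₁ ^ (R - 1) * C₂, ENNReal.mul_ne_top (ENNReal.rpow_ne_top_of_nonneg hR1.le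
    ENNReal.ofReal_ne_top) ENNReal.ofReal_ne_top, fun a => ?_⟩
  have step : ∀ m : ℕ,
      ((m : ℝ≥0∞) + 1) ^ (q - 1) * (((m : ℝ≥0∞) + 1)⁻¹ * ∑ i ∈ range (m + 1), a i) ^ R ≤
        C₁ ^ (R - 1) * ∑' i : ℕ, (if i ≤ m then ((m : ℝ≥0∞) + 1) ^ (-1 - η) else 0) *
          (((i : ℝ≥0∞) + 1) ^ (q - 1 + η) * a i ^ R) := by
    intro m
    set b : ℝ≥0∞ := (m : ℝ≥0∞) + 1 with hb
    have hb0 : b ≠ 0 := natCast_succ_ne_zero m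
    have hbt : b ≠ ∞ := natCast_succ_ne_top m
    have e1 : ∑ i ∈ range (m + 1), a i =
        ∑ i ∈ range (m + 1), ((i : ℝ≥0∞) + 1) ^ (-δ) * (((i : ℝ≥0∞) + 1) ^ δ * a i) := by
      refine sum_congr rfl fun i _ => ?_
      rw [← mul_assoc, ← ENNReal.rpow_add _ _ (natCast_succ_ne_zero i) (natCast_succ_ne_top i)]
      simp
    have e2 : ∀ i : ℕ, ((i : ℝ≥0∞) + 1) ^ (-δ) * (((i : ℝ≥0∞) + 1) ^ δ * a i) ^ R =
        ((i : ℝ≥0∞) + 1) ^ (q - 1 + η) * a i ^ R := by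
      intro i
      rw [ENNReal.mul_rpow_of_nonneg _ _ (by linarith), ← ENNReal.rpow_mul, ← mul_assoc,
        ← ENNReal.rpow_add _ _ (natCast_succ_ne_zero i) (natCast_succ_ne_top i)]
      congr 2
      linarith
    have e3 : ∑' i : ℕ, (if i ≤ m then b ^ (-1 - η) else 0) *
          (((i : ℝ≥0∞) + 1) ^ (q - 1 + η) * a i ^ R) =
        b ^ (-1 - η) * ∑ i ∈ range (m + 1), ((i : ℝ≥0∞) + 1) ^ (q - 1 + η) * a i ^ R := by
      rw [tsum_eq_sum (s := range (m + 1)), mul_sum]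
      · refine sum_congr rfl fun i hi => ?_
        rw [if_pos (by have := mem_range.1 hi; omega)]
      · intro i hi
        rw [if_neg (by simpa using hi), zero_mul]
    have h1 := rpow_sum_mul_le (range (m + 1)) (R := R) (by linarith)
      (fun i : ℕ => ((i : ℝ≥0∞) + 1) ^ (-δ)) (fun i => ((i : ℝ≥0∞) + 1) ^ δ * a i)
    simp_rw [e2] at h1
    rw [← e1] at h1
    have h2 := ennreal_sum_rpow_neg_le hδ0 hδ1 (m + 1)
    have hb' : ((m + 1 : ℕ) : ℝ≥0∞) = b := by simp [hb]
    rw [hb'] at h2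
    rw [e3, ENNReal.mul_rpow_of_nonneg _ _ (by linarith)]
    calc b ^ (q - 1) * (b⁻¹ ^ R * (∑ i ∈ range (m + 1), a i) ^ R)
        ≤ b ^ (q - 1) * (b⁻¹ ^ R * ((C₁ * b ^ (1 - δ)) ^ (R - 1) *
            ∑ i ∈ range (m + 1), ((i : ℝ≥0∞) + 1) ^ (q - 1 + η) * a i ^ R)) := by
          gcongr
          exact h1.trans (mul_le_mul_left (ENNReal.rpow_le_rpow h2 hR1.le) _)
      _ = C₁ ^ (R - 1) * ((b ^ (q - 1) * (b ^ (-R) * b ^ ((1 - δ) * (R - 1)))) *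
            ∑ i ∈ range (m + 1), ((i : ℝ≥0∞) + 1) ^ (q - 1 + η) * a i ^ R) := by
          rw [ENNReal.mul_rpow_of_nonneg _ _ hR1.le, ← ENNReal.rpow_mul, ENNReal.inv_rpow,
            ← ENNReal.rpow_neg]
          ring
      _ = _ := by
          rw [← ENNReal.rpow_add _ _ hb0 hbt, ← ENNReal.rpow_add _ _ hb0 hbt]
          rw [show q - 1 + (-R + (1 - δ) * (R - 1)) = -1 - η by linarith]
  calc _ ≤ ∑' m : ℕ, C₁ ^ (R - 1) * ∑' i : ℕ,
          (if i ≤ m then ((m : ℝ≥0∞) + 1) ^ (-1 - η) else 0) *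
          (((i : ℝ≥0∞) + 1) ^ (q - 1 + η) * a i ^ R) := ENNReal.tsum_le_tsum step
    _ = C₁ ^ (R - 1) * ∑' i : ℕ, (∑' m : ℕ,
          (if i ≤ m then ((m : ℝ≥0∞) + 1) ^ (-1 - η) else 0)) *
          (((i : ℝ≥0∞) + 1) ^ (q - 1 + η) * a i ^ R) := by
        rw [ENNReal.tsum_mul_left, ENNReal.tsum_comm]
        simp_rw [ENNReal.tsum_mul_right]
    _ ≤ C₁ ^ (R - 1) * ∑' i : ℕ, (C₂ * ((i : ℝ≥0∞) + 1) ^ (-η)) *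
          (((i : ℝ≥0∞) + 1) ^ (q - 1 + η) * a i ^ R) := by
        gcongr with i
        exact ennreal_tsum_tail_rpow_le hη0 hη1 i
    _ = _ := by
        rw [mul_assoc (C₁ ^ (R - 1)), ← ENNReal.tsum_mul_left (a := C₂)]
        congr 2
        ext i
        rw [mul_assoc, ← mul_assoc (((i : ℝ≥0∞) + 1) ^ (-η)),
          ← ENNReal.rpow_add _ _ (natCast_succ_ne_zero i) (natCast_succ_ne_top i)]
        ring_nf

/-- Minkowski's inequality for `ℝ≥0∞`-valued series. -/
theorem tsum_rpow_add_le {R : ℝ} (hR : 1 ≤ R) (a b : ℕ → ℝ≥0∞) :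
    (∑' m, (a m + b m) ^ R) ^ (1 / R) ≤
      (∑' m, a m ^ R) ^ (1 / R) + (∑' m, b m ^ R) ^ (1 / R) := by
  have := ENNReal.lintegral_Lp_add_le (μ := MeasureTheory.Measure.count) (f := a) (g := b)
    (measurable_of_countable a).aemeasurable (measurable_of_countable b).aemeasurable hR
  simpa [MeasureTheory.lintegral_count] using this

end Sums

/-! ### Rearrangements -/

section Rearrangement

open Finset

variable {𝕜 : Type u} [RCLike 𝕜]

theorem le_rearr {f : ℕ → 𝕜} {s : ℝ≥0∞} {m : ℕ} {A : Finset ℕ} (hA : m < A.card)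
    (h : ∀ n ∈ A, s ≤ ‖f n‖ₑ) : s ≤ rearr f m := by
  refine le_sInf fun s' hs' => ?_
  by_contra! hlt
  have hsub : (A : Set ℕ) ⊆ {n | s' < ‖f n‖ₑ} := fun n hn => hlt.trans_le (h n hn)
  have := (Set.encard_le_encard hsub).trans hs'
  rw [Set.encard_coe_eq_coe_finsetCard] at this
  have : A.card ≤ m := by exact_mod_cast this
  omega

/-- Together with `le_rearr` this trades the infimum in `rearr` for finite sets of large entries,
the form in which rearrangements are compared below. -/
theorem exists_finset_of_lt_rearr {f : ℕ → 𝕜} {s : ℝ≥0∞} {m : ℕ} (h : s < rearr f m) :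
    ∃ A : Finset ℕ, A.card = m + 1 ∧ ∀ n ∈ A, s < ‖f n‖ₑ := by
  have h1 : ¬ {n : ℕ | s < ‖f n‖ₑ}.encard ≤ (m : ℕ∞) := fun hs =>
    not_le_of_gt h (csInf_le' hs)
  have h2 : ((m + 1 : ℕ) : ℕ∞) ≤ {n : ℕ | s < ‖f n‖ₑ}.encard := by
    push_cast
    exact Order.add_one_le_of_lt (not_le.1 h1)
  obtain ⟨t, ht, htc⟩ := Set.exists_subset_encard_eq h2
  have hfin : t.Finite := Set.finite_of_encard_eq_coe htc
  refine ⟨hfin.toFinset, ?_, fun n hn => ht (by simpa using hn)⟩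
  rw [hfin.encard_eq_coe_toFinset_card] at htc
  exact_mod_cast htc

theorem rearr_antitone (f : ℕ → 𝕜) : Antitone (rearr f) := fun m k hmk =>
  sInf_le_sInf fun _ (hs : _ ≤ (m : ℕ∞)) =>
    show _ ≤ (k : ℕ∞) from hs.trans (by exact_mod_cast hmk)

/-- Comparison of rearrangements through level sets. -/
theorem rearr_add_le_rearr {f g : ℕ → 𝕜} (k : ℕ)
    (H : ∀ (s : ℝ≥0∞) (A : Finset ℕ), (∀ n ∈ A, s < ‖f n‖ₑ) →
      ∃ B : Finset ℕ, A.card ≤ B.card + k ∧ ∀ n ∈ B, s < ‖g n‖ₑ) (m : ℕ) :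
    rearr f (m + k) ≤ rearr g m := by
  refine le_of_forall_lt fun s hs => ?_
  obtain ⟨s', hs, hs'⟩ := exists_between hs
  obtain ⟨A, hA, hAs⟩ := exists_finset_of_lt_rearr hs'
  obtain ⟨B, hB, hBs⟩ := H s' A hAs
  exact hs.trans_le (le_rearr (by omega) fun n hn => (hBs n hn).le)

theorem rearr_mono {f g : ℕ → 𝕜} (h : ∀ n, ‖f n‖ₑ ≤ ‖g n‖ₑ) (m : ℕ) : rearr f m ≤ rearr g m :=
  rearr_add_le_rearr 0 (fun _ A hA => ⟨A, by simp, fun n hn => (hA n hn).trans_le (h n)⟩) m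

theorem rearr_le_of_forall_le {f : ℕ → 𝕜} {s : ℝ≥0∞} (h : ∀ n, ‖f n‖ₑ ≤ s) (m : ℕ) :
    rearr f m ≤ s := by
  refine sInf_le ?_
  have : {n : ℕ | s < ‖f n‖ₑ} = ∅ := by
    ext n; simpa using h n
  simp [this]

theorem rearr_zero_fun (m : ℕ) : rearr (0 : ℕ → 𝕜) m = 0 :=
  le_antisymm (rearr_le_of_forall_le (by simp) m) zero_le

theorem rearr_smul_le (c : 𝕜) (f : ℕ → 𝕜) (m : ℕ) : rearr (c • f) m ≤ ‖c‖ₑ * rearr f m := by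
  rcases eq_or_ne c 0 with rfl | hc
  · simp [rearr_zero_fun]
  refine le_of_forall_lt fun s hs => ?_
  obtain ⟨s', hs, hs'⟩ := exists_between hs
  obtain ⟨A, hA, hAs⟩ := exists_finset_of_lt_rearr hs'
  refine hs.trans_le ?_
  have hc0 : ‖c‖ₑ ≠ 0 := by simpa using hc
  rw [mul_comm, ← ENNReal.div_le_iff_le_mul (Or.inl hc0) (Or.inl enorm_ne_top)]
  refine le_rearr (A := A) (by omega) fun n hn => ?_
  rw [ENNReal.div_le_iff_le_mul (Or.inl hc0) (Or.inl enorm_ne_top), mul_comm]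
  simpa [enorm_mul] using (hAs n hn).le

theorem rearr_smul (c : 𝕜) (f : ℕ → 𝕜) (m : ℕ) : rearr (c • f) m = ‖c‖ₑ * rearr f m := by
  refine le_antisymm (rearr_smul_le c f m) ?_
  rcases eq_or_ne c 0 with rfl | hc
  · simp
  have h := rearr_smul_le c⁻¹ (c • f) m
  rw [inv_smul_smul₀ hc, enorm_inv hc] at h
  calc ‖c‖ₑ * rearr f m ≤ ‖c‖ₑ * (‖c‖ₑ⁻¹ * rearr (c • f) m) := by gcongr
    _ = rearr (c • f) m := by
      rw [← mul_assoc, ENNReal.mul_inv_cancel (by simpa using hc) enorm_ne_top, one_mul]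

theorem lowerSemicontinuous_rearr (m : ℕ) :
    LowerSemicontinuous fun f : ℕ → 𝕜 => rearr f m := by
  intro f s hs
  obtain ⟨s', hs, hs'⟩ := exists_between hs
  obtain ⟨A, hA, hAs⟩ := exists_finset_of_lt_rearr hs'
  have : ∀ᶠ g : ℕ → 𝕜 in 𝓝 f, ∀ n ∈ A, s' < ‖g n‖ₑ := by
    rw [Filter.eventually_all_finset]
    intro n hn
    have : Continuous fun g : ℕ → 𝕜 => ‖g n‖ₑ := (continuous_apply n).enorm
    exact this.continuousAt.eventually (lt_mem_nhds (hAs n hn))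
  filter_upwards [this] with g hg
  exact hs.trans_le (le_rearr (by omega) fun n hn => (hg n hn).le)

/-- Induction on the cardinality: the smallest of k + 1 chosen entries is at most `rearr f k`, and
it is the one to remove. -/
theorem sum_rpow_le_sum_rearr {p : ℝ} (hp : 0 ≤ p) (f : ℕ → 𝕜) (A : Finset ℕ) :
    ∑ n ∈ A, ‖f n‖ₑ ^ p ≤ ∑ i ∈ range A.card, rearr f i ^ p := by
  induction h : A.card generalizing A with
  | zero => rw [card_eq_zero.1 h]; simp
  | succ k ih =>
    obtain ⟨n, hn, hmin⟩ := A.exists_min_image (fun n => ‖f n‖ₑ) (card_pos.1 (by omega))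
    rw [← sum_erase_add _ _ hn, sum_range_succ]
    refine add_le_add (ih _ (by rw [card_erase_of_mem hn]; omega)) ?_
    exact ENNReal.rpow_le_rpow (le_rearr (by omega) hmin) hp

end Rearrangement

/-! ### The Lorentz functional on sequences -/

section LorentzSeq

open Finset

/-- The Lorentz functional of a nonnegative sequence. -/
def lorentzSeq (q : ℝ≥0∞) (r : ℕ → ℝ≥0∞) : ℝ≥0∞ :=
  if q = ∞ then ⨆ m : ℕ, ((m : ℝ≥0∞) + 1) * r m
  else (∑' m : ℕ, (((m : ℝ≥0∞) + 1) ^ (1 - 1 / q.toReal) * r m) ^ q.toReal) ^ (1 / q.toReal)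

theorem lorentzNorm_eq {𝕜 : Type u} [RCLike 𝕜] (q : ℝ≥0∞) (f : ℕ → 𝕜) :
    lorentzNorm q f = lorentzSeq q (rearr f) := rfl

variable {q : ℝ≥0∞}

theorem one_lt_toReal (hq : 1 < q) (hq' : q ≠ ∞) : 1 < q.toReal := by
  rw [← ENNReal.toReal_one]
  exact (ENNReal.toReal_lt_toReal ENNReal.one_ne_top hq').2 hq

theorem lorentzSeq_top (r : ℕ → ℝ≥0∞) : lorentzSeq ∞ r = ⨆ m : ℕ, ((m : ℝ≥0∞) + 1) * r m :=
  if_pos rfl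

theorem lorentzSeq_of_ne_top (hq : 1 < q) (hq' : q ≠ ∞) (r : ℕ → ℝ≥0∞) :
    lorentzSeq q r =
      (∑' m : ℕ, ((m : ℝ≥0∞) + 1) ^ (q.toReal - 1) * r m ^ q.toReal) ^ (1 / q.toReal) := by
  have h1 := one_lt_toReal hq hq'
  rw [lorentzSeq, if_neg hq']
  congr 2
  ext m
  rw [ENNReal.mul_rpow_of_nonneg _ _ (by linarith), ← ENNReal.rpow_mul]
  congr 2
  field_simp

theorem lorentzSeq_mono (hq : 1 < q) {r r' : ℕ → ℝ≥0∞} (h : ∀ m, r m ≤ r' m) :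
    lorentzSeq q r ≤ lorentzSeq q r' := by
  by_cases hq' : q = ∞
  · subst hq'
    rw [lorentzSeq_top, lorentzSeq_top]
    exact iSup_mono fun m => by gcongr; exact h m
  · have h1 := one_lt_toReal hq hq'
    rw [lorentzSeq_of_ne_top hq hq', lorentzSeq_of_ne_top hq hq']
    gcongr with m
    exact h m

theorem lorentzSeq_const_mul (hq : 1 < q) (c : ℝ≥0∞) (r : ℕ → ℝ≥0∞) :
    lorentzSeq q (fun m => c * r m) = c * lorentzSeq q r := by
  by_cases hq' : q = ∞
  · subst hq'
    rw [lorentzSeq_top, lorentzSeq_top, ENNReal.mul_iSup]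
    exact iSup_congr fun m => by ring
  · have h1 := one_lt_toReal hq hq'
    rw [lorentzSeq_of_ne_top hq hq', lorentzSeq_of_ne_top hq hq']
    have : ∀ m : ℕ, ((m : ℝ≥0∞) + 1) ^ (q.toReal - 1) * (c * r m) ^ q.toReal =
        c ^ q.toReal * (((m : ℝ≥0∞) + 1) ^ (q.toReal - 1) * r m ^ q.toReal) := fun m => by
      rw [ENNReal.mul_rpow_of_nonneg _ _ (by linarith)]; ring
    simp_rw [this]
    rw [ENNReal.tsum_mul_left, ENNReal.mul_rpow_of_nonneg _ _ (by positivity), ← ENNReal.rpow_mul,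
      mul_one_div_cancel (by linarith), ENNReal.rpow_one]

/-- Telescoping with the convex form of Bernoulli's inequality: (n+1)^Q - n^Q ≤ Q (n+1)^(Q-1). -/
theorem rpow_le_mul_sum {Q : ℝ} (hQ : 1 < Q) (n : ℕ) :
    (n : ℝ) ^ Q ≤ Q * ∑ i ∈ range n, ((i : ℝ) + 1) ^ (Q - 1) := by
  induction n with
  | zero => simp [Real.zero_rpow (by linarith : Q ≠ 0)]
  | succ n ih =>
    rw [sum_range_succ]
    have hx : (0 : ℝ) < (n : ℝ) + 1 := by positivity
    have hs : (-1 : ℝ) ≤ -((n : ℝ) + 1)⁻¹ := by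
      rw [neg_le_neg_iff]; exact inv_le_one_of_one_le₀ (by linarith [n.cast_nonneg (α := ℝ)])
    have hb := one_add_mul_self_le_rpow_one_add hs hQ.le
    have e1 : (1 + -((n : ℝ) + 1)⁻¹) = (n : ℝ) / ((n : ℝ) + 1) := by field_simp; ring
    rw [e1, Real.div_rpow n.cast_nonneg hx.le] at hb
    have e2 : ((n : ℝ) + 1) ^ (Q - 1) = ((n : ℝ) + 1) ^ Q * ((n : ℝ) + 1)⁻¹ := by
      rw [← Real.rpow_neg_one, ← Real.rpow_add hx]; ring_nf
    have hp := Real.rpow_pos_of_pos hx Q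
    rw [le_div_iff₀ hp] at hb
    push_cast
    rw [mul_add, e2]
    linarith

/-- This is the embedding of ℓ_{1,q} in ℓ_{1,∞}. For an antitone sequence the first m + 1 terms are
all at least `r m`, and their weights add up to at least a multiple of (m+1)^Q. -/
theorem mul_le_lorentzSeq (hq : 1 < q) : ∃ C : ℝ≥0∞, C ≠ ∞ ∧ ∀ r : ℕ → ℝ≥0∞, Antitone r →
    ∀ m : ℕ, ((m : ℝ≥0∞) + 1) * r m ≤ C * lorentzSeq q r := by
  by_cases hq' : q = ∞
  · subst hq'
    refine ⟨1, by simp, fun r _ m => ?_⟩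
    rw [one_mul, lorentzSeq_top]
    exact le_iSup (fun m : ℕ => ((m : ℝ≥0∞) + 1) * r m) m
  have h1 := one_lt_toReal hq hq'
  set Q := q.toReal
  have hQ0 : 0 < Q := by linarith
  refine ⟨ENNReal.ofReal Q ^ (1 / Q), ENNReal.rpow_ne_top_of_nonneg (by positivity)
    ENNReal.ofReal_ne_top, fun r hr m => ?_⟩
  rw [lorentzSeq_of_ne_top hq hq', ← ENNReal.mul_rpow_of_nonneg _ _ (by positivity),
    one_div, ENNReal.le_rpow_inv_iff hQ0, ENNReal.mul_rpow_of_nonneg _ _ hQ0.le]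
  have h2 : ((m : ℝ≥0∞) + 1) ^ Q ≤
      ENNReal.ofReal Q * ∑ i ∈ range (m + 1), ((i : ℝ≥0∞) + 1) ^ (Q - 1) := by
    simp_rw [natCast_succ_rpow]
    rw [← ENNReal.ofReal_sum_of_nonneg fun i _ => by positivity, ← ENNReal.ofReal_mul hQ0.le]
    refine ENNReal.ofReal_le_ofReal ?_
    simpa using rpow_le_mul_sum h1 (m + 1)
  calc ((m : ℝ≥0∞) + 1) ^ Q * r m ^ Q
      ≤ (ENNReal.ofReal Q * ∑ i ∈ range (m + 1), ((i : ℝ≥0∞) + 1) ^ (Q - 1)) * r m ^ Q := by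
        gcongr
    _ = ENNReal.ofReal Q * ∑ i ∈ range (m + 1), ((i : ℝ≥0∞) + 1) ^ (Q - 1) * r m ^ Q := by
        rw [mul_assoc, sum_mul]
    _ ≤ ENNReal.ofReal Q * ∑ i ∈ range (m + 1), ((i : ℝ≥0∞) + 1) ^ (Q - 1) * r i ^ Q := by
        gcongr with i hi
        exact hr (by have := mem_range.1 hi; omega)
    _ ≤ _ := by
        gcongr
        exact ENNReal.sum_le_tsum _

/-- In terms of the p-th powers a and b, the p-th power of the functional is a weighted ℓ_{Q/p}
norm. As Q/p ≥ 1, Minkowski's inequality applies; for q = ∞ the estimate is pointwise. -/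
theorem lorentzSeq_add_rpow_le (hq : 1 < q) {p : ℝ} (hp0 : 0 < p) (hp1 : p < 1)
    (a b : ℕ → ℝ≥0∞) :
    lorentzSeq q (fun m => (a m + b m) ^ (1 / p)) ^ p ≤
      lorentzSeq q (fun m => a m ^ (1 / p)) ^ p + lorentzSeq q (fun m => b m ^ (1 / p)) ^ p := by
  by_cases hq' : q = ∞
  · subst hq'
    simp_rw [lorentzSeq_top]
    rw [one_div, ← ENNReal.le_rpow_inv_iff hp0]
    refine iSup_le fun m => ?_
    rw [ENNReal.le_rpow_inv_iff hp0, ENNReal.mul_rpow_of_nonneg _ _ hp0.le,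
      ENNReal.rpow_inv_rpow hp0.ne', mul_add]
    have key : ∀ c : ℕ → ℝ≥0∞, ((m : ℝ≥0∞) + 1) ^ p * c m ≤
        (⨆ m : ℕ, ((m : ℝ≥0∞) + 1) * c m ^ p⁻¹) ^ p := fun c => by
      have := ENNReal.rpow_le_rpow
        (le_iSup (fun m : ℕ => ((m : ℝ≥0∞) + 1) * c m ^ p⁻¹) m) hp0.le
      rwa [ENNReal.mul_rpow_of_nonneg _ _ hp0.le, ENNReal.rpow_inv_rpow hp0.ne'] at this
    exact add_le_add (key a) (key b)
  · have h1 := one_lt_toReal hq hq'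
    simp_rw [lorentzSeq_of_ne_top hq hq']
    set Q := q.toReal
    have hQ0 : 0 < Q := by linarith
    have hR : 1 ≤ Q / p := by rw [le_div_iff₀ hp0]; linarith
    have key : ∀ c : ℕ → ℝ≥0∞,
        ((∑' m : ℕ, ((m : ℝ≥0∞) + 1) ^ (Q - 1) * (c m ^ (1 / p)) ^ Q) ^ (1 / Q)) ^ p =
        (∑' m : ℕ, (((m : ℝ≥0∞) + 1) ^ ((Q - 1) / (Q / p)) * c m) ^ (Q / p)) ^ (1 / (Q / p)) := by
      intro c
      rw [← ENNReal.rpow_mul]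
      congr 1
      · congr 1
        ext m
        rw [ENNReal.mul_rpow_of_nonneg _ _ (by linarith), ← ENNReal.rpow_mul, ← ENNReal.rpow_mul,
          div_mul_cancel₀ _ (by positivity)]
        congr 2
        ring
      · field_simp
    rw [key, key, key]
    simp_rw [mul_add]
    exact tsum_rpow_add_le hR _ _

/-- Hardy's inequality for the sequence r^p with exponent R = Q/p. The condition p < 1 enters as Q <
R. For q = ∞ the bound r i ≤ W/(i+1) and a power sum suffice. -/
theorem lorentzSeq_average_le (hq : 1 < q) {p : ℝ} (hp0 : 0 < p) (hp1 : p < 1) :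
    ∃ C : ℝ≥0∞, C ≠ ∞ ∧ ∀ r : ℕ → ℝ≥0∞,
      lorentzSeq q (fun m => (((m : ℝ≥0∞) + 1)⁻¹ * ∑ i ∈ range (m + 1), r i ^ p) ^ (1 / p)) ≤
        C * lorentzSeq q r := by
  by_cases hq' : q = ∞
  · subst hq'
    set C₁ := ENNReal.ofReal (1 - p)⁻¹
    refine ⟨C₁ ^ (1 / p), ENNReal.rpow_ne_top_of_nonneg (by positivity) ENNReal.ofReal_ne_top,
      fun r => ?_⟩
    rw [lorentzSeq_top, lorentzSeq_top]
    set W := ⨆ m : ℕ, ((m : ℝ≥0∞) + 1) * r m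
    refine iSup_le fun m => ?_
    have hb0 := natCast_succ_ne_zero m
    have hbt := natCast_succ_ne_top m
    have h1 : ∀ i, r i ^ p ≤ W ^ p * ((i : ℝ≥0∞) + 1) ^ (-p) := by
      intro i
      have : r i ≤ W * ((i : ℝ≥0∞) + 1)⁻¹ := by
        rw [← div_eq_mul_inv, ENNReal.le_div_iff_mul_le (Or.inl (natCast_succ_ne_zero i))
          (Or.inl (natCast_succ_ne_top i)), mul_comm]
        exact le_iSup (fun m : ℕ => ((m : ℝ≥0∞) + 1) * r m) i
      refine (ENNReal.rpow_le_rpow this hp0.le).trans_eq ?_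
      rw [ENNReal.mul_rpow_of_nonneg _ _ hp0.le, ENNReal.inv_rpow, ENNReal.rpow_neg]
    have h2 : ((m : ℝ≥0∞) + 1)⁻¹ * ∑ i ∈ range (m + 1), r i ^ p ≤
        C₁ * W ^ p * ((m : ℝ≥0∞) + 1) ^ (-p) := by
      calc _ ≤ ((m : ℝ≥0∞) + 1)⁻¹ *
              ∑ i ∈ range (m + 1), W ^ p * ((i : ℝ≥0∞) + 1) ^ (-p) := by
            gcongr with i; exact h1 i
        _ ≤ ((m : ℝ≥0∞) + 1)⁻¹ * (W ^ p * (C₁ * ((m + 1 : ℕ) : ℝ≥0∞) ^ (1 - p))) := by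
            rw [← mul_sum]; gcongr; exact ennreal_sum_rpow_neg_le hp0 hp1 (m + 1)
        _ = C₁ * W ^ p * (((m : ℝ≥0∞) + 1) ^ (-1 : ℝ) * ((m : ℝ≥0∞) + 1) ^ (1 - p)) := by
            rw [ENNReal.rpow_neg_one]; push_cast; ring
        _ = _ := by
            rw [← ENNReal.rpow_add _ _ hb0 hbt]; ring_nf
    calc _ ≤ ((m : ℝ≥0∞) + 1) * (C₁ * W ^ p * ((m : ℝ≥0∞) + 1) ^ (-p)) ^ (1 / p) := by
          gcongr
      _ = C₁ ^ (1 / p) * W * (((m : ℝ≥0∞) + 1) * ((m : ℝ≥0∞) + 1)⁻¹) := by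
          rw [ENNReal.mul_rpow_of_nonneg _ _ (by positivity),
            ENNReal.mul_rpow_of_nonneg _ _ (by positivity), ← ENNReal.rpow_mul, ← ENNReal.rpow_mul,
            mul_one_div_cancel hp0.ne', neg_mul, mul_one_div_cancel hp0.ne', ENNReal.rpow_neg_one,
            ENNReal.rpow_one]
          ring
      _ = _ := by rw [ENNReal.mul_inv_cancel hb0 hbt, mul_one]
  · have h1 := one_lt_toReal hq hq'
    simp_rw [lorentzSeq_of_ne_top hq hq']
    set Q := q.toReal
    have hQ0 : 0 < Q := by linarith
    obtain ⟨C, hC, hH⟩ := hardy h1 (R := Q / p) (by rw [lt_div_iff₀ hp0]; nlinarith)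
    refine ⟨C ^ (1 / Q), ENNReal.rpow_ne_top_of_nonneg (by positivity) hC, fun r => ?_⟩
    rw [← ENNReal.mul_rpow_of_nonneg _ _ (by positivity)]
    refine ENNReal.rpow_le_rpow ?_ (by positivity)
    have h2 := hH fun i => r i ^ p
    have e : ∀ x : ℝ≥0∞, (x ^ p) ^ (Q / p) = x ^ Q := fun x => by
      rw [← ENNReal.rpow_mul, mul_div_cancel₀ _ hp0.ne']
    simp_rw [e] at h2
    refine (ENNReal.tsum_le_tsum fun m => ?_).trans h2
    rw [← ENNReal.rpow_mul, one_div_mul_eq_div]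

/-- Absolute continuity of the Lorentz functional. -/
theorem exists_lorentzSeq_le (hq : 1 < q) {r : ℕ → ℝ≥0∞} (hr : lorentzSeq q r < ∞)
    (hr' : q = ∞ → Tendsto (fun m : ℕ => ((m : ℝ≥0∞) + 1) * r m) atTop (𝓝 0))
    {ε : ℝ≥0∞} (hε : ε ≠ 0) :
    ∃ δ : ℝ≥0∞, δ ≠ 0 ∧ ∀ r' : ℕ → ℝ≥0∞, (∀ m, r' m ≤ δ) → (∀ m, r' m ≤ r m) →
      lorentzSeq q r' ≤ ε := by
  by_cases hq' : q = ∞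
  · subst hq'
    obtain ⟨M, hM⟩ := eventually_atTop.1
      ((hr' rfl).eventually (gt_mem_nhds (pos_iff_ne_zero.2 hε)))
    refine ⟨ε / ((M : ℝ≥0∞) + 1), ENNReal.div_ne_zero.2 ⟨hε, natCast_succ_ne_top M⟩,
      fun r' h1 h2 => ?_⟩
    rw [lorentzSeq_top]
    refine iSup_le fun m => ?_
    rcases le_total M m with hm | hm
    · exact (mul_le_mul_right (h2 m) _).trans (hM m hm).le
    · calc ((m : ℝ≥0∞) + 1) * r' m ≤ ((M : ℝ≥0∞) + 1) * (ε / ((M : ℝ≥0∞) + 1)) := by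
            gcongr; exact h1 m
        _ ≤ ε := ENNReal.mul_div_le
  · have h1 := one_lt_toReal hq hq'
    rw [lorentzSeq_of_ne_top hq hq'] at hr
    simp_rw [lorentzSeq_of_ne_top hq hq']
    set Q := q.toReal
    have hQ0 : 0 < Q := by linarith
    set T : ℕ → ℝ≥0∞ := fun m => ((m : ℝ≥0∞) + 1) ^ (Q - 1) * r m ^ Q with hT
    have hsum : ∑' m, T m ≠ ∞ := fun h => by
      rw [h, ENNReal.top_rpow_of_pos (by positivity)] at hr
      exact hr.ne rfl
    have hε2 : ε ^ Q / 2 ≠ 0 := by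
      rw [Ne, ENNReal.div_eq_zero_iff, ENNReal.rpow_eq_zero_iff]
      simp [hε, hQ0.not_gt]
    obtain ⟨M, hM⟩ := eventually_atTop.1
      ((ENNReal.tendsto_sum_nat_add T hsum).eventually (gt_mem_nhds (pos_iff_ne_zero.2 hε2)))
    have hM := (hM M le_rfl).le
    set B : ℝ≥0∞ := ∑ m ∈ range M, ((m : ℝ≥0∞) + 1) ^ (Q - 1) with hB
    have hBt : B ≠ ∞ := ENNReal.sum_ne_top.2 fun m _ =>
      ENNReal.rpow_ne_top_of_nonneg (by linarith) (natCast_succ_ne_top m)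
    -- The tail beyond M contributes at most ε^Q/2 by domination. This δ makes the first M terms
    -- contribute at most as much; the 1 added to B keeps the divisor nonzero when M = 0.
    set δ : ℝ≥0∞ := (ε ^ Q / 2 / (B + 1)) ^ (1 / Q) with hδ
    have hδQ : δ ^ Q = ε ^ Q / 2 / (B + 1) := by
      rw [hδ, ← ENNReal.rpow_mul, one_div_mul_cancel hQ0.ne', ENNReal.rpow_one]
    refine ⟨δ, fun h => ?_, fun r' h1 h2 => ?_⟩
    · rw [h, ENNReal.zero_rpow_of_pos hQ0] at hδQ
      exact (ENNReal.div_ne_zero.2 ⟨hε2, by simpa using hBt⟩) hδQ.symm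
    · rw [one_div, ENNReal.rpow_inv_le_iff hQ0]
      rw [← ENNReal.summable.sum_add_tsum_nat_add' (k := M)]
      calc _ ≤ ∑ m ∈ range M, ((m : ℝ≥0∞) + 1) ^ (Q - 1) * δ ^ Q + ∑' m, T (m + M) := by
            gcongr with m hm m
            · exact h1 m
            · exact mul_le_mul_right (ENNReal.rpow_le_rpow (h2 _) hQ0.le) _
        _ ≤ ε ^ Q / 2 + ε ^ Q / 2 := by
            refine add_le_add ?_ hM
            rw [← sum_mul, hδQ]
            calc B * (ε ^ Q / 2 / (B + 1)) ≤ (B + 1) * (ε ^ Q / 2 / (B + 1)) := by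
                  gcongr; exact le_self_add
              _ ≤ _ := ENNReal.mul_div_le
        _ = ε ^ Q := ENNReal.add_halves _

end LorentzSeq

/-! ### The Lorentz gauge -/

section LorentzNorm

open Finset

variable {𝕜 : Type u} [RCLike 𝕜] {q : ℝ≥0∞}

theorem lorentzNorm_smul (hq : 1 < q) (c : 𝕜) (f : ℕ → 𝕜) :
    lorentzNorm q (c • f) = ‖c‖ₑ * lorentzNorm q f := by
  rw [lorentzNorm_eq, lorentzNorm_eq, ← lorentzSeq_const_mul hq]
  congr 1
  ext m
  exact rearr_smul c f m

theorem lorentzNorm_mono (hq : 1 < q) {f g : ℕ → 𝕜} (h : ∀ m, rearr f m ≤ rearr g m) :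
    lorentzNorm q f ≤ lorentzNorm q g := lorentzSeq_mono hq h

/-- A Chebyshev bound: it limits the number of entries of size at least t, and so the cost of
altering a truncated sum at such entries. -/
theorem card_mul_le_lorentzNorm_top {f : ℕ → 𝕜} {t : ℝ≥0∞} {A : Finset ℕ}
    (h : ∀ n ∈ A, t ≤ ‖f n‖ₑ) : (A.card : ℝ≥0∞) * t ≤ lorentzNorm ∞ f := by
  rcases Nat.eq_zero_or_pos A.card with h0 | h0
  · simp [h0]
  · obtain ⟨m, hm⟩ := Nat.exists_eq_succ_of_ne_zero h0.ne'
    rw [lorentzNorm_eq, lorentzSeq_top, hm]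
    refine le_trans ?_ (le_iSup (fun m : ℕ => ((m : ℝ≥0∞) + 1) * rearr f m) m)
    push_cast
    gcongr
    exact le_rearr (by omega) h

theorem exists_lorentzNorm_top_le (hq : 1 < q) : ∃ C : ℝ≥0∞, C ≠ ∞ ∧ ∀ f : ℕ → 𝕜,
    lorentzNorm ∞ f ≤ C * lorentzNorm q f := by
  obtain ⟨C, hC, h⟩ := mul_le_lorentzSeq hq
  refine ⟨C, hC, fun f => ?_⟩
  rw [lorentzNorm_eq ∞, lorentzSeq_top]
  exact iSup_le fun m => h _ (rearr_antitone f) m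

theorem finite_setOf_le_enorm {f : ℕ → 𝕜} (hf : lorentzNorm ∞ f ≠ ∞) {t : ℝ≥0∞} (ht : t ≠ 0) :
    {n | t ≤ ‖f n‖ₑ}.Finite := by
  by_contra hinf
  obtain ⟨k, hk⟩ := ENNReal.exists_nat_mul_gt ht hf
  obtain ⟨A, hA, hAk⟩ := Set.Infinite.exists_subset_card_eq hinf k
  have := card_mul_le_lorentzNorm_top (f := f) (t := t) (A := A) fun n hn => hA hn
  rw [hAk] at this
  exact this.not_gt hk

theorem tendsto_zero_of_lorentzNorm_top {f : ℕ → 𝕜} (hf : lorentzNorm ∞ f ≠ ∞) :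
    Tendsto f atTop (𝓝 0) := by
  rw [← Nat.cofinite_eq_atTop, tendsto_zero_iff_enorm_tendsto_zero, ENNReal.tendsto_nhds_zero]
  intro ε hε
  rw [eventually_cofinite]
  exact (finite_setOf_le_enorm hf hε.ne').subset fun n hn => (not_le.1 hn).le

theorem lowerSemicontinuous_lorentzNorm (hq : 1 < q) :
    LowerSemicontinuous fun f : ℕ → 𝕜 => lorentzNorm q f := by
  by_cases hq' : q = ∞
  · subst hq'
    simp_rw [lorentzNorm_eq, lorentzSeq_top]
    refine lowerSemicontinuous_iSup fun m => ?_
    exact (ENNReal.continuous_const_mul (natCast_succ_ne_top m)).comp_lowerSemicontinuous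
      (lowerSemicontinuous_rearr m) fun a b hab => by dsimp only; gcongr
  · have h1 := one_lt_toReal hq hq'
    simp_rw [lorentzNorm_eq, lorentzSeq_of_ne_top hq hq']
    refine (ENNReal.continuous_rpow_const (y := 1 / q.toReal)).comp_lowerSemicontinuous
      (lowerSemicontinuous_tsum fun m => ?_) (ENNReal.monotone_rpow_of_nonneg (by positivity))
    refine (ENNReal.continuous_const_mul (ENNReal.rpow_ne_top_of_nonneg (by linarith)
      (natCast_succ_ne_top m))).comp_lowerSemicontinuous ?_ fun a b hab => by dsimp only; gcongr
    exact (ENNReal.continuous_rpow_const (y := q.toReal)).comp_lowerSemicontinuous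
      (lowerSemicontinuous_rearr m) (ENNReal.monotone_rpow_of_nonneg (by positivity))

/-- Supremum of the sums of `|f|^p` over the sets of cardinality `m + 1`. -/
def topSum (p : ℝ) (f : ℕ → 𝕜) (m : ℕ) : ℝ≥0∞ :=
  ⨆ (A : Finset ℕ) (_ : A.card = m + 1), ∑ n ∈ A, ‖f n‖ₑ ^ p

/-- A gauge equivalent to `lorentzNorm q` whose `p`-th power is subadditive. -/
def averageNorm (p : ℝ) (q : ℝ≥0∞) (f : ℕ → 𝕜) : ℝ≥0∞ :=
  lorentzSeq q fun m => (((m : ℝ≥0∞) + 1)⁻¹ * topSum p f m) ^ (1 / p)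

/-- Sums of |f|^p over a fixed set are subadditive in f for p < 1, hence so is their supremum
`topSum`. The rearrangement itself has no such property, which is the reason for passing to
averages. -/
theorem averageNorm_add_rpow_le (hq : 1 < q) {p : ℝ} (hp0 : 0 < p) (hp1 : p < 1)
    (f g : ℕ → 𝕜) :
    averageNorm p q (f + g) ^ p ≤ averageNorm p q f ^ p + averageNorm p q g ^ p := by
  refine le_trans ?_ (lorentzSeq_add_rpow_le hq hp0 hp1 _ _)
  refine ENNReal.rpow_le_rpow (lorentzSeq_mono hq fun m => ?_) hp0.le
  refine ENNReal.rpow_le_rpow ?_ (by positivity)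
  rw [← mul_add]
  gcongr
  refine iSup₂_le fun A hA => ?_
  calc ∑ n ∈ A, ‖(f + g) n‖ₑ ^ p ≤ ∑ n ∈ A, (‖f n‖ₑ ^ p + ‖g n‖ₑ ^ p) := by
        gcongr with n
        exact (ENNReal.rpow_le_rpow (enorm_add_le _ _) hp0.le).trans
          (ENNReal.rpow_add_le_add_rpow _ _ hp0.le hp1.le)
    _ ≤ _ := by
        rw [sum_add_distrib]
        exact add_le_add (le_iSup₂_of_le A hA le_rfl) (le_iSup₂_of_le A hA le_rfl)

theorem averageNorm_zero (hq : 1 < q) {p : ℝ} (hp0 : 0 < p) :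
    averageNorm p q (0 : ℕ → 𝕜) = 0 := by
  have h0 : ∀ m, topSum p (0 : ℕ → 𝕜) m = 0 := fun m => by
    simp [topSum, ENNReal.zero_rpow_of_pos hp0]
  have : (fun m : ℕ => (((m : ℝ≥0∞) + 1)⁻¹ * topSum p (0 : ℕ → 𝕜) m) ^ (1 / p)) =
      fun m : ℕ => 0 * (0 : ℝ≥0∞) := by
    ext m
    rw [h0, mul_zero, ENNReal.zero_rpow_of_pos (by positivity), mul_zero]
  rw [averageNorm, this, lorentzSeq_const_mul hq, zero_mul]

/-- The average of the m + 1 largest p-th powers dominates the smallest of them. -/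
theorem lorentzNorm_le_averageNorm (hq : 1 < q) {p : ℝ} (hp0 : 0 < p) (f : ℕ → 𝕜) :
    lorentzNorm q f ≤ averageNorm p q f := by
  refine lorentzSeq_mono hq fun m => ?_
  rw [one_div, ENNReal.le_rpow_inv_iff hp0]
  refine le_of_forall_lt fun s hs => ?_
  have hs' : s ^ (1 / p) < rearr f m := by
    rw [one_div, ENNReal.rpow_inv_lt_iff hp0]; exact hs
  obtain ⟨s', hs', hlt⟩ := exists_between hs'
  rw [one_div, ENNReal.rpow_inv_lt_iff hp0] at hs'
  obtain ⟨A, hA, hAs⟩ := exists_finset_of_lt_rearr hlt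
  refine hs'.trans_le ?_
  calc s' ^ p = ((m : ℝ≥0∞) + 1)⁻¹ * (((m : ℝ≥0∞) + 1) * s' ^ p) := by
        rw [← mul_assoc, ENNReal.inv_mul_cancel (natCast_succ_ne_zero m) (natCast_succ_ne_top m),
          one_mul]
    _ = ((m : ℝ≥0∞) + 1)⁻¹ * ∑ n ∈ A, s' ^ p := by rw [sum_const, hA]; simp
    _ ≤ ((m : ℝ≥0∞) + 1)⁻¹ * ∑ n ∈ A, ‖f n‖ₑ ^ p := by
        gcongr with n hn
        exact (hAs n hn).le
    _ ≤ _ := by gcongr; exact le_iSup₂_of_le A hA le_rfl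

theorem exists_averageNorm_le (hq : 1 < q) {p : ℝ} (hp0 : 0 < p) (hp1 : p < 1) :
    ∃ C : ℝ≥0∞, C ≠ ∞ ∧ ∀ f : ℕ → 𝕜, averageNorm p q f ≤ C * lorentzNorm q f := by
  obtain ⟨C, hC, h⟩ := lorentzSeq_average_le hq hp0 hp1
  refine ⟨C, hC, fun f => le_trans (lorentzSeq_mono hq fun m => ?_) (h (rearr f))⟩
  gcongr
  refine iSup₂_le fun A hA => ?_
  rw [← hA]
  exact sum_rpow_le_sum_rearr hp0.le f A

/-- The Lorentz gauge is equivalent to a `p`-convex one for every `p < 1`. -/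
theorem exists_lorentzNorm_sum_rpow_le (hq : 1 < q) {p : ℝ} (hp0 : 0 < p) (hp1 : p < 1) :
    ∃ C : ℝ≥0∞, C ≠ ∞ ∧ ∀ (n : ℕ) (g : Fin n → ℕ → 𝕜),
      lorentzNorm q (∑ j, g j) ^ p ≤ C * ∑ j, lorentzNorm q (g j) ^ p := by
  obtain ⟨C, hC, h⟩ := exists_averageNorm_le (𝕜 := 𝕜) hq hp0 hp1
  refine ⟨C ^ p, ENNReal.rpow_ne_top_of_nonneg hp0.le hC, fun n g => ?_⟩
  calc lorentzNorm q (∑ j, g j) ^ p ≤ averageNorm p q (∑ j, g j) ^ p :=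
        ENNReal.rpow_le_rpow (lorentzNorm_le_averageNorm hq hp0 _) hp0.le
    _ ≤ ∑ j, averageNorm p q (g j) ^ p :=
        Finset.le_sum_of_subadditive (fun f : ℕ → 𝕜 => averageNorm p q f ^ p)
          (by simp [averageNorm_zero hq hp0, ENNReal.zero_rpow_of_pos hp0])
          (averageNorm_add_rpow_le hq hp0 hp1) _ _
    _ ≤ ∑ j, C ^ p * lorentzNorm q (g j) ^ p := by
        gcongr with j
        rw [← ENNReal.mul_rpow_of_nonneg _ _ hp0.le]
        exact ENNReal.rpow_le_rpow (h _) hp0.le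
    _ = _ := by rw [mul_sum]

/-- The i-th rearranged entry is at most the weak-ℓ₁ gauge over i + 1, and the p-th powers of
1/(i+1) sum to order |A|^(1-p). This controls a function on a small exceptional set. -/
theorem exists_sum_enorm_rpow_le {p : ℝ} (hp0 : 0 < p) (hp1 : p < 1) :
    ∃ C : ℝ≥0∞, C ≠ ∞ ∧ ∀ (f : ℕ → 𝕜) (A : Finset ℕ),
      ∑ n ∈ A, ‖f n‖ₑ ^ p ≤ C * lorentzNorm ∞ f ^ p * (A.card : ℝ≥0∞) ^ (1 - p) := by
  refine ⟨ENNReal.ofReal (1 - p)⁻¹, ENNReal.ofReal_ne_top, fun f A => ?_⟩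
  have h1 : ∀ i, rearr f i ^ p ≤ lorentzNorm ∞ f ^ p * ((i : ℝ≥0∞) + 1) ^ (-p) := by
    intro i
    have : rearr f i ≤ lorentzNorm ∞ f * ((i : ℝ≥0∞) + 1)⁻¹ := by
      rw [← div_eq_mul_inv, ENNReal.le_div_iff_mul_le (Or.inl (natCast_succ_ne_zero i))
        (Or.inl (natCast_succ_ne_top i)), mul_comm, lorentzNorm_eq, lorentzSeq_top]
      exact le_iSup (fun m : ℕ => ((m : ℝ≥0∞) + 1) * rearr f m) i
    refine (ENNReal.rpow_le_rpow this hp0.le).trans_eq ?_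
    rw [ENNReal.mul_rpow_of_nonneg _ _ hp0.le, ENNReal.inv_rpow, ENNReal.rpow_neg]
  calc _ ≤ ∑ i ∈ range A.card, rearr f i ^ p := sum_rpow_le_sum_rearr hp0.le f A
    _ ≤ ∑ i ∈ range A.card, lorentzNorm ∞ f ^ p * ((i : ℝ≥0∞) + 1) ^ (-p) := by
        gcongr with i; exact h1 i
    _ ≤ lorentzNorm ∞ f ^ p *
          (ENNReal.ofReal (1 - p)⁻¹ * (A.card : ℝ≥0∞) ^ (1 - p)) := by
        rw [← mul_sum]; gcongr; exact ennreal_sum_rpow_neg_le hp0 hp1 _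
    _ = _ := by ring

end LorentzNorm

/-! ### Truncated interval sums -/

section TruncNorm

open Finset

variable {𝕜 : Type u} [RCLike 𝕜]

/-- The supremum of the absolute values of the sums of `f` over interval truncations
`{n ∈ [a, b] : |f n| ≤ t}`. -/
def truncNorm (f : ℕ → 𝕜) : ℝ≥0∞ :=
  ⨆ (t : NNReal) (a : ℕ) (b : ℕ), ‖∑ n ∈ Icc a b with ‖f n‖₊ ≤ t, f n‖ₑ

theorem le_truncNorm (f : ℕ → 𝕜) (t : NNReal) (a b : ℕ) :
    ‖∑ n ∈ Icc a b with ‖f n‖₊ ≤ t, f n‖ₑ ≤ truncNorm f :=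
  le_iSup_of_le t (le_iSup₂_of_le a b le_rfl)

theorem enorm_sum_le_card_mul {f : ℕ → 𝕜} {S : Finset ℕ} {t : ℝ≥0∞}
    (h : ∀ n ∈ S, ‖f n‖ₑ ≤ t) : ‖∑ n ∈ S, f n‖ₑ ≤ S.card * t := by
  refine (enorm_sum_le _ _).trans ((sum_le_sum h).trans ?_)
  rw [sum_const, nsmul_eq_mul]

theorem enorm_sum_Icc_le_truncNorm (f : ℕ → 𝕜) (a b : ℕ) :
    ‖∑ n ∈ Icc a b, f n‖ₑ ≤ truncNorm f := by
  have h := le_truncNorm f (∑ n ∈ Icc a b, ‖f n‖₊) a b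
  rwa [filter_true_of_mem] at h
  intro n hn
  exact single_le_sum (f := fun n => ‖f n‖₊) (fun _ _ => zero_le) hn

/-- Level sets of null sequences are greedy sets. -/
theorem exists_isGreedySet_level {f : ℕ → 𝕜} (hf : Tendsto f atTop (𝓝 0)) {t : NNReal}
    (ht : t ≠ 0) : ∃ F : Finset ℕ, IsGreedySet f F ∧ ∀ n, n ∈ F ↔ t < ‖f n‖₊ := by
  have hfin : {n | t < ‖f n‖₊}.Finite := by
    have h0 : Tendsto (fun n => ‖f n‖₊) cofinite (𝓝 0) := by
      rw [Nat.cofinite_eq_atTop]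
      simpa using hf.nnnorm
    have := h0.eventually (gt_mem_nhds (pos_iff_ne_zero.2 ht))
    exact (eventually_cofinite.1 this).subset fun n (hn : t < _) => hn.le.not_gt
  refine ⟨hfin.toFinset, fun n hn k hk => ?_, fun n => by simp⟩
  simp only [Set.Finite.mem_toFinset, Set.mem_ofPred_eq, not_lt] at hn hk
  exact_mod_cast hk.trans hn.le

theorem enorm_sum_filter_le_beta {f : ℕ → 𝕜} {t : NNReal} {F : Finset ℕ}
    (hF : ∀ n, n ∈ F ↔ t < ‖f n‖₊) (a b : ℕ) :
    ‖∑ n ∈ Icc a b with ‖f n‖₊ ≤ t, f n‖ₑ ≤ beta f F := by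
  refine le_trans (le_of_eq ?_) (le_iSup₂_of_le a b le_rfl)
  congr 2
  ext n
  simp [hF]

theorem sum_filter_nnnorm_le_zero (f : ℕ → 𝕜) (S : Finset ℕ) :
    ∑ n ∈ S with ‖f n‖₊ ≤ 0, f n = 0 :=
  sum_eq_zero fun n hn => by simpa using (mem_filter.1 hn).2

/-- Removing the greedy set {|f| > t} from an interval leaves exactly its truncation. The case t = 0
is separate because that level set may be infinite, but then the truncated sum vanishes. -/
theorem truncNorm_le_normB {f : ℕ → 𝕜} (hf : Tendsto f atTop (𝓝 0)) :
    truncNorm f ≤ normB f := by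
  refine iSup_le fun t => iSup₂_le fun a b => ?_
  rcases eq_or_ne t 0 with rfl | ht
  · rw [sum_filter_nnnorm_le_zero]
    simp
  obtain ⟨F, hF, hmem⟩ := exists_isGreedySet_level hf ht
  exact (enorm_sum_filter_le_beta hmem a b).trans (le_iSup₂_of_le F hF le_rfl)

theorem IsGreedySet.exists_threshold {f : ℕ → 𝕜} {A : Finset ℕ} (hA : IsGreedySet f A)
    (hne : A.Nonempty) :
    ∃ t : NNReal, (∀ n ∈ A, t ≤ ‖f n‖₊) ∧ (∀ n ∉ A, ‖f n‖₊ ≤ t) ∧ ∃ n ∈ A, ‖f n‖₊ = t := by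
  obtain ⟨n, hn, hmin⟩ := A.exists_min_image (fun n => ‖f n‖₊) hne
  exact ⟨‖f n‖₊, hmin, fun k hk => hA n hn k hk, n, hn, rfl⟩

theorem isGreedySet_empty (f : ℕ → 𝕜) : IsGreedySet f ∅ := fun n hn => by simp at hn

/-- Off D, the set I \ A differs from {n ∈ I : |h n| ≤ t} only in points of A, where |h| = |f| ≥ t;
the weak-ℓ₁ gauge of h bounds their number times t. The points of D are paid for twice, once for f
and once for h. With D = ∅ this compares `normB` with `truncNorm`; with D the support of an
approximant it gives membership in 𝔹₀. -/
theorem beta_le_of_eqOn {f h : ℕ → 𝕜} {A D : Finset ℕ} {t : NNReal}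
    (ht : ∀ n ∈ A, t ≤ ‖f n‖₊) (ht' : ∀ n ∉ A, ‖f n‖₊ ≤ t) (hfh : ∀ n ∉ D, f n = h n) :
    beta f A ≤ truncNorm h + lorentzNorm ∞ h + 2 * (D.card * t) := by
  refine iSup₂_le fun a b => ?_
  set I := Icc a b
  have hsub : I \ (A ∪ D) ⊆ {n ∈ I | ‖h n‖₊ ≤ t} := fun n hn => by
    simp only [Finset.mem_sdiff, mem_union, not_or] at hn
    exact mem_filter.2 ⟨hn.1, hfh n hn.2.2 ▸ ht' n hn.2.1⟩
  have h1 := sum_sdiff (f := h) hsub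
  rw [← eq_sub_iff_add_eq'] at h1
  have h2 : ({n ∈ I | ‖h n‖₊ ≤ t} \ (I \ (A ∪ D))) ⊆ (A \ D) ∪ D := fun n hn => by
    simp only [Finset.mem_sdiff, mem_filter, mem_union] at hn ⊢
    tauto
  have hW : ((A \ D).card : ℝ≥0∞) * t ≤ lorentzNorm ∞ h := by
    refine card_mul_le_lorentzNorm_top fun n hn => ?_
    rw [Finset.mem_sdiff] at hn
    rw [← hfh n hn.2]
    exact_mod_cast ht n hn.1
  have h3 : ‖∑ n ∈ {n ∈ I | ‖h n‖₊ ≤ t} \ (I \ (A ∪ D)), h n‖ₑ ≤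
      lorentzNorm ∞ h + D.card * t := by
    refine (enorm_sum_le_card_mul (t := t) fun n hn => ?_).trans ?_
    · exact_mod_cast (mem_filter.1 (Finset.mem_sdiff.1 hn).1).2
    · calc _ ≤ (((A \ D).card + D.card : ℕ) : ℝ≥0∞) * t :=
            mul_le_mul_left (Nat.cast_le.2 ((card_le_card h2).trans (card_union_le _ _))) _
        _ = ((A \ D).card : ℝ≥0∞) * t + D.card * t := by push_cast; ring
        _ ≤ _ := by gcongr
  have h4 : ‖∑ n ∈ (I \ A) ∩ D, f n‖ₑ ≤ D.card * t := by
    refine (enorm_sum_le_card_mul (t := t) fun n hn => ?_).trans ?_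
    · exact_mod_cast ht' n (Finset.mem_sdiff.1 (mem_inter.1 hn).1).2
    · exact mul_le_mul_left (Nat.cast_le.2 (card_le_card inter_subset_right)) _
  have h5 : ∑ n ∈ (I \ A) \ D, f n = ∑ n ∈ I \ (A ∪ D), h n := by
    rw [sdiff_sdiff, sup_eq_union]
    refine sum_congr rfl fun n hn => hfh n ?_
    simp only [Finset.mem_sdiff, mem_union, not_or] at hn
    exact hn.2.2
  rw [← sum_inter_add_sum_sdiff (I \ A) D, h5, h1]
  calc _ ≤ D.card * t + (truncNorm h + (lorentzNorm ∞ h + D.card * t)) :=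
        (enorm_add_le _ _).trans (add_le_add h4
          ((enorm_sub_le).trans (add_le_add (le_truncNorm h t a b) h3)))
    _ = _ := by ring

theorem normB_le (f : ℕ → 𝕜) : normB f ≤ truncNorm f + lorentzNorm ∞ f := by
  refine iSup₂_le fun A hA => ?_
  rcases A.eq_empty_or_nonempty with rfl | hne
  · refine iSup₂_le fun a b => ?_
    rw [sdiff_empty]
    exact (enorm_sum_Icc_le_truncNorm f a b).trans le_self_add
  · obtain ⟨t, ht, ht', -⟩ := hA.exists_threshold hne
    simpa using beta_le_of_eqOn (D := ∅) ht ht' fun _ _ => rfl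

theorem beta_smul (c : 𝕜) (f : ℕ → 𝕜) (A : Finset ℕ) :
    beta (c • f) A = ‖c‖ₑ * beta f A := by
  simp only [beta, ENNReal.mul_iSup, Pi.smul_apply, smul_eq_mul, ← mul_sum, enorm_mul]

theorem isGreedySet_smul {c : 𝕜} (hc : c ≠ 0) {f : ℕ → 𝕜} {A : Finset ℕ} :
    IsGreedySet (c • f) A ↔ IsGreedySet f A := by
  simp [IsGreedySet, hc]

theorem normB_smul (c : 𝕜) (f : ℕ → 𝕜) : normB (c • f) = ‖c‖ₑ * normB f := by
  rcases eq_or_ne c 0 with rfl | hc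
  · simp [normB, beta]
  · simp only [normB, ENNReal.mul_iSup, beta_smul, isGreedySet_smul hc]

theorem lowerSemicontinuous_truncNorm : LowerSemicontinuous (truncNorm (𝕜 := 𝕜)) := by
  intro f s hs
  simp only [truncNorm, lt_iSup_iff] at hs
  obtain ⟨t, a, b, hs⟩ := hs
  -- Raising the threshold slightly makes every comparison on [a, b] strict, so that nearby
  -- sequences truncated at t' keep exactly the same indices.
  obtain ⟨t', htt', ht'⟩ : ∃ t', t < t' ∧ ∀ n ∈ Icc a b, t < ‖f n‖₊ → t' < ‖f n‖₊ := by
    have : ∀ᶠ t' in 𝓝[>] t, ∀ n ∈ Icc a b, t < ‖f n‖₊ → t' < ‖f n‖₊ := by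
      rw [Filter.eventually_all_finset]
      intro n _
      by_cases h : t < ‖f n‖₊
      · filter_upwards [Ioo_mem_nhdsGT h] with t' ht' _
        exact ht'.2
      · exact Eventually.of_forall fun _ h' => absurd h' h
    exact (Filter.Eventually.and (self_mem_nhdsWithin (s := Set.Ioi t)) this).exists
  have e1 : ∀ᶠ g : ℕ → 𝕜 in 𝓝 f, ∀ n ∈ Icc a b, (‖g n‖₊ ≤ t' ↔ ‖f n‖₊ ≤ t) := by
    rw [Filter.eventually_all_finset]
    intro n hn
    have hc : Continuous fun g : ℕ → 𝕜 => ‖g n‖₊ := (continuous_apply n).nnnorm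
    by_cases h : ‖f n‖₊ ≤ t
    · filter_upwards [hc.continuousAt.eventually (gt_mem_nhds (h.trans_lt htt'))] with g hg
      exact ⟨fun _ => h, fun _ => hg.le⟩
    · filter_upwards [hc.continuousAt.eventually (lt_mem_nhds (ht' n hn (not_le.1 h)))] with g hg
      exact ⟨fun h' => absurd h' (not_le.2 hg), fun h' => absurd h' h⟩
  have hc : Continuous fun g : ℕ → 𝕜 => ‖∑ n ∈ Icc a b with ‖f n‖₊ ≤ t, g n‖ₑ :=
    (continuous_finsetSum _ fun n _ => continuous_apply n).enorm
  filter_upwards [e1, hc.continuousAt.eventually (lt_mem_nhds hs)] with g h1 h2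
  rw [← filter_congr h1] at h2
  exact h2.trans_le (le_truncNorm g t' a b)

theorem truncNorm_indicator_Iio_le (f : ℕ → 𝕜) (m : ℕ) :
    truncNorm ((Set.Iio m).indicator f) ≤ truncNorm f := by
  refine iSup_le fun t => iSup₂_le fun a b => ?_
  -- Cutting to n < m only shortens the interval to [a, min b (m - 1)]; for m = 0 the truncated
  -- subtraction would leave the index 0.
  rcases Nat.eq_zero_or_pos m with rfl | hm
  · simp
  refine le_trans (le_of_eq ?_) (le_truncNorm f t a (min b (m - 1)))
  congr 1
  rw [sum_filter, sum_filter]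
  have hsub : Icc a (min b (m - 1)) ⊆ Icc a b := Icc_subset_Icc le_rfl (min_le_left _ _)
  rw [← sum_subset hsub]
  · refine sum_congr rfl fun n hn => ?_
    have : n < m := by have := mem_Icc.1 hn; omega
    simp [this]
  · intro n hn hn'
    have : ¬ n < m := by simp only [mem_Icc] at hn hn'; omega
    simp [this]

/-- Off A all entries are at most t, so the threshold s may be lowered to min s t. At that level the
two residuals differ only on B \ A and A \ B, in entries of modulus at most t. Both sets have at
most |A \ B| points, and on A \ B the residual off B has modulus at least t. -/
theorem truncNorm_greedy_le {f : ℕ → 𝕜} {A B : Finset ℕ} (hA : IsGreedySet f A)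
    (hAB : B.card ≤ A.card) :
    truncNorm ((A : Set ℕ)ᶜ.indicator f) ≤ truncNorm ((B : Set ℕ)ᶜ.indicator f) +
      2 * lorentzNorm ∞ ((B : Set ℕ)ᶜ.indicator f) := by
  rcases A.eq_empty_or_nonempty with rfl | hne
  · have : B = ∅ := by simpa using hAB
    subst this
    exact le_self_add
  obtain ⟨t, ht, ht', -⟩ := hA.exists_threshold hne
  set h := (B : Set ℕ)ᶜ.indicator f
  refine iSup_le fun s => iSup₂_le fun a b => ?_
  set S₁ := {n ∈ Icc a b \ A | ‖f n‖₊ ≤ min s t}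
  set S₂ := {n ∈ Icc a b \ B | ‖f n‖₊ ≤ min s t}
  have e1 : ∑ n ∈ Icc a b with ‖(A : Set ℕ)ᶜ.indicator f n‖₊ ≤ s, (A : Set ℕ)ᶜ.indicator f n =
      ∑ n ∈ S₁, f n := by
    rw [sum_filter, sum_filter, sdiff_eq_filter, sum_filter]
    refine sum_congr rfl fun n _ => ?_
    by_cases hn : n ∈ A
    · simp [hn]
    · simp [hn, ht' n hn]
  have e2 : ∑ n ∈ Icc a b with ‖h n‖₊ ≤ min s t, h n = ∑ n ∈ S₂, f n := by
    rw [sum_filter, sum_filter, sdiff_eq_filter, sum_filter]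
    refine sum_congr rfl fun n _ => ?_
    by_cases hn : n ∈ B <;> simp [hn, h]
  have e3 : ∑ n ∈ S₁, f n = ∑ n ∈ S₂, f n + (∑ n ∈ S₁ \ S₂, f n - ∑ n ∈ S₂ \ S₁, f n) := by
    rw [← sum_sdiff (inter_subset_left : S₁ ∩ S₂ ⊆ S₁), ← sum_sdiff
      (inter_subset_right : S₁ ∩ S₂ ⊆ S₂), sdiff_inter_self_left, sdiff_inter_self_right]
    ring
  have hW : ((A \ B).card : ℝ≥0∞) * t ≤ lorentzNorm ∞ h := by
    refine card_mul_le_lorentzNorm_top fun n hn => ?_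
    rw [Finset.mem_sdiff] at hn
    have : h n = f n := by simp [h, hn.2]
    rw [this]
    exact_mod_cast ht n hn.1
  have hBA : (B \ A).card ≤ (A \ B).card := card_sdiff_le_card_sdiff_iff.2 hAB
  have hle : ∀ n, ‖f n‖₊ ≤ min s t → ‖f n‖ₑ ≤ (t : ℝ≥0∞) := fun n hn => by
    exact_mod_cast hn.trans (min_le_right _ _)
  have b1 : ‖∑ n ∈ S₁ \ S₂, f n‖ₑ ≤ lorentzNorm ∞ h := by
    refine (enorm_sum_le_card_mul (t := t) fun n hn => ?_).trans (le_trans ?_ hW)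
    · exact hle n (mem_filter.1 (Finset.mem_sdiff.1 hn).1).2
    · refine mul_le_mul_left (Nat.cast_le.2 ((card_le_card fun n hn => ?_).trans hBA)) _
      simp only [S₁, S₂, Finset.mem_sdiff, mem_filter] at hn ⊢
      tauto
  have b2 : ‖∑ n ∈ S₂ \ S₁, f n‖ₑ ≤ lorentzNorm ∞ h := by
    refine (enorm_sum_le_card_mul (t := t) fun n hn => ?_).trans (le_trans ?_ hW)
    · exact hle n (mem_filter.1 (Finset.mem_sdiff.1 hn).1).2
    · refine mul_le_mul_left (Nat.cast_le.2 (card_le_card fun n hn => ?_)) _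
      simp only [S₁, S₂, Finset.mem_sdiff, mem_filter] at hn ⊢
      tauto
  rw [e1, e3, two_mul]
  refine (enorm_add_le _ _).trans (add_le_add ?_ ((enorm_sub_le).trans (add_le_add b1 b2)))
  rw [← e2]
  exact le_truncNorm h _ a b

/-- Let S be a set on which the residual off A exceeds s. If S meets B, then f exceeds s at a point
outside A, hence on all of A. The points of S ∩ B, which lie in B \ A, can then be exchanged for
those of A \ B, at least as numerous. -/
theorem rearr_greedy_le {f : ℕ → 𝕜} {A B : Finset ℕ} (hA : IsGreedySet f A)
    (hAB : B.card ≤ A.card) (m : ℕ) :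
    rearr ((A : Set ℕ)ᶜ.indicator f) m ≤ rearr ((B : Set ℕ)ᶜ.indicator f) m := by
  refine rearr_add_le_rearr 0 (fun s S hS => ?_) m
  have hSA : ∀ n ∈ S, n ∉ A ∧ s < ‖f n‖ₑ := by
    intro n hn
    have := hS n hn
    by_cases hnA : n ∈ A
    · simp [hnA] at this
    · exact ⟨hnA, by simpa [hnA] using this⟩
  by_cases hSB : ∃ n ∈ S, n ∈ B
  · obtain ⟨n, hnS, hnB⟩ := hSB
    refine ⟨S \ B ∪ A \ B, ?_, fun k hk => ?_⟩
    · rw [card_union_of_disjoint]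
      · have h1 : (B \ A).card ≤ (A \ B).card := card_sdiff_le_card_sdiff_iff.2 hAB
        have h2 : (S ∩ B).card ≤ (B \ A).card := card_le_card fun k hk => by
          rw [mem_inter] at hk
          exact Finset.mem_sdiff.2 ⟨hk.2, (hSA k hk.1).1⟩
        have h3 := card_sdiff_add_card_inter S B
        omega
      · rw [disjoint_left]
        intro k hk hk'
        exact (hSA k (Finset.mem_sdiff.1 hk).1).1 (Finset.mem_sdiff.1 hk').1
    · have hkB : k ∉ B := by
        simp only [mem_union, Finset.mem_sdiff] at hk; tauto
      have : (B : Set ℕ)ᶜ.indicator f k = f k := by simp [hkB]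
      rw [this]
      rcases mem_union.1 hk with hk | hk
      · exact (hSA k (Finset.mem_sdiff.1 hk).1).2
      · have := hA k (Finset.mem_sdiff.1 hk).1 n (hSA n hnS).1
        refine (hSA n hnS).2.trans_le ?_
        rwa [enorm_le_iff_norm_le]
  · push Not at hSB
    refine ⟨S, by simp, fun n hn => ?_⟩
    have : (B : Set ℕ)ᶜ.indicator f n = f n := by simp [hSB n hn]
    rw [this]
    exact (hSA n hn).2

theorem rpow_sum_le_sum_rpow {p : ℝ} (hp0 : 0 < p) (hp1 : p ≤ 1) {n : ℕ} (a : Fin n → ℝ≥0∞) :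
    (∑ j, a j) ^ p ≤ ∑ j, a j ^ p :=
  Finset.le_sum_of_subadditive (fun x : ℝ≥0∞ => x ^ p) (by simp [hp0])
    (fun x y => ENNReal.rpow_add_le_add_rpow x y hp0.le hp1) _ _

/-- Fix t and I, and let K be the ℓ_p combination of the gauges of the summands. The set U where
some summand exceeds t satisfies |U| t ≤ K, so on V ∩ U the small values of the sum cost at most K.
On V \ U each summand is at most t, and its sum there is a truncated interval sum up to a correction
over a subset of A ∪ U, whose size is O(K/t). The p-th power estimate bounds this correction by a
multiple of G_j^p K^(1-p), and adding over j gives K^p K^(1-p) = K. -/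
theorem exists_truncNorm_sum_rpow_le {p : ℝ} (hp0 : 0 < p) (hp1 : p < 1) :
    ∃ C : ℝ≥0∞, C ≠ ∞ ∧ ∀ (n : ℕ) (g : Fin n → ℕ → 𝕜),
      truncNorm (∑ j, g j) ^ p ≤ C * ∑ j, max (truncNorm (g j)) (lorentzNorm ∞ (g j)) ^ p := by
  obtain ⟨C₁, hC₁, hL⟩ := exists_lorentzNorm_sum_rpow_le (𝕜 := 𝕜) ENNReal.one_lt_top hp0 hp1
  obtain ⟨C₂, hC₂, hS⟩ := exists_sum_enorm_rpow_le (𝕜 := 𝕜) hp0 hp1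
  have h1p : 0 < 1 - p := by linarith
  set C₃ : ℝ≥0∞ := C₁ ^ (1 / p)
  have hC₃ : C₃ ≠ ∞ := ENNReal.rpow_ne_top_of_nonneg (by positivity) hC₁
  set C₄ : ℝ≥0∞ := 1 + (1 + C₂ * (C₃ + 1) ^ (1 - p))
  have hC₄ : C₄ ≠ ∞ := by
    have : C₂ * (C₃ + 1) ^ (1 - p) ≠ ∞ := ENNReal.mul_ne_top hC₂
      (ENNReal.rpow_ne_top_of_nonneg h1p.le (by simpa using hC₃))
    simp [C₄, this]
  refine ⟨C₄ ^ p, ENNReal.rpow_ne_top_of_nonneg hp0.le hC₄, fun n g => ?_⟩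
  set G : Fin n → ℝ≥0∞ := fun j => max (truncNorm (g j)) (lorentzNorm ∞ (g j))
  set Kp : ℝ≥0∞ := ∑ j, G j ^ p with hKp
  set K : ℝ≥0∞ := Kp ^ (1 / p) with hK
  have hKK : K ^ p = Kp := by
    rw [hK, ← ENNReal.rpow_mul, one_div_mul_cancel hp0.ne', ENNReal.rpow_one]
  have hGK : ∑ j, G j ≤ K := by
    rw [hK, one_div, ENNReal.le_rpow_inv_iff hp0]
    exact rpow_sum_le_sum_rpow hp0 hp1.le G
  set h : ℕ → 𝕜 := ∑ j, g j with hh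
  have hWh : lorentzNorm ∞ h ≤ C₃ * K := by
    rw [hK, ← ENNReal.mul_rpow_of_nonneg _ _ (by positivity), one_div,
      ENNReal.le_rpow_inv_iff hp0]
    refine (hL n g).trans ?_
    rw [hKp]
    gcongr with j
    exact le_max_right (truncNorm (g j)) _
  change _ ≤ C₄ ^ p * Kp
  rw [← hKK, ← ENNReal.mul_rpow_of_nonneg _ _ hp0.le]
  refine ENNReal.rpow_le_rpow ?_ hp0.le
  refine iSup_le fun t => iSup₂_le fun a b => ?_
  set I := Icc a b
  set V := {n ∈ I | ‖h n‖₊ ≤ t} with hV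
  set A := {n ∈ I | t < ‖h n‖₊} with hA
  set F : Fin n → Finset ℕ := fun j => {n ∈ I | t < ‖g j n‖₊} with hF
  set U := univ.biUnion F with hU
  have hAt : (A.card : ℝ≥0∞) * t ≤ C₃ * K :=
    (card_mul_le_lorentzNorm_top fun n hn => by exact_mod_cast (mem_filter.1 hn).2.le).trans hWh
  have hUt : (U.card : ℝ≥0∞) * t ≤ K := by
    calc (U.card : ℝ≥0∞) * t ≤ ((∑ j, (F j).card : ℕ) : ℝ≥0∞) * t := by
          gcongr; exact card_biUnion_le
      _ = ∑ j, ((F j).card : ℝ≥0∞) * t := by push_cast; rw [sum_mul]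
      _ ≤ ∑ j, G j := by
          gcongr with j
          exact (card_mul_le_lorentzNorm_top fun n hn => by
            exact_mod_cast (mem_filter.1 hn).2.le).trans (le_max_right _ _)
      _ ≤ K := hGK
  have hAUt : ((A ∪ U).card : ℝ≥0∞) * t ≤ (C₃ + 1) * K := by
    calc ((A ∪ U).card : ℝ≥0∞) * t ≤ ((A.card + U.card : ℕ) : ℝ≥0∞) * t := by
          gcongr; exact card_union_le _ _
      _ = A.card * t + U.card * t := by push_cast; ring
      _ ≤ C₃ * K + K := add_le_add hAt hUt
      _ = _ := by ring
  have hmain : ∀ j, ‖∑ n ∈ V \ U, g j n‖ₑ ≤ G j + C₂ * G j ^ p * ((C₃ + 1) * K) ^ (1 - p) := by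
    intro j
    have hsub : V \ U ⊆ {n ∈ I | ‖g j n‖₊ ≤ t} := fun n hn => by
      simp only [hV, hU, hF, Finset.mem_sdiff, mem_filter, mem_biUnion, mem_univ, true_and,
        not_exists, not_and, not_lt] at hn ⊢
      exact ⟨hn.1.1, hn.2 j hn.1.1⟩
    set D := {n ∈ I | ‖g j n‖₊ ≤ t} \ (V \ U) with hD
    have hDs : D ⊆ A ∪ U := fun n hn => by
      simp only [hD, hV, hA, Finset.mem_sdiff, mem_filter, mem_union] at hn ⊢
      by_cases hnt : ‖h n‖₊ ≤ t
      · tauto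
      · exact Or.inl ⟨hn.1.1, not_le.1 hnt⟩
    have e := sum_sdiff (f := g j) hsub
    rw [← eq_sub_iff_add_eq'] at e
    rw [e]
    refine (enorm_sub_le).trans
      (add_le_add ((le_truncNorm (g j) t a b).trans (le_max_left _ _)) ?_)
    calc ‖∑ n ∈ D, g j n‖ₑ ≤ ∑ n ∈ D, ‖g j n‖ₑ := enorm_sum_le _ _
      -- Estimating D by |D| t would cost K for each j, with no summability in j. Splitting off only
      -- the power 1 - p keeps the factor G_j^p.
      _ ≤ ∑ n ∈ D, (t : ℝ≥0∞) ^ (1 - p) * ‖g j n‖ₑ ^ p := by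
          refine sum_le_sum fun n hn => ?_
          have hnt : ‖g j n‖ₑ ≤ t := by
            exact_mod_cast (mem_filter.1 (Finset.mem_sdiff.1 hn).1).2
          calc ‖g j n‖ₑ = ‖g j n‖ₑ ^ (1 - p) * ‖g j n‖ₑ ^ p := by
                rw [← ENNReal.rpow_add_of_nonneg _ _ h1p.le hp0.le, sub_add_cancel,
                  ENNReal.rpow_one]
            _ ≤ _ := by gcongr
      _ = (t : ℝ≥0∞) ^ (1 - p) * ∑ n ∈ D, ‖g j n‖ₑ ^ p := by rw [mul_sum]
      _ ≤ (t : ℝ≥0∞) ^ (1 - p) * (C₂ * G j ^ p * ((A ∪ U).card : ℝ≥0∞) ^ (1 - p)) := by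
          gcongr
          refine (hS (g j) D).trans ?_
          gcongr
          exact le_max_right _ _
      _ = C₂ * G j ^ p * (((A ∪ U).card : ℝ≥0∞) * t) ^ (1 - p) := by
          rw [ENNReal.mul_rpow_of_nonneg _ _ h1p.le]; ring
      _ ≤ _ := by gcongr
  have e1 : ∑ n ∈ V, h n = ∑ n ∈ V ∩ U, h n + ∑ j, ∑ n ∈ V \ U, g j n := by
    rw [sum_comm, ← sum_inter_add_sum_sdiff V U]
    congr 1
    refine sum_congr rfl fun n _ => ?_
    rw [hh, Finset.sum_apply]
  have b1 : ‖∑ n ∈ V ∩ U, h n‖ₑ ≤ K := by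
    refine (enorm_sum_le_card_mul (t := t) fun n hn => ?_).trans (le_trans ?_ hUt)
    · exact_mod_cast (mem_filter.1 (mem_inter.1 hn).1).2
    · gcongr
      exact inter_subset_right
  have b2 : ∑ j, ‖∑ n ∈ V \ U, g j n‖ₑ ≤ K + C₂ * (C₃ + 1) ^ (1 - p) * K := by
    calc _ ≤ ∑ j, (G j + C₂ * G j ^ p * ((C₃ + 1) * K) ^ (1 - p)) := sum_le_sum fun j _ => hmain j
      _ = ∑ j, G j + C₂ * Kp * ((C₃ + 1) * K) ^ (1 - p) := by
          rw [sum_add_distrib, ← sum_mul, ← mul_sum]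
      _ ≤ K + C₂ * Kp * ((C₃ + 1) * K) ^ (1 - p) := by gcongr
      _ = K + C₂ * (C₃ + 1) ^ (1 - p) * (K ^ p * K ^ (1 - p)) := by
          rw [ENNReal.mul_rpow_of_nonneg _ _ h1p.le, hKK]; ring
      _ = _ := by
          rw [← ENNReal.rpow_add_of_nonneg _ _ hp0.le h1p.le, add_sub_cancel, ENNReal.rpow_one]
  rw [e1]
  calc _ ≤ K + (K + C₂ * (C₃ + 1) ^ (1 - p) * K) :=
        (enorm_add_le _ _).trans (add_le_add b1 ((enorm_sum_le _ _).trans b2))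
    _ = C₄ * K := by simp only [C₄]; ring

end TruncNorm

/-! ### The gauge of `𝔹 ∩ ℓ_{1,q}` -/

section Gauge

open Finset

variable {𝕜 : Type u} [RCLike 𝕜] {q : ℝ≥0∞}

/-- The gauge `max {‖f‖_𝔹, ‖f‖_{1,q}}`. -/
def gauge (q : ℝ≥0∞) (f : ℕ → 𝕜) : ℝ≥0∞ := max (normB f) (lorentzNorm q f)

/-- The gauge obtained by replacing `‖f‖_𝔹` by truncated interval sums. -/
def truncGauge (q : ℝ≥0∞) (f : ℕ → 𝕜) : ℝ≥0∞ := max (truncNorm f) (lorentzNorm q f)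

theorem lorentzNorm_top_ne_top (hq : 1 < q) {f : ℕ → 𝕜} (h : lorentzNorm q f ≠ ∞) :
    lorentzNorm ∞ f ≠ ∞ := by
  obtain ⟨C, hC, hW⟩ := exists_lorentzNorm_top_le (𝕜 := 𝕜) hq
  exact ne_top_of_le_ne_top (ENNReal.mul_ne_top hC h) (hW f)

theorem truncGauge_le_gauge (hq : 1 < q) (f : ℕ → 𝕜) : truncGauge q f ≤ gauge q f := by
  by_cases h : lorentzNorm q f = ∞
  · simp [gauge, h]
  · exact max_le_max (truncNorm_le_normB
      (tendsto_zero_of_lorentzNorm_top (lorentzNorm_top_ne_top hq h))) le_rfl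

theorem exists_gauge_le (hq : 1 < q) : ∃ C : ℝ≥0∞, C ≠ ∞ ∧ ∀ f : ℕ → 𝕜,
    truncNorm f + lorentzNorm ∞ f ≤ C * truncGauge q f ∧ gauge q f ≤ C * truncGauge q f := by
  obtain ⟨C, hC, hW⟩ := exists_lorentzNorm_top_le (𝕜 := 𝕜) hq
  have key : ∀ f : ℕ → 𝕜, truncNorm f + lorentzNorm ∞ f ≤ (1 + C) * truncGauge q f := fun f => by
    rw [add_mul, one_mul]
    refine add_le_add (le_max_left _ _) ((hW f).trans ?_)
    gcongr
    exact le_max_right _ _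
  refine ⟨1 + C, by simpa using hC, fun f => ⟨key f, ?_⟩⟩
  refine max_le ((normB_le f).trans (key f)) ((le_max_right (truncNorm f) _).trans ?_)
  exact le_mul_of_one_le_left zero_le le_self_add

theorem gauge_smul (hq : 1 < q) (c : 𝕜) (f : ℕ → 𝕜) :
    gauge q (c • f) = ‖c‖ₑ * gauge q f := by
  rw [gauge, normB_smul, lorentzNorm_smul hq, gauge, mul_max]

theorem gauge_zero (hq : 1 < q) : gauge q (0 : ℕ → 𝕜) = 0 := by
  simpa using gauge_smul hq (0 : 𝕜) (0 : ℕ → 𝕜)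

theorem gauge_neg (hq : 1 < q) (f : ℕ → 𝕜) : gauge q (-f) = gauge q f := by
  simpa using gauge_smul hq (-1 : 𝕜) f

theorem exists_gauge_sum_rpow_le (hq : 1 < q) {p : ℝ} (hp0 : 0 < p) (hp1 : p < 1) :
    ∃ C : ℝ≥0∞, C ≠ ∞ ∧ ∀ (n : ℕ) (g : Fin n → ℕ → 𝕜),
      gauge q (∑ j, g j) ^ p ≤ C * ∑ j, gauge q (g j) ^ p := by
  obtain ⟨C₀, hC₀, hG⟩ := exists_gauge_le (𝕜 := 𝕜) hq
  obtain ⟨C₁, hC₁, hT⟩ := exists_truncNorm_sum_rpow_le (𝕜 := 𝕜) hp0 hp1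
  obtain ⟨C₂, hC₂, hL⟩ := exists_lorentzNorm_sum_rpow_le (𝕜 := 𝕜) hq hp0 hp1
  refine ⟨C₀ ^ p * (C₁ * C₀ ^ p + C₂), ?_, fun n g => ?_⟩
  · have := ENNReal.rpow_ne_top_of_nonneg hp0.le hC₀
    exact ENNReal.mul_ne_top this (ENNReal.add_ne_top.2 ⟨ENNReal.mul_ne_top hC₁ this, hC₂⟩)
  set S := ∑ j, gauge q (g j) ^ p with hS
  have h1 : truncNorm (∑ j, g j) ^ p ≤ C₁ * C₀ ^ p * S := by
    refine (hT n g).trans ?_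
    rw [mul_assoc, hS, mul_sum (a := C₀ ^ p)]
    gcongr with j
    rw [← ENNReal.mul_rpow_of_nonneg _ _ hp0.le]
    refine ENNReal.rpow_le_rpow ?_ hp0.le
    refine le_trans ?_ (((hG (g j)).1).trans ?_)
    · exact max_le le_self_add le_add_self
    · gcongr
      exact truncGauge_le_gauge hq _
  have h2 : lorentzNorm q (∑ j, g j) ^ p ≤ C₂ * S := by
    refine (hL n g).trans ?_
    rw [hS]
    gcongr with j
    exact le_max_right (normB (g j)) _
  calc gauge q (∑ j, g j) ^ p ≤ (C₀ * truncGauge q (∑ j, g j)) ^ p :=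
        ENNReal.rpow_le_rpow (hG _).2 hp0.le
    _ = C₀ ^ p * truncGauge q (∑ j, g j) ^ p := ENNReal.mul_rpow_of_nonneg _ _ hp0.le
    _ ≤ C₀ ^ p * (C₁ * C₀ ^ p * S + C₂ * S) := by
        gcongr
        rw [truncGauge, (ENNReal.monotone_rpow_of_nonneg hp0.le).map_max]
        exact max_le (h1.trans le_self_add) (h2.trans le_add_self)
    _ = _ := by ring

theorem exists_gauge_add_le (hq : 1 < q) : ∃ C : ℝ≥0∞, C ≠ ∞ ∧ ∀ f g : ℕ → 𝕜,
    gauge q (f + g) ≤ C * (gauge q f + gauge q g) := by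
  obtain ⟨C, hC, h⟩ := exists_gauge_sum_rpow_le (𝕜 := 𝕜) hq (p := 1 / 2) (by norm_num)
    (by norm_num)
  refine ⟨C ^ (2 : ℝ) * 2, ENNReal.mul_ne_top (ENNReal.rpow_ne_top_of_nonneg (by norm_num) hC)
    (by simp), fun f g => ?_⟩
  have h1 := h 2 ![f, g]
  simp only [Fin.sum_univ_two, Matrix.cons_val_zero, Matrix.cons_val_one] at h1
  have e : ∀ x : ℝ≥0∞, (x ^ (1 / 2 : ℝ)) ^ (2 : ℝ) = x := fun x => by
    rw [← ENNReal.rpow_mul]; norm_num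
  have h2 := ENNReal.rpow_le_rpow h1 (z := 2) (by norm_num)
  rw [e, ENNReal.mul_rpow_of_nonneg _ _ (by norm_num)] at h2
  refine h2.trans ?_
  rw [mul_assoc]
  gcongr
  refine (ENNReal.rpow_add_le_mul_rpow_add_rpow _ _ (by norm_num)).trans_eq ?_
  rw [e, e]
  norm_num

theorem isClosed_setOf_truncGauge_le (hq : 1 < q) (ε : ℝ≥0∞) :
    IsClosed {f : ℕ → 𝕜 | truncGauge q f ≤ ε} := by
  have : {f : ℕ → 𝕜 | truncGauge q f ≤ ε} =
      truncNorm ⁻¹' Set.Iic ε ∩ lorentzNorm q ⁻¹' Set.Iic ε := by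
    ext f
    simp [truncGauge]
  rw [this]
  exact (lowerSemicontinuous_truncNorm.isClosed_preimage ε).inter
    ((lowerSemicontinuous_lorentzNorm hq).isClosed_preimage ε)

theorem exists_gauge_indicator_Iio_le (hq : 1 < q) : ∃ C : ℝ≥0∞, C ≠ ∞ ∧
    ∀ (f : ℕ → 𝕜) (m : ℕ), gauge q ((Set.Iio m).indicator f) ≤ C * gauge q f := by
  obtain ⟨C, hC, h⟩ := exists_gauge_le (𝕜 := 𝕜) hq
  refine ⟨C, hC, fun f m => (h _).2.trans ?_⟩
  gcongr
  refine le_trans (max_le_max (truncNorm_indicator_Iio_le f m) (lorentzNorm_mono hq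
    (rearr_mono fun n => ?_))) (truncGauge_le_gauge hq f)
  exact enorm_indicator_le_enorm_self _ _

theorem exists_gauge_greedy_le (hq : 1 < q) : ∃ C : ℝ≥0∞, C ≠ ∞ ∧
    ∀ (f : ℕ → 𝕜) (A B : Finset ℕ), IsGreedySet f A → B.card ≤ A.card →
      gauge q ((A : Set ℕ)ᶜ.indicator f) ≤ C * gauge q ((B : Set ℕ)ᶜ.indicator f) := by
  obtain ⟨C, hC, h⟩ := exists_gauge_le (𝕜 := 𝕜) hq
  refine ⟨C * (2 * C + 1), ENNReal.mul_ne_top hC (by finiteness), fun f A B hA hAB => ?_⟩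
  set g := (B : Set ℕ)ᶜ.indicator f
  refine (h _).2.trans ?_
  rw [mul_assoc]
  gcongr
  refine max_le ((truncNorm_greedy_le hA hAB).trans ?_)
    ((lorentzNorm_mono hq (rearr_greedy_le hA hAB)).trans ?_)
  · calc truncNorm g + 2 * lorentzNorm ∞ g ≤ 2 * (truncNorm g + lorentzNorm ∞ g) := by
          rw [mul_add]
          gcongr
          exact le_mul_of_one_le_left zero_le (by norm_num)
      _ ≤ 2 * (C * gauge q g) := by
          gcongr
          exact (h g).1.trans (mul_le_mul_right (truncGauge_le_gauge hq g) _)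
      _ ≤ _ := by
          rw [add_mul, mul_assoc]
          exact le_self_add
  · rw [add_mul, one_mul]
    exact (le_max_right (normB g) _).trans le_add_self

theorem enorm_sum_Icc_le_gauge (hq : 1 < q) (f : ℕ → 𝕜) (a b : ℕ) :
    ‖∑ n ∈ Icc a b, f n‖ₑ ≤ gauge q f :=
  (enorm_sum_Icc_le_truncNorm f a b).trans ((le_max_left _ _).trans (truncGauge_le_gauge hq f))

theorem enorm_le_gauge (hq : 1 < q) (f : ℕ → 𝕜) (n : ℕ) : ‖f n‖ₑ ≤ gauge q f := by
  simpa using enorm_sum_Icc_le_gauge hq f n n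

/-- Bounding all k weights by the largest one loses nothing that matters: k · k^(Q-1) c^Q = (k c)^Q.
Constant 1 here makes the quasi-norm of an indicator exactly |A|. -/
theorem lorentzSeq_le_of_support (hq : 1 < q) {r : ℕ → ℝ≥0∞} {c : ℝ≥0∞} {k : ℕ}
    (h : ∀ m, r m ≤ c) (h0 : ∀ m, k ≤ m → r m = 0) : lorentzSeq q r ≤ k * c := by
  by_cases hq' : q = ∞
  · subst hq'
    rw [lorentzSeq_top]
    refine iSup_le fun m => ?_
    rcases le_or_gt k m with hm | hm
    · simp [h0 m hm]
    · have : (m : ℝ≥0∞) + 1 ≤ k := by exact_mod_cast hm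
      exact mul_le_mul' this (h m)
  · have h1 := one_lt_toReal hq hq'
    rw [lorentzSeq_of_ne_top hq hq']
    set Q := q.toReal
    have hQ0 : 0 < Q := by linarith
    rw [one_div, ENNReal.rpow_inv_le_iff hQ0, tsum_eq_sum (s := range k)]
    · calc _ ≤ ∑ m ∈ range k, (k : ℝ≥0∞) ^ (Q - 1) * c ^ Q := by
            refine sum_le_sum fun m hm => ?_
            have : (m : ℝ≥0∞) + 1 ≤ k := by exact_mod_cast mem_range.1 hm
            exact mul_le_mul' (ENNReal.rpow_le_rpow this (by linarith))
              (ENNReal.rpow_le_rpow (h m) hQ0.le)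
        _ = (k : ℝ≥0∞) ^ (1 : ℝ) * (k : ℝ≥0∞) ^ (Q - 1) * c ^ Q := by
            rw [sum_const, card_range, nsmul_eq_mul, ENNReal.rpow_one, mul_assoc]
        _ = _ := by
            rw [← ENNReal.rpow_add_of_nonneg _ _ (by norm_num) (by linarith), add_sub_cancel,
              ENNReal.mul_rpow_of_nonneg _ _ hQ0.le]
    · intro m hm
      rw [h0 m (by simpa using hm), ENNReal.zero_rpow_of_pos hQ0, mul_zero]

theorem rearr_eq_zero_of_support {f : ℕ → 𝕜} {A : Finset ℕ} (hA : ∀ n ∉ A, f n = 0) {m : ℕ}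
    (hm : A.card ≤ m) : rearr f m = 0 := by
  by_contra h
  obtain ⟨B, hB, hBf⟩ := exists_finset_of_lt_rearr (pos_iff_ne_zero.2 h)
  have : B ⊆ A := fun n hn => by
    by_contra hnA
    simpa [hA n hnA] using hBf n hn
  have := card_le_card this
  omega

theorem gauge_le_card_mul (hq : 1 < q) {f : ℕ → 𝕜} {A : Finset ℕ} {c : ℝ≥0∞}
    (hA : ∀ n ∉ A, f n = 0) (hc : ∀ n, ‖f n‖ₑ ≤ c) : gauge q f ≤ A.card * c := by
  refine max_le (iSup₂_le fun D _ => iSup₂_le fun a b => ?_)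
    (lorentzSeq_le_of_support hq (rearr_le_of_forall_le hc) fun m => rearr_eq_zero_of_support hA)
  rw [← sum_inter_add_sum_sdiff _ A, sum_eq_zero (s := (Icc a b \ D) \ A), add_zero]
  · refine (enorm_sum_le_card_mul fun n _ => hc n).trans ?_
    exact mul_le_mul_left (Nat.cast_le.2 (card_le_card inter_subset_right)) _
  · exact fun n hn => hA n (Finset.mem_sdiff.1 hn).2

theorem gauge_ne_top_of_support (hq : 1 < q) {f : ℕ → 𝕜} (hf : f.support.Finite) :
    gauge q f ≠ ∞ := by
  have hA : ∀ n ∉ hf.toFinset, f n = 0 := fun n hn => by simpa using hn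
  refine ne_top_of_le_ne_top ?_ (gauge_le_card_mul hq (c := ∑ n ∈ hf.toFinset, ‖f n‖ₑ) hA
    fun n => ?_)
  · exact ENNReal.mul_ne_top (by simp) (ENNReal.sum_ne_top.2 fun _ _ => enorm_ne_top)
  · by_cases hn : n ∈ hf.toFinset
    · exact single_le_sum (f := fun n => ‖f n‖ₑ) (fun _ _ => zero_le) hn
    · simp [hA n hn]

end Gauge

/-! ### The space `𝔹₀ ∩ 𝕊_q` as the closure of the finitely supported sequences -/

section Space

variable {𝕜 : Type u} [RCLike 𝕜] {q : ℝ≥0∞}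

variable (𝕜) in
/-- The sequences that can be approximated by finitely supported ones. -/
def approxSpace (hq : 1 < q) : Submodule 𝕜 (ℕ → 𝕜) where
  carrier := {f | ∀ ε : ℝ≥0∞, ε ≠ 0 → ∃ g : ℕ → 𝕜, g.support.Finite ∧ gauge q (f - g) ≤ ε}
  zero_mem' := fun ε _ => ⟨0, by simp, by simp [gauge_zero hq]⟩
  add_mem' := by
    intro f f' hf hf' ε hε
    obtain ⟨C, hC, h⟩ := exists_gauge_add_le (𝕜 := 𝕜) hq
    have hδ : ε / (2 * (C + 1)) ≠ 0 := ENNReal.div_ne_zero.2 ⟨hε, by finiteness⟩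
    obtain ⟨g, hg, hfg⟩ := hf _ hδ
    obtain ⟨g', hg', hfg'⟩ := hf' _ hδ
    refine ⟨g + g', (hg.union hg').subset (Function.support_add _ _), ?_⟩
    rw [add_sub_add_comm]
    calc _ ≤ C * (gauge q (f - g) + gauge q (f' - g')) := h _ _
      _ ≤ (C + 1) * (ε / (2 * (C + 1)) + ε / (2 * (C + 1))) := by
          gcongr; exact le_self_add
      _ = 2 * (C + 1) * (ε / (2 * (C + 1))) := by ring
      _ ≤ ε := ENNReal.mul_div_le
  smul_mem' := by
    intro c f hf ε hε
    have hδ : ε / (‖c‖ₑ + 1) ≠ 0 := ENNReal.div_ne_zero.2 ⟨hε, by finiteness⟩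
    obtain ⟨g, hg, hfg⟩ := hf _ hδ
    refine ⟨c • g, hg.subset (Function.support_const_smul_subset _ _), ?_⟩
    rw [← smul_sub, gauge_smul hq]
    calc _ ≤ (‖c‖ₑ + 1) * (ε / (‖c‖ₑ + 1)) := by gcongr; exact le_self_add
      _ ≤ ε := ENNReal.mul_div_le

theorem mem_approxSpace_of_support (hq : 1 < q) {f : ℕ → 𝕜} (hf : f.support.Finite) :
    f ∈ approxSpace 𝕜 hq := fun ε _ => ⟨f, hf, by simp [gauge_zero hq]⟩

theorem gauge_ne_top (hq : 1 < q) {f : ℕ → 𝕜} (hf : f ∈ approxSpace 𝕜 hq) : gauge q f ≠ ∞ := by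
  obtain ⟨C, hC, h⟩ := exists_gauge_add_le (𝕜 := 𝕜) hq
  obtain ⟨g, hg, hfg⟩ := hf 1 one_ne_zero
  have := h (f - g) g
  rw [sub_add_cancel] at this
  exact ne_top_of_le_ne_top (ENNReal.mul_ne_top hC (ENNReal.add_ne_top.2
    ⟨ne_top_of_le_ne_top (by simp) hfg, gauge_ne_top_of_support hq hg⟩)) this

theorem IsGreedySet.union {f : ℕ → 𝕜} {A B : Finset ℕ} (hA : IsGreedySet f A)
    (hB : IsGreedySet f B) : IsGreedySet f (A ∪ B) := by
  intro n hn k hk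
  rw [Finset.mem_union, not_or] at hk
  rcases Finset.mem_union.1 hn with hn | hn
  · exact hA n hn k hk.1
  · exact hB n hn k hk.2

/-- Apply `beta_le_of_eqOn` to h = f - g, with g a finitely supported approximant and D its support.
What remains is |D| times the threshold of A, and this tends to 0 along the greedy sets when f has
infinite support. -/
theorem mem_spaceB0_of_mem_approxSpace (hq : 1 < q) {f : ℕ → 𝕜} (hf : f ∈ approxSpace 𝕜 hq) :
    f ∈ spaceB0 𝕜 := by
  have hft := gauge_ne_top hq hf
  have hW : lorentzNorm ∞ f ≠ ∞ :=
    lorentzNorm_top_ne_top hq (ne_top_of_le_ne_top hft (le_max_right _ _))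
  have hf0 := tendsto_zero_of_lorentzNorm_top hW
  refine ⟨hf0, ENNReal.tendsto_nhds_zero.2 fun ε hε => ?_⟩
  obtain ⟨C, hC, hG⟩ := exists_gauge_le (𝕜 := 𝕜) hq
  by_cases hfin : f.support.Finite
  · have hgr : IsGreedySet f hfin.toFinset := fun n _ k hk => by
      have : f k = 0 := by simpa using hk
      simp [this]
    filter_upwards [eventually_ge_atTop
      (⟨hfin.toFinset, hgr⟩ : {A : Finset ℕ // IsGreedySet f A})] with A hA
    refine iSup₂_le fun a b => ?_
    rw [Finset.sum_eq_zero]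
    · simp
    · intro n hn
      by_contra hne
      exact (Finset.mem_sdiff.1 hn).2 (hA (by simpa using hne))
  have hδ : ε / 2 / (C + 1) ≠ 0 := ENNReal.div_ne_zero.2
    ⟨(ENNReal.half_pos hε.ne').ne', by simpa using hC⟩
  obtain ⟨g, hg, hfg⟩ := hf _ hδ
  set D := hg.toFinset
  set δ : ℝ≥0∞ := ε / 2 / (2 * (D.card + 1))
  have hδ0 : δ ≠ 0 := ENNReal.div_ne_zero.2 ⟨(ENNReal.half_pos hε.ne').ne', by finiteness⟩
  -- A greedy set containing an index with a tiny nonzero entry has a tiny threshold; infinite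
  -- support provides such an index.
  obtain ⟨n₀, hn₀, hn₀'⟩ : ∃ n, f n ≠ 0 ∧ ‖f n‖ₑ ≤ δ := by
    have h1 : ∀ᶠ n in cofinite, ‖f n‖ₑ ≤ δ := by
      rw [Nat.cofinite_eq_atTop]
      exact ENNReal.tendsto_nhds_zero.1 (tendsto_zero_iff_enorm_tendsto_zero.1 hf0) δ
        (pos_iff_ne_zero.2 hδ0)
    have h2 : ∃ᶠ n in cofinite, f n ≠ 0 := frequently_cofinite_iff_infinite.2 hfin
    exact (h2.and_eventually h1).exists
  have hA₀ := finite_setOf_le_enorm hW (t := ‖f n₀‖ₑ) (by simpa using hn₀)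
  have hgr : IsGreedySet f hA₀.toFinset := by
    intro n hn k hk
    simp only [Set.Finite.mem_toFinset, Set.mem_ofPred_eq, not_le] at hn hk
    exact enorm_le_iff_norm_le.1 (hk.le.trans hn)
  filter_upwards [eventually_ge_atTop
    (⟨hA₀.toFinset, hgr⟩ : {A : Finset ℕ // IsGreedySet f A})] with A hA
  have hn₀A : n₀ ∈ A.1 := hA (by simp)
  obtain ⟨t, ht, ht', -⟩ := A.2.exists_threshold ⟨n₀, hn₀A⟩
  have htδ : (t : ℝ≥0∞) ≤ δ := le_trans (by exact_mod_cast ht n₀ hn₀A) hn₀'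
  refine (beta_le_of_eqOn (h := f - g) (D := D) ht ht' fun n hn => ?_).trans ?_
  · have : g n = 0 := by simpa [D] using hn
    simp [this]
  · calc _ ≤ C * gauge q (f - g) + 2 * (D.card * δ) := by
          gcongr
          exact (hG _).1.trans (mul_le_mul_right (truncGauge_le_gauge hq _) _)
      _ ≤ (C + 1) * (ε / 2 / (C + 1)) + 2 * (D.card + 1) * δ := by
          rw [← mul_assoc]
          gcongr
          · exact le_self_add
          · exact le_self_add
      _ ≤ ε / 2 + ε / 2 := add_le_add ENNReal.mul_div_le ENNReal.mul_div_le
      _ = ε := ENNReal.add_halves _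

theorem mem_lorentzSpace_of_mem_approxSpace (hq : 1 < q) {f : ℕ → 𝕜}
    (hf : f ∈ approxSpace 𝕜 hq) : f ∈ lorentzSpace 𝕜 q := by
  refine ⟨lt_top_iff_ne_top.2 (ne_top_of_le_ne_top (gauge_ne_top hq hf) (le_max_right _ _)), ?_⟩
  rintro rfl
  refine ENNReal.tendsto_nhds_zero.2 fun ε hε => ?_
  obtain ⟨g, hg, hfg⟩ := hf _ (ENNReal.half_pos hε.ne').ne'
  set D := hg.toFinset with hD
  have hshift : ∀ m, rearr f (m + D.card) ≤ rearr (f - g) m := by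
    refine rearr_add_le_rearr D.card fun s A hA => ⟨A \ D, ?_, fun n hn => ?_⟩
    · have := Finset.le_card_sdiff D A
      omega
    · rw [Finset.mem_sdiff] at hn
      have : g n = 0 := by simpa [D] using hn.2
      simpa [this] using hA n hn.1
  -- Discarding D shifts the rearrangement by |D|. For m ≥ 2|D| the weight m + 1 is at most twice
  -- the shifted weight m - |D| + 1.
  filter_upwards [eventually_ge_atTop (D.card + D.card)] with m hm
  obtain ⟨k, rfl⟩ := Nat.exists_eq_add_of_le' hm
  have h1 := hshift (k + D.card)
  have h2 : ((k + D.card : ℕ) + 1 : ℝ≥0∞) * rearr (f - g) (k + D.card) ≤ ε / 2 :=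
    (le_iSup (fun m : ℕ => ((m : ℝ≥0∞) + 1) * rearr (f - g) m) _).trans
      (((le_max_right _ _ : lorentzNorm ∞ (f - g) ≤ _)).trans hfg)
  calc _ ≤ (2 * ((k + D.card : ℕ) + 1 : ℝ≥0∞)) * rearr (f - g) (k + D.card) := by
        rw [← add_assoc]
        refine mul_le_mul' ?_ h1
        norm_cast
        omega
    _ = 2 * (((k + D.card : ℕ) + 1 : ℝ≥0∞) * rearr (f - g) (k + D.card)) := by ring
    _ ≤ 2 * (ε / 2) := by gcongr
    _ ≤ ε := ENNReal.mul_div_le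

/-- The approximant keeps the entries of modulus above a small t. Every truncated sum of the
remainder h is a truncated sum of f at a level at most t, that is, an interval sum off a greedy set
containing A₀, and so is small. The Lorentz gauge of h is small by absolute continuity. -/
theorem mem_approxSpace_of_mem (hq : 1 < q) {f : ℕ → 𝕜} (hf : f ∈ spaceB0 𝕜)
    (hf' : f ∈ lorentzSpace 𝕜 q) : f ∈ approxSpace 𝕜 hq := by
  by_cases hfin : f.support.Finite
  · exact mem_approxSpace_of_support hq hfin
  obtain ⟨hf0, hβ⟩ := hf
  intro ε hε
  obtain ⟨C, hC, hG⟩ := exists_gauge_le (𝕜 := 𝕜) hq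
  set ε' : ℝ≥0∞ := ε / (C + 1)
  have hε' : ε' ≠ 0 := ENNReal.div_ne_zero.2 ⟨hε, by simpa using hC⟩
  obtain ⟨δ, hδ, hL⟩ := exists_lorentzSeq_le hq hf'.1 hf'.2 hε'
  have : Nonempty {A : Finset ℕ // IsGreedySet f A} := ⟨⟨∅, isGreedySet_empty f⟩⟩
  have : IsDirectedOrder {A : Finset ℕ // IsGreedySet f A} :=
    ⟨fun A B => ⟨⟨A.1 ∪ B.1, A.2.union B.2⟩, Finset.subset_union_left, Finset.subset_union_right⟩⟩
  obtain ⟨A₀, hA₀⟩ := eventually_atTop.1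
    (ENNReal.tendsto_nhds_zero.1 hβ ε' (pos_iff_ne_zero.2 hε'))
  -- A zero entry in a greedy set would force f to vanish outside it. Infinite support therefore
  -- leaves room for a positive t below all moduli on A₀.
  have hne : ∀ n ∈ A₀.1, f n ≠ 0 := by
    intro n hn h0
    refine hfin (A₀.1.finite_toSet.subset fun k hk => ?_)
    by_contra hkA
    have := A₀.2 n hn k hkA
    rw [h0, norm_zero] at this
    exact hk (norm_le_zero_iff.1 this)
  obtain ⟨t, ht0, htA, htδ⟩ : ∃ t : NNReal, 0 < t ∧ (∀ n ∈ A₀.1, t < ‖f n‖₊) ∧ (t : ℝ≥0∞) ≤ δ := by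
    have h1 : ∀ᶠ t : NNReal in 𝓝[>] 0, ∀ n ∈ A₀.1, t < ‖f n‖₊ := by
      rw [Filter.eventually_all_finset]
      intro n hn
      exact (gt_mem_nhds (nnnorm_pos.2 (hne n hn))).filter_mono nhdsWithin_le_nhds
    have h2 : ∀ᶠ t : NNReal in 𝓝[>] 0, (t : ℝ≥0∞) ≤ δ := by
      have : Tendsto (fun t : NNReal => (t : ℝ≥0∞)) (𝓝[>] 0) (𝓝 0) :=
        (ENNReal.continuous_coe.tendsto' 0 0 (by simp)).mono_left nhdsWithin_le_nhds
      exact ENNReal.tendsto_nhds_zero.1 this δ (pos_iff_ne_zero.2 hδ)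
    obtain ⟨t, h⟩ := (Filter.Eventually.and (self_mem_nhdsWithin (s := Set.Ioi (0 : NNReal)))
      (h1.and h2)).exists
    exact ⟨t, h.1, h.2.1, h.2.2⟩
  set h : ℕ → 𝕜 := {n | ‖f n‖₊ ≤ t}.indicator f with hh
  have hT : truncNorm h ≤ ε' := by
    refine iSup_le fun s => iSup₂_le fun a b => ?_
    have e : ∑ n ∈ Finset.Icc a b with ‖h n‖₊ ≤ s, h n =
        ∑ n ∈ Finset.Icc a b with ‖f n‖₊ ≤ min s t, f n := by
      rw [Finset.sum_filter, Finset.sum_filter]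
      refine Finset.sum_congr rfl fun n _ => ?_
      by_cases hn : ‖f n‖₊ ≤ t <;> simp [hh, hn]
    rw [e]
    rcases eq_or_ne (min s t) 0 with h0 | h0
    · rw [h0, sum_filter_nnnorm_le_zero]
      simp
    · obtain ⟨F, hF, hmem⟩ := exists_isGreedySet_level hf0 h0
      refine (enorm_sum_filter_le_beta hmem a b).trans (hA₀ ⟨F, hF⟩ fun n hn => ?_)
      exact (hmem n).2 ((min_le_right _ _).trans_lt (htA n hn))
  have hLh : lorentzNorm q h ≤ ε' := by
    refine hL (rearr h) (fun m => (rearr_le_of_forall_le (fun n => ?_) m).trans htδ)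
      (rearr_mono fun n => enorm_indicator_le_enorm_self _ _)
    by_cases hn : ‖f n‖₊ ≤ t
    · have : h n = f n := by simp [hh, hn]
      rw [this]
      exact_mod_cast hn
    · simp [hh, hn]
  obtain ⟨F, -, hmem⟩ := exists_isGreedySet_level hf0 ht0.ne'
  refine ⟨f - h, F.finite_toSet.subset fun n hn => ?_, ?_⟩
  · by_contra hnF
    have : ‖f n‖₊ ≤ t := not_lt.1 fun h' => hnF ((hmem n).2 h')
    exact hn (by simp [hh, this])
  · rw [sub_sub_cancel]
    calc gauge q h ≤ C * truncGauge q h := (hG h).2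
      _ ≤ (C + 1) * ε' := by
          gcongr
          · exact le_self_add
          · exact max_le hT hLh
      _ ≤ ε := ENNReal.mul_div_le

theorem coe_approxSpace (hq : 1 < q) :
    (approxSpace 𝕜 hq : Set (ℕ → 𝕜)) = spaceB0 𝕜 ∩ lorentzSpace 𝕜 q :=
  Set.Subset.antisymm (fun _ hf => ⟨mem_spaceB0_of_mem_approxSpace hq hf,
    mem_lorentzSpace_of_mem_approxSpace hq hf⟩) fun _ hf => mem_approxSpace_of_mem hq hf.1 hf.2

end Space

/-! ### The quasi-Banach space and its unit vector basis -/

section QuasiBanach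

open Finset

variable {𝕜 : Type u} [RCLike 𝕜] {q : ℝ≥0∞}

/-- The quasi-norm of `𝔹₀ ∩ 𝕊_q`. -/
def spaceNorm (hq : 1 < q) (f : approxSpace 𝕜 hq) : ℝ := (gauge q (f : ℕ → 𝕜)).toReal

theorem ofReal_spaceNorm (hq : 1 < q) (f : approxSpace 𝕜 hq) :
    ENNReal.ofReal (spaceNorm hq f) = gauge q (f : ℕ → 𝕜) :=
  ENNReal.ofReal_toReal (gauge_ne_top hq f.2)

theorem spaceNorm_nonneg (hq : 1 < q) (f : approxSpace 𝕜 hq) : 0 ≤ spaceNorm hq f :=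
  ENNReal.toReal_nonneg

theorem spaceNorm_le (hq : 1 < q) {f : approxSpace 𝕜 hq} {r : ℝ} (hr : 0 ≤ r)
    (h : gauge q (f : ℕ → 𝕜) ≤ ENNReal.ofReal r) : spaceNorm hq f ≤ r :=
  ENNReal.toReal_le_of_le_ofReal hr h

theorem spaceNorm_le_mul (hq : 1 < q) {f g : approxSpace 𝕜 hq} {C : ℝ≥0∞} (hC : C ≠ ∞)
    (h : gauge q (f : ℕ → 𝕜) ≤ C * gauge q (g : ℕ → 𝕜)) :
    spaceNorm hq f ≤ C.toReal * spaceNorm hq g := by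
  rw [spaceNorm, spaceNorm, ← ENNReal.toReal_mul]
  exact ENNReal.toReal_mono (ENNReal.mul_ne_top hC (gauge_ne_top hq g.2)) h

theorem norm_le_spaceNorm_of_enorm_le (hq : 1 < q) {x : 𝕜} {f : approxSpace 𝕜 hq}
    (h : ‖x‖ₑ ≤ gauge q (f : ℕ → 𝕜)) : ‖x‖ ≤ spaceNorm hq f := by
  rw [← toReal_enorm]
  exact ENNReal.toReal_mono (gauge_ne_top hq f.2) h

theorem norm_apply_le_spaceNorm (hq : 1 < q) (f : approxSpace 𝕜 hq) (n : ℕ) :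
    ‖(f : ℕ → 𝕜) n‖ ≤ spaceNorm hq f :=
  norm_le_spaceNorm_of_enorm_le hq (enorm_le_gauge hq _ n)

theorem spaceNorm_smul (hq : 1 < q) (c : 𝕜) (f : approxSpace 𝕜 hq) :
    spaceNorm hq (c • f) = ‖c‖ * spaceNorm hq f := by
  rw [spaceNorm, Submodule.coe_smul, gauge_smul hq, ENNReal.toReal_mul, toReal_enorm, spaceNorm]

theorem isQuasiNorm_spaceNorm (hq : 1 < q) : IsQuasiNorm 𝕜 (spaceNorm (𝕜 := 𝕜) hq) where
  nonneg := spaceNorm_nonneg hq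
  pos := by
    intro f hf
    refine (spaceNorm_nonneg hq f).lt_of_ne' fun h0 => hf ?_
    ext n
    have := norm_apply_le_spaceNorm hq f n
    rw [h0] at this
    simpa using this
  smul := spaceNorm_smul hq
  add := by
    obtain ⟨C, hC, h⟩ := exists_gauge_add_le (𝕜 := 𝕜) hq
    refine ⟨C.toReal, fun f g => ?_⟩
    rw [spaceNorm, spaceNorm, spaceNorm, ← ENNReal.toReal_add (gauge_ne_top hq f.2)
      (gauge_ne_top hq g.2), ← ENNReal.toReal_mul]
    exact ENNReal.toReal_mono (ENNReal.mul_ne_top hC (ENNReal.add_ne_top.2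
      ⟨gauge_ne_top hq f.2, gauge_ne_top hq g.2⟩)) (h _ _)

/-- The space of approximable sequences is closed. -/
theorem mem_approxSpace_of_approx (hq : 1 < q) {f : ℕ → 𝕜}
    (h : ∀ ε : ℝ≥0∞, ε ≠ 0 → ∃ g ∈ approxSpace 𝕜 hq, gauge q (f - g) ≤ ε) :
    f ∈ approxSpace 𝕜 hq := by
  obtain ⟨C, hC, hadd⟩ := exists_gauge_add_le (𝕜 := 𝕜) hq
  intro ε hε
  have hδ : ε / (2 * (C + 1)) ≠ 0 := ENNReal.div_ne_zero.2 ⟨hε, by finiteness⟩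
  obtain ⟨g, hg, hfg⟩ := h _ hδ
  obtain ⟨g', hg', hgg'⟩ := hg _ hδ
  refine ⟨g', hg', ?_⟩
  rw [← sub_add_sub_cancel f g g']
  calc _ ≤ C * (gauge q (f - g) + gauge q (g - g')) := hadd _ _
    _ ≤ (C + 1) * (ε / (2 * (C + 1)) + ε / (2 * (C + 1))) := by
        gcongr; exact le_self_add
    _ = 2 * (C + 1) * (ε / (2 * (C + 1))) := by ring
    _ ≤ ε := ENNReal.mul_div_le

theorem isQuasiBanach_spaceNorm (hq : 1 < q) : IsQuasiBanach 𝕜 (spaceNorm (𝕜 := 𝕜) hq) where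
  toIsQuasiNorm := isQuasiNorm_spaceNorm hq
  complete := by
    intro u hu
    have hcauchy : ∀ k, CauchySeq fun n => (u n : ℕ → 𝕜) k := by
      intro k
      rw [Metric.cauchySeq_iff]
      intro ε hε
      obtain ⟨n₀, h⟩ := hu ε hε
      refine ⟨n₀, fun m hm n hn => ?_⟩
      rw [dist_eq_norm]
      exact (norm_apply_le_spaceNorm hq (u m - u n) k).trans_lt (h m n hm hn)
    choose f hf using fun k => cauchySeq_tendsto_of_complete (hcauchy k)
    obtain ⟨C, hC, hG⟩ := exists_gauge_le (𝕜 := 𝕜) hq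
    have key : ∀ ε : ℝ, 0 < ε → ∃ n₀, ∀ n ≥ n₀,
        gauge q ((u n : ℕ → 𝕜) - f) ≤ C * ENNReal.ofReal ε := by
      intro ε hε
      obtain ⟨n₀, h⟩ := hu ε hε
      refine ⟨n₀, fun n hn => (hG _).2.trans ?_⟩
      gcongr
      -- A Fatou argument: the sublevel sets of `truncGauge` are closed under coordinatewise limits,
      -- so the Cauchy estimate passes to the limit in m.
      have hlim : Tendsto (fun m => (u n : ℕ → 𝕜) - (u m : ℕ → 𝕜)) atTop
          (𝓝 ((u n : ℕ → 𝕜) - f)) :=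
        tendsto_const_nhds.sub (tendsto_pi_nhds.2 hf)
      refine (isClosed_setOf_truncGauge_le hq (ENNReal.ofReal ε)).mem_of_tendsto hlim ?_
      filter_upwards [eventually_ge_atTop n₀] with m hm
      have h1 := ENNReal.ofReal_le_ofReal (h n m hn hm).le
      rw [ofReal_spaceNorm] at h1
      exact (truncGauge_le_gauge hq _).trans h1
    have hCt : C * ENNReal.ofReal 0 = 0 := by simp
    have hfX : f ∈ approxSpace 𝕜 hq := by
      refine mem_approxSpace_of_approx hq fun ε hε => ?_
      have : Tendsto (fun r : ℝ => C * ENNReal.ofReal r) (𝓝[>] 0) (𝓝 0) := by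
        have hc : Continuous fun r : ℝ => C * ENNReal.ofReal r :=
          (ENNReal.continuous_const_mul hC).comp ENNReal.continuous_ofReal
        exact (hc.tendsto' 0 0 hCt).mono_left nhdsWithin_le_nhds
      obtain ⟨r, hr0, hr⟩ := (Filter.Eventually.and (self_mem_nhdsWithin (s := Set.Ioi (0 : ℝ)))
        (ENNReal.tendsto_nhds_zero.1 this ε (pos_iff_ne_zero.2 hε))).exists
      obtain ⟨n₀, h⟩ := key r hr0
      refine ⟨u n₀, (u n₀).2, ?_⟩
      rw [← gauge_neg hq, neg_sub]
      exact (h n₀ le_rfl).trans hr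
    refine ⟨⟨f, hfX⟩, Metric.tendsto_atTop.2 fun ε hε => ?_⟩
    obtain ⟨n₀, h⟩ := key (ε / 2 / (C.toReal + 1)) (by positivity)
    refine ⟨n₀, fun n hn => ?_⟩
    rw [Real.dist_eq, sub_zero, abs_of_nonneg (spaceNorm_nonneg hq _)]
    refine lt_of_le_of_lt (spaceNorm_le hq (r := ε / 2) (by positivity) ((h n hn).trans ?_))
      (half_lt_self hε)
    rw [← ENNReal.ofReal_toReal hC, ← ENNReal.ofReal_mul ENNReal.toReal_nonneg]
    refine ENNReal.ofReal_le_ofReal ?_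
    rw [ENNReal.toReal_ofReal ENNReal.toReal_nonneg, ← mul_div_assoc,
      div_le_iff₀ (by positivity)]
    nlinarith [ENNReal.toReal_nonneg (a := C)]

theorem exists_spaceNorm_sum_rpow_le (hq : 1 < q) {p : ℝ} (hp0 : 0 < p) (hp1 : p < 1) :
    ∃ C : ℝ, 0 ≤ C ∧ ∀ (ι : Type) [Fintype ι] (g : ι → approxSpace 𝕜 hq),
      spaceNorm hq (∑ j, g j) ^ p ≤ C * ∑ j, spaceNorm hq (g j) ^ p := by
  obtain ⟨C, hC, h⟩ := exists_gauge_sum_rpow_le (𝕜 := 𝕜) hq hp0 hp1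
  refine ⟨C.toReal, ENNReal.toReal_nonneg, fun ι _ g => ?_⟩
  have h1 := h (Fintype.card ι) fun j => (g ((Fintype.equivFin ι).symm j) : ℕ → 𝕜)
  rw [Equiv.sum_comp (Fintype.equivFin ι).symm (fun j => (g j : ℕ → 𝕜)),
    Equiv.sum_comp (Fintype.equivFin ι).symm (fun j => gauge q (g j : ℕ → 𝕜) ^ p)] at h1
  have hne : ∀ j, gauge q (g j : ℕ → 𝕜) ^ p ≠ ∞ := fun j =>
    ENNReal.rpow_ne_top_of_nonneg hp0.le (gauge_ne_top hq (g j).2)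
  have h2 := ENNReal.toReal_mono (ENNReal.mul_ne_top hC
    (ENNReal.sum_ne_top.2 fun j _ => hne j)) h1
  rw [ENNReal.toReal_mul, ENNReal.toReal_sum fun j _ => hne j, ← ENNReal.toReal_rpow] at h2
  simp_rw [← ENNReal.toReal_rpow] at h2
  rw [spaceNorm, AddSubmonoidClass.coe_finsetSum]
  exact h2

theorem locallyPConvex_spaceNorm (hq : 1 < q) {p : ℝ} (hp0 : 0 < p) (hp1 : p < 1) :
    LocallyPConvex 𝕜 (spaceNorm (𝕜 := 𝕜) hq) p := by
  obtain ⟨C, hC, h⟩ := exists_spaceNorm_sum_rpow_le (𝕜 := 𝕜) hq hp0 hp1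
  -- The neighbourhood is the absolutely p-convex hull of the unit ball, written as finite sums with
  -- total p-th power at most 1. It is bounded by the p-convexity estimate.
  refine ⟨{f | ∃ (ι : Type) (_ : Fintype ι) (g : ι → approxSpace 𝕜 hq),
    ∑ j, g j = f ∧ ∑ j, spaceNorm hq (g j) ^ p ≤ 1}, ?_, ⟨1, one_pos, fun f hf => ?_⟩,
    (C + 1) ^ (1 / p), ?_⟩
  · intro n f t hf ht
    choose ι hι g hgf hg using hf
    refine ⟨Σ j, ι j, inferInstance, fun i => t i.1 • g i.1 i.2, ?_, ?_⟩
    · rw [Fintype.sum_sigma]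
      exact Finset.sum_congr rfl fun j _ => by dsimp only; rw [← smul_sum, hgf]
    · rw [Fintype.sum_sigma]
      refine le_trans (Finset.sum_le_sum fun j _ => ?_) ht
      simp_rw [spaceNorm_smul, Real.mul_rpow (norm_nonneg _) (spaceNorm_nonneg hq _)]
      rw [← mul_sum]
      exact mul_le_of_le_one_right (by positivity) (hg j)
  · refine ⟨Unit, inferInstance, fun _ => f, by simp, ?_⟩
    simpa using Real.rpow_le_one (spaceNorm_nonneg hq f) hf hp0.le
  · rintro f ⟨ι, _, g, rfl, hg⟩
    rw [one_div, Real.le_rpow_inv_iff_of_pos (spaceNorm_nonneg hq _) (by positivity) hp0]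
    refine (h ι g).trans ?_
    nlinarith

/-- The unit vectors. -/
def unitVec (hq : 1 < q) (n : ℕ) : approxSpace 𝕜 hq :=
  ⟨Pi.single n 1, mem_approxSpace_of_support hq
    ((Set.finite_singleton n).subset Pi.support_single_subset)⟩

/-- The coordinate functionals. -/
def coordFun (hq : 1 < q) (n : ℕ) : approxSpace 𝕜 hq →ₗ[𝕜] 𝕜 :=
  (LinearMap.proj n).comp (approxSpace 𝕜 hq).subtype

@[simp]
theorem coordFun_apply (hq : 1 < q) (n : ℕ) (f : approxSpace 𝕜 hq) :
    coordFun hq n f = (f : ℕ → 𝕜) n := rfl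

theorem coe_sum_smul_unitVec (hq : 1 < q) (A : Finset ℕ) (a : ℕ → 𝕜) :
    ((∑ n ∈ A, a n • unitVec hq n : approxSpace 𝕜 hq) : ℕ → 𝕜) = (A : Set ℕ).indicator a := by
  ext k
  rw [AddSubmonoidClass.coe_finsetSum, Finset.sum_apply]
  simp [unitVec, Pi.single_apply, Set.indicator_apply]

theorem coe_sum_unitVec (hq : 1 < q) (A : Finset ℕ) :
    ((∑ n ∈ A, unitVec hq n : approxSpace 𝕜 hq) : ℕ → 𝕜) = (A : Set ℕ).indicator 1 := by
  simpa using coe_sum_smul_unitVec hq A (1 : ℕ → 𝕜)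

theorem spaceNorm_sum_unitVec (hq : 1 < q) (A : Finset ℕ) :
    spaceNorm hq (∑ n ∈ A, unitVec hq n : approxSpace 𝕜 hq) = A.card := by
  refine le_antisymm (spaceNorm_le hq (by positivity) ?_) ?_
  · rw [coe_sum_unitVec]
    refine (gauge_le_card_mul hq (A := A) (c := 1) (fun n hn => by simp [hn]) fun n => ?_).trans ?_
    · refine (enorm_indicator_le_enorm_self _ _).trans ?_
      simp
    · simp
  · have h := norm_le_spaceNorm_of_enorm_le hq (enorm_sum_Icc_le_gauge hq
      ((∑ n ∈ A, unitVec hq n : approxSpace 𝕜 hq) : ℕ → 𝕜) 0 (A.sup id))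
    rw [coe_sum_unitVec, sum_indicator_subset (1 : ℕ → 𝕜) fun n hn =>
      mem_Icc.2 ⟨Nat.zero_le _, le_sup (f := id) hn⟩] at h
    simpa using h

theorem spaceNorm_unitVec (hq : 1 < q) (n : ℕ) :
    spaceNorm hq (unitVec hq n : approxSpace 𝕜 hq) = 1 := by
  simpa using spaceNorm_sum_unitVec (𝕜 := 𝕜) hq {n}

theorem indicatorsLinear_spaceNorm (hq : 1 < q) :
    IndicatorsLinear (spaceNorm (𝕜 := 𝕜) hq) (unitVec hq) :=
  ⟨1, 1, one_pos, fun A => by simp [spaceNorm_sum_unitVec hq]⟩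

theorem exists_spaceNorm_partialSum_le (hq : 1 < q) : ∃ C : ℝ, 0 ≤ C ∧
    ∀ (f : approxSpace 𝕜 hq) (m : ℕ),
      spaceNorm hq (∑ n ∈ range m, (f : ℕ → 𝕜) n • unitVec hq n : approxSpace 𝕜 hq) ≤ C * spaceNorm hq f := by
  obtain ⟨C, hC, h⟩ := exists_gauge_indicator_Iio_le (𝕜 := 𝕜) hq
  refine ⟨C.toReal, ENNReal.toReal_nonneg, fun f m => spaceNorm_le_mul hq hC ?_⟩
  rw [coe_sum_smul_unitVec, coe_range]
  exact h f m

/-- The partial sum projections are uniformly bounded and eventually fix each finitely supported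
sequence; such sequences are dense. -/
theorem tendsto_partialSum (hq : 1 < q) (f : approxSpace 𝕜 hq) :
    Tendsto (fun m => spaceNorm hq (f - ∑ n ∈ range m, (f : ℕ → 𝕜) n • unitVec hq n)) atTop
      (𝓝 0) := by
  obtain ⟨C, hC, h⟩ := exists_gauge_indicator_Iio_le (𝕜 := 𝕜) hq
  obtain ⟨κ, hκ, hadd⟩ := exists_gauge_add_le (𝕜 := 𝕜) hq
  have : Tendsto (fun m => gauge q ((f : ℕ → 𝕜) - (Set.Iio m).indicator (f : ℕ → 𝕜))) atTop
      (𝓝 0) := by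
    refine ENNReal.tendsto_nhds_zero.2 fun ε hε => ?_
    set K := κ * (1 + C) + 1
    have hK : K ≠ ∞ := by finiteness
    obtain ⟨g, hg, hfg⟩ := f.2 (ε / K) (ENNReal.div_ne_zero.2 ⟨hε.ne', hK⟩)
    obtain ⟨M, hM⟩ := hg.bddAbove
    filter_upwards [eventually_gt_atTop M] with m hm
    have hgm : (Set.Iio m).indicator g = g := by
      rw [Set.indicator_eq_self]
      exact fun n hn => (hM hn).trans_lt hm
    have e : (f : ℕ → 𝕜) - (Set.Iio m).indicator (f : ℕ → 𝕜) =
        ((f : ℕ → 𝕜) - g) + -(Set.Iio m).indicator ((f : ℕ → 𝕜) - g) := by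
      rw [Set.indicator_sub', hgm]
      abel
    rw [e]
    calc _ ≤ κ * (gauge q ((f : ℕ → 𝕜) - g) + C * gauge q ((f : ℕ → 𝕜) - g)) := by
          refine (hadd _ _).trans ?_
          rw [gauge_neg hq]
          gcongr
          exact h _ _
      _ = κ * (1 + C) * gauge q ((f : ℕ → 𝕜) - g) := by ring
      _ ≤ K * (ε / K) := by gcongr; exact le_self_add
      _ ≤ ε := ENNReal.mul_div_le
  have h2 := (ENNReal.tendsto_toReal ENNReal.zero_ne_top).comp this
  refine h2.congr fun m => ?_
  rw [Function.comp_apply, spaceNorm, Submodule.coe_sub, coe_sum_smul_unitVec, coe_range]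

theorem isSchauderBasis_unitVec (hq : 1 < q) :
    IsSchauderBasis 𝕜 (spaceNorm (𝕜 := 𝕜) hq) (unitVec hq) := by
  refine fun f => ⟨(f : ℕ → 𝕜), tendsto_partialSum hq f, fun a ha => ?_⟩
  ext k
  have : Tendsto (fun m : ℕ => ‖(f : ℕ → 𝕜) k - a k‖) atTop (𝓝 0) := by
    refine squeeze_zero' (Eventually.of_forall fun _ => norm_nonneg _) ?_ ha
    filter_upwards [eventually_gt_atTop k] with m hm
    have h := norm_apply_le_spaceNorm hq (f - ∑ n ∈ range m, a n • unitVec hq n) k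
    rw [Submodule.coe_sub, coe_sum_smul_unitVec] at h
    simpa [hm] using h
  have h0 := tendsto_nhds_unique this tendsto_const_nhds
  exact (sub_eq_zero.1 (norm_eq_zero.1 h0.symm)).symm

theorem isWBasis_unitVec (hq : 1 < q) :
    IsWBasis 𝕜 (spaceNorm (𝕜 := 𝕜) hq) (unitVec hq) (coordFun hq) where
  continuous n := ⟨1, fun f => by simpa using norm_apply_le_spaceNorm hq f n⟩
  biorthogonal n k := by simp [unitVec, Pi.single_apply]
  complete f ε hε := by
    obtain ⟨m, hm⟩ := ((tendsto_partialSum hq f).eventually (gt_mem_nhds hε)).exists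
    exact ⟨_, Submodule.sum_mem _ fun n _ => Submodule.smul_mem _ _
      (Submodule.subset_span ⟨n, rfl⟩), hm⟩
  seminormalized := ⟨1, 1, one_pos, fun n => by simp [spaceNorm_unitVec hq]⟩
  mbounded := ⟨1, fun n f => by
    simpa [spaceNorm_smul, spaceNorm_unitVec hq] using norm_apply_le_spaceNorm hq f n⟩

theorem coe_sub_coordProj (hq : 1 < q) (f : approxSpace 𝕜 hq) (A : Finset ℕ) :
    ((f - coordProj (unitVec hq) (coordFun hq) A f : approxSpace 𝕜 hq) : ℕ → 𝕜) =
      (A : Set ℕ)ᶜ.indicator (f : ℕ → 𝕜) := by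
  rw [Submodule.coe_sub, coordProj]
  simp_rw [coordFun_apply]
  rw [coe_sum_smul_unitVec, Set.indicator_compl]

theorem isAlmostGreedy_unitVec (hq : 1 < q) :
    IsAlmostGreedy 𝕜 (spaceNorm (𝕜 := 𝕜) hq) (unitVec hq) := by
  obtain ⟨C, hC, h⟩ := exists_gauge_greedy_le (𝕜 := 𝕜) hq
  refine ⟨coordFun hq, isWBasis_unitVec hq, C.toReal + 1, by simp, fun f A hA B hAB => ?_⟩
  have h1 := spaceNorm_le_mul hq (f := f - coordProj (unitVec hq) (coordFun hq) A f)
    (g := f - coordProj (unitVec hq) (coordFun hq) B f) hC (by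
      rw [coe_sub_coordProj, coe_sub_coordProj]
      exact h f A B hA hAB)
  refine h1.trans ?_
  gcongr
  · exact spaceNorm_nonneg hq _
  · simp

end QuasiBanach

/-! ### Consequences of greedy-type conditions for a general basis. -/

section Abstract

variable {𝕜 : Type u} [RCLike 𝕜] {X : Type v} [AddCommGroup X] [Module 𝕜 X]

theorem IsAlmostGreedy.isQuasiGreedy {N : X → ℝ} {x : ℕ → X} (h : IsAlmostGreedy 𝕜 N x) :
    IsQuasiGreedy 𝕜 N x := by
  obtain ⟨xs, hxs, C, hC, h⟩ := h
  refine ⟨xs, hxs, C, fun f hf A hA => (h f A hA ∅ (by simp)).trans ?_⟩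
  have : f - coordProj x xs ∅ f = f := by simp [coordProj]
  rw [this]
  exact mul_le_of_le_one_right (by linarith) hf

/-- Quasi-greedy bases are unconditional for constant coefficients. -/
theorem IsQuasiGreedy.isUnconditionalForConstCoeffs {N : X → ℝ} (hN : IsQuasiNorm 𝕜 N)
    {x : ℕ → X} (h : IsQuasiGreedy 𝕜 N x) : IsUnconditionalForConstCoeffs 𝕜 N x := by
  obtain ⟨xs, hxs, C, h⟩ := h
  have hN0 : N 0 = 0 := by simpa using hN.smul 0 0
  refine ⟨max C 1, le_max_right _ _, fun A B hAB ε hε => ?_⟩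
  set f := ∑ n ∈ B, ε n • x n with hf
  have hcoord : ∀ k, xs k f = if k ∈ B then ε k else 0 := by
    intro k
    simp [hf, map_sum, hxs.biorthogonal]
  have key : ∀ g : X, ∀ D, IsGreedySet (fun n => xs n g) D →
      N (g - coordProj x xs D g) ≤ C * N g := by
    intro g D hD
    rcases eq_or_ne g 0 with rfl | hg
    · simp [coordProj, hN0]
    have hNg := hN.pos g hg
    set c : 𝕜 := (((N g)⁻¹ : ℝ) : 𝕜)
    have hc : ‖c‖ = (N g)⁻¹ := by simp [c, abs_of_pos hNg]
    have h1 := h (c • g) (by rw [hN.smul, hc, inv_mul_cancel₀ hNg.ne']) D fun n hn k hk => by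
      simp only [map_smul, norm_smul]
      exact mul_le_mul_of_nonneg_left (hD n hn k hk) (norm_nonneg _)
    have e : c • g - coordProj x xs D (c • g) = c • (g - coordProj x xs D g) := by
      simp [coordProj, smul_sub, Finset.smul_sum, smul_smul]
    rw [e, hN.smul, hc, inv_mul_le_iff₀ hNg] at h1
    linarith
  -- All coefficients of f on B have modulus one, so every subset of B is greedy; removing B \ A
  -- leaves the part over A.
  have hgr : IsGreedySet (fun n => xs n f) (B \ A) := by
    intro n hn k hk
    simp only [hcoord]
    rw [if_pos (Finset.mem_sdiff.1 hn).1, hε n (Finset.mem_sdiff.1 hn).1]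
    split_ifs with hkB
    · exact (hε k hkB).le
    · simp
  have h1 := key f (B \ A) hgr
  have e : f - coordProj x xs (B \ A) f = ∑ n ∈ A, ε n • x n := by
    rw [sub_eq_iff_eq_add', hf, ← Finset.sum_sdiff hAB, coordProj]
    congr 1
    refine Finset.sum_congr rfl fun n hn => ?_
    rw [Finset.sum_sdiff hAB, ← hf, hcoord, if_pos (Finset.mem_sdiff.1 hn).1]
  rw [e] at h1
  exact h1.trans (mul_le_mul_of_nonneg_right (le_max_left _ _) (hN.nonneg _))

end Abstract

/-! ### Banach envelopes -/

section Envelope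

open Finset

variable {𝕜 : Type u} [RCLike 𝕜] {X : Type u} [AddCommGroup X] [Module 𝕜 X]

variable (𝕜) in
/-- The seminorm given by the functionals dominated by `N`. -/
def dualSeminorm (N : X → ℝ) (hN : ∀ f, 0 ≤ N f) : Seminorm 𝕜 X :=
  have hbdd : ∀ f : X, BddAbove (Set.range fun φ : {φ : X →ₗ[𝕜] 𝕜 // ∀ g, ‖φ g‖ ≤ N g} =>
      ‖φ.1 f‖) := fun f => ⟨N f, by rintro _ ⟨φ, rfl⟩; exact φ.2 f⟩
  have : Nonempty {φ : X →ₗ[𝕜] 𝕜 // ∀ g, ‖φ g‖ ≤ N g} := ⟨⟨0, fun g => by simpa using hN g⟩⟩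
  Seminorm.ofSMulLE (fun f => ⨆ φ : {φ : X →ₗ[𝕜] 𝕜 // ∀ g, ‖φ g‖ ≤ N g}, ‖φ.1 f‖) (by simp)
    (fun f g => ciSup_le fun φ => by
      rw [map_add]
      exact (norm_add_le _ _).trans (add_le_add (le_ciSup (hbdd f) φ) (le_ciSup (hbdd g) φ)))
    (fun c f => ciSup_le fun φ => by
      rw [map_smul, norm_smul]
      exact mul_le_mul_of_nonneg_left (le_ciSup (hbdd f) φ) (norm_nonneg _))

theorem dualSeminorm_le {N : X → ℝ} (hN : ∀ f, 0 ≤ N f) (f : X) : dualSeminorm 𝕜 N hN f ≤ N f :=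
  have : Nonempty {φ : X →ₗ[𝕜] 𝕜 // ∀ g, ‖φ g‖ ≤ N g} := ⟨⟨0, fun g => by simpa using hN g⟩⟩
  ciSup_le (f := fun φ : {φ : X →ₗ[𝕜] 𝕜 // ∀ g, ‖φ g‖ ≤ N g} => ‖φ.1 f‖) fun φ => φ.2 f

theorem norm_le_dualSeminorm {N : X → ℝ} (hN : ∀ f, 0 ≤ N f) {φ : X →ₗ[𝕜] 𝕜}
    (hφ : ∀ g, ‖φ g‖ ≤ N g) (f : X) : ‖φ f‖ ≤ dualSeminorm 𝕜 N hN f :=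
  le_ciSup (f := fun φ : {φ : X →ₗ[𝕜] 𝕜 // ∀ g, ‖φ g‖ ≤ N g} => ‖φ.1 f‖)
    ⟨N f, by rintro _ ⟨φ, rfl⟩; exact φ.2 f⟩ ⟨φ, hφ⟩

/-- By Hahn–Banach, compose T with a functional norming T f; divided by C it is among the
functionals that define the seminorm. -/
theorem norm_le_mul_dualSeminorm {N : X → ℝ} (hN : ∀ f, 0 ≤ N f) {Y : Type*}
    [NormedAddCommGroup Y] [NormedSpace 𝕜 Y] (T : X →ₗ[𝕜] Y) {C : ℝ} (hC : 0 ≤ C)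
    (hT : ∀ f, ‖T f‖ ≤ C * N f) (f : X) : ‖T f‖ ≤ C * dualSeminorm 𝕜 N hN f := by
  rcases hC.eq_or_lt with rfl | hC
  · simpa using hT f
  obtain ⟨g, hg, hgf⟩ := exists_dual_vector'' 𝕜 (T f)
  have hCn : ‖((C⁻¹ : ℝ) : 𝕜)‖ = C⁻¹ := by simp [abs_of_pos hC]
  have h := norm_le_dualSeminorm hN (φ := ((C⁻¹ : ℝ) : 𝕜) • (g : Y →ₗ[𝕜] 𝕜).comp T) (fun x => by
    have h1 : ‖g (T x)‖ ≤ C * N x :=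
      (g.le_of_opNorm_le hg _).trans (by simpa using hT x)
    rw [LinearMap.smul_apply, norm_smul, hCn, inv_mul_le_iff₀ hC]
    exact h1) f
  rw [LinearMap.smul_apply, norm_smul, hCn, inv_mul_le_iff₀ hC] at h
  simpa [hgf] using h

/-- The envelope is the completion of X under `dualSeminorm`, which also identifies vectors not
separated by continuous functionals. -/
theorem exists_isBanachEnvelope (N : X → ℝ) (hN : ∀ f, 0 ≤ N f) :
    ∃ (E : Type u) (_ : NormedAddCommGroup E) (_ : NormedSpace 𝕜 E) (_ : CompleteSpace E)
      (J : X →ₗ[𝕜] E), IsBanachEnvelope 𝕜 N J := by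
  let p := dualSeminorm 𝕜 N hN
  let : SeminormedAddCommGroup X := p.toAddGroupSeminorm.toSeminormedAddCommGroup
  let : NormedSpace 𝕜 X := ⟨fun c f => (map_smul_eq_mul p c f).le⟩
  let J : X →ₗ[𝕜] UniformSpace.Completion X :=
    (UniformSpace.Completion.toComplL (𝕜 := 𝕜) (E := X) : X →ₗ[𝕜] UniformSpace.Completion X)
  have hJ : ∀ f, ‖J f‖ = p f := fun f => UniformSpace.Completion.norm_coe f
  have hd : DenseRange J := UniformSpace.Completion.denseRange_coe
  refine ⟨UniformSpace.Completion X, inferInstance, inferInstance, inferInstance, J, ?_, ?_⟩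
  · intro f
    rw [hJ]
    exact dualSeminorm_le hN f
  · intro Y _ _ _ T C hC hT
    have hb : ∀ f, ‖T f‖ ≤ C * ‖J f‖ := fun f => by
      rw [hJ]
      exact norm_le_mul_dualSeminorm hN T hC hT f
    have he : ∀ f, T.extendOfNorm J (J f) = T f := LinearMap.extendOfNorm_eq hd ⟨C, hb⟩
    refine ⟨T.extendOfNorm J, he, LinearMap.opNorm_extendOfNorm_le hd hC hb, fun S hS => ?_⟩
    refine ContinuousLinearMap.coeFn_injective (hd.equalizer S.continuous
      (T.extendOfNorm J).continuous ?_)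
    ext f
    simp [hS, he]

variable {E : Type u} [NormedAddCommGroup E] [NormedSpace 𝕜 E] [CompleteSpace E]
  {N : X → ℝ} {J : X →ₗ[𝕜] E}

/-- Modulo the closure of the range, the quotient map and the zero map both extend the zero map of
X, so uniqueness makes them equal. -/
theorem IsBanachEnvelope.denseRange (hJ : IsBanachEnvelope 𝕜 N J) : DenseRange J := by
  set S : Submodule 𝕜 E := (LinearMap.range J).topologicalClosure with hS
  have hSc : IsClosed (S : Set E) := Submodule.isClosed_topologicalClosure _
  obtain ⟨That, -, -, huniq⟩ := hJ.universal (E ⧸ S) 0 0 le_rfl (by simp)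
  have h1 : S.mkQL = That := huniq _ fun f => by
    have : J f ∈ S := Submodule.le_topologicalClosure _ ⟨f, rfl⟩
    simpa using this
  have h2 : (0 : E →L[𝕜] E ⧸ S) = That := huniq _ fun f => by simp
  intro y
  have h3 : S.mkQL y = 0 := by rw [h1, ← h2]; rfl
  have h4 : y ∈ S := by simpa using h3
  exact h4

theorem IsBanachEnvelope.norm_apply_le (hJ : IsBanachEnvelope 𝕜 N J) {φ : X →ₗ[𝕜] 𝕜} {C : ℝ}
    (hC : 0 ≤ C) (hφ : ∀ f, ‖φ f‖ ≤ C * N f) (f : X) : ‖φ f‖ ≤ C * ‖J f‖ := by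
  obtain ⟨That, hThat, hnorm, -⟩ := hJ.universal 𝕜 φ C hC hφ
  rw [← hThat]
  exact That.le_of_opNorm_le hnorm _

/-- The Banach envelope map transfers Schauder bases. -/
theorem IsBanachEnvelope.isWBasis_and_isSchauderBasis (hJ : IsBanachEnvelope 𝕜 N J)
    {x : ℕ → X} {xs : ℕ → X →ₗ[𝕜] 𝕜}
    (hxs : ∀ n f, ‖xs n f‖ ≤ N f) (hbi : ∀ n k, xs n (x k) = if n = k then 1 else 0)
    (hx : ∀ n, N (x n) ≤ 1) {C : ℝ} (hC : 0 ≤ C)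
    (hP : ∀ f m, N (∑ n ∈ range m, xs n f • x n) ≤ C * N f)
    (hlim : ∀ f, Tendsto (fun m => N (f - ∑ n ∈ range m, xs n f • x n)) atTop (𝓝 0)) :
    (∃ ys : ℕ → E →ₗ[𝕜] 𝕜, IsWBasis 𝕜 (fun y : E => ‖y‖) (fun n => J (x n)) ys) ∧
      IsSchauderBasis 𝕜 (fun y : E => ‖y‖) (fun n => J (x n)) := by
  have hd := hJ.denseRange
  choose ys hys hys1 _ using fun n =>
    hJ.universal 𝕜 (xs n) 1 zero_le_one (fun f => by simpa using hxs n f)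
  have hysle : ∀ n y, ‖ys n y‖ ≤ ‖y‖ := fun n y => by
    simpa using (ys n).le_of_opNorm_le (hys1 n) y
  have hJx : ∀ n, ‖J (x n)‖ ≤ 1 := fun n => (hJ.contraction _).trans (hx n)
  let Q : ℕ → E →L[𝕜] E := fun m => ∑ n ∈ range m, (ys n).smulRight (J (x n))
  have hQ : ∀ m y, Q m y = ∑ n ∈ range m, ys n y • J (x n) := fun m y => by
    simp [Q]
  have hQJ : ∀ m f, Q m (J f) = J (∑ n ∈ range m, xs n f • x n) := fun m f => by
    simp [hQ, hys]
  -- Q m is the unique extension of J composed with the m-th partial sum projection, so the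
  -- universal property transfers the bound C.
  have hQn : ∀ m, ‖Q m‖ ≤ C := by
    intro m
    let T : X →ₗ[𝕜] E := ((Q m : E →L[𝕜] E) : E →ₗ[𝕜] E).comp J
    obtain ⟨That, -, hnorm, huniq⟩ := hJ.universal E T C hC (fun f => by
      change ‖Q m (J f)‖ ≤ _
      rw [hQJ]
      exact (hJ.contraction _).trans (hP f m))
    rwa [huniq (Q m) fun f => rfl]
  have hconv : ∀ y, Tendsto (fun m => ‖y - Q m y‖) atTop (𝓝 0) := by
    intro y
    refine Metric.tendsto_atTop.2 fun ε hε => ?_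
    obtain ⟨f, hf⟩ := hd.exists_dist_lt y (ε := ε / (2 * (C + 1))) (by positivity)
    rw [dist_eq_norm, lt_div_iff₀ (by positivity)] at hf
    obtain ⟨M, hM⟩ := eventually_atTop.1 ((hlim f).eventually (gt_mem_nhds (half_pos hε)))
    refine ⟨M, fun m hm => ?_⟩
    rw [Real.dist_eq, sub_zero, abs_norm]
    have e : y - Q m y = (y - J f) + J (f - ∑ n ∈ range m, xs n f • x n) - Q m (y - J f) := by
      rw [map_sub, map_sub, hQJ]
      abel
    have h1 : ‖Q m (y - J f)‖ ≤ C * ‖y - J f‖ := (Q m).le_of_opNorm_le (hQn m) _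
    have h2 := hJ.contraction (f - ∑ n ∈ range m, xs n f • x n)
    rw [e]
    calc _ ≤ ‖y - J f‖ + ‖J (f - ∑ n ∈ range m, xs n f • x n)‖ + ‖Q m (y - J f)‖ :=
          (norm_sub_le _ _).trans (add_le_add_left (norm_add_le _ _) _)
      _ < ε := by
          have := hM m hm
          linarith
  have hbi' : ∀ n k, ys n (J (x k)) = if n = k then 1 else 0 := fun n k => by rw [hys, hbi]
  refine ⟨⟨fun n => (ys n : E →ₗ[𝕜] 𝕜), ?_, ?_, ?_, ?_, ?_⟩, ?_⟩
  · exact fun n => ⟨1, fun y => by simpa using hysle n y⟩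
  · exact hbi'
  · intro y ε hε
    obtain ⟨m, hm⟩ := ((hconv y).eventually (gt_mem_nhds hε)).exists
    refine ⟨Q m y, ?_, hm⟩
    rw [hQ]
    exact Submodule.sum_mem _ fun n _ => Submodule.smul_mem _ _ (Submodule.subset_span ⟨n, rfl⟩)
  · refine ⟨1, 1, one_pos, fun n => ⟨?_, hJx n⟩⟩
    have := hysle n (J (x n))
    rw [hbi' n n, if_pos rfl, norm_one] at this
    exact this
  · refine ⟨1, fun n y => ?_⟩
    rw [norm_smul, one_mul]
    exact (mul_le_of_le_one_right (norm_nonneg _) (hJx n)).trans (hysle n y)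
  · intro y
    refine ⟨fun n => ys n y, ?_, fun a ha => ?_⟩
    · simpa only [hQ] using hconv y
    · ext k
      have : Tendsto (fun m : ℕ => ‖ys k y - a k‖) atTop (𝓝 0) := by
        refine squeeze_zero' (Eventually.of_forall fun _ => norm_nonneg _) ?_ ha
        filter_upwards [eventually_gt_atTop k] with m hm
        have h := hysle k (y - ∑ n ∈ range m, a n • J (x n))
        rw [map_sub, map_sum] at h
        simpa [hbi', hm] using h
      have h0 := tendsto_nhds_unique this tendsto_const_nhds
      exact (sub_eq_zero.1 (norm_eq_zero.1 h0.symm)).symm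

end Envelope

/-! ### Democracy from linear growth of indicators. -/

section Indicators

variable {X : Type v} [AddCommGroup X]

theorem IndicatorsLinear.isDemocratic {N : X → ℝ} {x : ℕ → X} (h : IndicatorsLinear N x) :
    IsDemocratic N x := by
  obtain ⟨c, C, hc, h⟩ := h
  refine ⟨max C 0 / c, fun A B hAB => ?_⟩
  have hAB' : (A.card : ℝ) ≤ B.card := by exact_mod_cast hAB
  calc N (∑ n ∈ A, x n) ≤ C * A.card := (h A).2
    _ ≤ max C 0 * B.card :=
        mul_le_mul (le_max_left _ _) hAB' (by positivity) (le_max_right _ _)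
    _ = max C 0 / c * (c * B.card) := by field_simp
    _ ≤ _ := by
        gcongr
        exact (h B).1

end Indicators

/-! ### Alternating sequences built on permutations of the harmonic sequence -/

section Alternating

open Finset

variable {𝕜 : Type u} [RCLike 𝕜] {q : ℝ≥0∞}

/-- The sequence `c 0, -c 0, c 1, -c 1, …`. -/
def altSeq (c : ℕ → 𝕜) (n : ℕ) : 𝕜 := (-1) ^ n * c (n / 2)

@[simp]
theorem nnnorm_altSeq (c : ℕ → 𝕜) (n : ℕ) : ‖altSeq c n‖₊ = ‖c (n / 2)‖₊ := by
  simp [altSeq, nnnorm_mul, nnnorm_pow]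

theorem sum_range_altSeq (c : ℕ → 𝕜) (M : ℕ) :
    ∑ n ∈ range M, altSeq c n = if Even M then 0 else c (M / 2) := by
  induction M with
  | zero => simp
  | succ M ih =>
    rw [sum_range_succ, ih, altSeq]
    rcases Nat.even_or_odd M with h | h
    · have h1 : ¬ Even (M + 1) := by simpa [Nat.even_add_one] using h
      have h2 : (M + 1) / 2 = M / 2 := by obtain ⟨k, rfl⟩ := h; omega
      rw [if_pos h, if_neg h1, h.neg_one_pow, h2]
      ring
    · have h0 : ¬ Even M := Nat.not_even_iff_odd.2 h
      have h1 : Even (M + 1) := by simpa [Nat.even_add_one] using h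
      rw [if_neg h0, if_pos h1, h.neg_one_pow]
      ring

/-- The two members of a pair have equal modulus, so truncation keeps or drops whole pairs: the
result is again alternating. An interval sum is a difference of two initial sums, each of them zero
or a single entry. -/
theorem truncNorm_altSeq_le {c : ℕ → 𝕜} (hc : ∀ k, ‖c k‖ ≤ 1) : truncNorm (altSeq c) ≤ 2 := by
  refine iSup_le fun t => iSup₂_le fun a b => ?_
  set d : ℕ → 𝕜 := fun k => if ‖c k‖₊ ≤ t then c k else 0
  have hd : ∀ k, ‖d k‖ ≤ 1 := fun k => by
    by_cases h : ‖c k‖₊ ≤ t <;> simp [d, h, hc]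
  have hpre : ∀ M, ‖∑ n ∈ range M, altSeq d n‖ ≤ 1 := fun M => by
    rw [sum_range_altSeq]
    split_ifs <;> simp [hd]
  have e : ∑ n ∈ Icc a b with ‖altSeq c n‖₊ ≤ t, altSeq c n = ∑ n ∈ Icc a b, altSeq d n := by
    rw [sum_filter]
    refine sum_congr rfl fun n _ => ?_
    by_cases h : ‖c (n / 2)‖₊ ≤ t <;> simp [d, altSeq, h]
  have h2 : ‖∑ n ∈ Icc a b, altSeq d n‖ ≤ 2 := by
    rcases le_or_gt a (b + 1) with hab | hab
    · have : Icc a b = Ico a (b + 1) := by ext n; simp only [mem_Icc, mem_Ico]; omega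
      rw [this, sum_Ico_eq_sub _ hab]
      refine (norm_sub_le _ _).trans ?_
      linarith [hpre (b + 1), hpre a]
    · rw [Icc_eq_empty (by omega)]
      simp
  rw [e, ← ofReal_norm]
  exact ENNReal.ofReal_le_of_le_toReal (by simpa using h2)

/-- The harmonic sequence of length `N` permuted by `σ`. -/
def permHarmonic {N : ℕ} (σ : Equiv.Perm (Fin N)) (k : ℕ) : 𝕜 :=
  if h : k < N then (((σ ⟨k, h⟩ : ℕ) : 𝕜) + 1)⁻¹ else 0

theorem norm_natCast_add_one_inv (k : ℕ) : ‖((k : 𝕜) + 1)⁻¹‖ = ((k : ℝ) + 1)⁻¹ := by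
  rw [norm_inv]
  congr 1
  exact_mod_cast RCLike.norm_natCast (K := 𝕜) (k + 1)

theorem norm_permHarmonic {N : ℕ} (σ : Equiv.Perm (Fin N)) {k : ℕ} (h : k < N) :
    ‖(permHarmonic σ k : 𝕜)‖ = ((σ ⟨k, h⟩ : ℕ) + 1 : ℝ)⁻¹ := by
  rw [permHarmonic, dif_pos h, norm_natCast_add_one_inv]

theorem norm_permHarmonic_le {N : ℕ} (σ : Equiv.Perm (Fin N)) (k : ℕ) :
    ‖(permHarmonic σ k : 𝕜)‖ ≤ 1 := by
  by_cases h : k < N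
  · rw [norm_permHarmonic σ h]
    exact inv_le_one_of_one_le₀ (by simp)
  · simp [permHarmonic, h]

theorem altSeq_permHarmonic_eq_zero {N : ℕ} (σ : Equiv.Perm (Fin N)) {n : ℕ}
    (hn : n ∉ range (2 * N)) : altSeq (permHarmonic σ : ℕ → 𝕜) n = 0 := by
  have : ¬ n / 2 < N := by rw [mem_range] at hn; omega
  simp [altSeq, permHarmonic, this]

/-- Each value 1/(j+1) occurs twice. The entries above 2/(m+1) have 2(j+1) < m+1, and the index 2j
plus the parity of n embeds them into {0, …, m-1}. -/
theorem rearr_altSeq_permHarmonic_le {N : ℕ} (σ : Equiv.Perm (Fin N)) (m : ℕ) :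
    rearr (altSeq (permHarmonic σ : ℕ → 𝕜)) m ≤ 2 * ((m : ℝ≥0∞) + 1)⁻¹ := by
  refine sInf_le ?_
  have key : ∀ n, 2 * ((m : ℝ≥0∞) + 1)⁻¹ < ‖altSeq (permHarmonic σ : ℕ → 𝕜) n‖ₑ →
      ∃ h : n / 2 < N, 2 * ((σ ⟨n / 2, h⟩ : ℕ) + 1) < m + 1 := by
    intro n hn
    have h : n / 2 < N := by
      by_contra h
      have : n ∉ range (2 * N) := by rw [mem_range]; omega
      rw [altSeq_permHarmonic_eq_zero σ this] at hn
      simp at hn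
    refine ⟨h, ?_⟩
    rw [enorm_eq_nnnorm, nnnorm_altSeq, ← enorm_eq_nnnorm, ← ofReal_norm,
      norm_permHarmonic σ h] at hn
    have e : 2 * ((m : ℝ≥0∞) + 1)⁻¹ = ENNReal.ofReal (2 * ((m : ℝ) + 1)⁻¹) := by
      rw [ENNReal.ofReal_mul (by norm_num), ENNReal.ofReal_inv_of_pos (by positivity),
        ENNReal.ofReal_add (by positivity) (by norm_num)]
      simp
    rw [e, ENNReal.ofReal_lt_ofReal_iff (by positivity), ← div_eq_mul_inv, inv_eq_one_div,
      div_lt_div_iff₀ (by positivity) (by positivity)] at hn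
    rw [one_mul] at hn
    exact_mod_cast hn
  change Set.encard _ ≤ (m : ℕ∞)
  have hcard : ((range m : Finset ℕ) : Set ℕ).encard = (m : ℕ∞) := by
    rw [Set.encard_coe_eq_coe_finsetCard, card_range]
  rw [← hcard]
  refine Set.encard_le_encard_of_injOn
    (f := fun n => if h : n / 2 < N then 2 * (σ ⟨n / 2, h⟩ : ℕ) + n % 2 else 0) ?_ ?_
  · intro n hn
    obtain ⟨h, hlt⟩ := key n hn
    simp only [h, dif_pos, coe_range, Set.mem_Iio]
    omega
  · intro n hn n' hn' heq
    obtain ⟨h, -⟩ := key n hn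
    obtain ⟨h', -⟩ := key n' hn'
    simp only [h, h', dif_pos] at heq
    have h1 : (σ ⟨n / 2, h⟩ : ℕ) = (σ ⟨n' / 2, h'⟩ : ℕ) := by omega
    have h2 := congrArg Fin.val (σ.injective (Fin.ext h1))
    simp only at h2
    omega

theorem lorentzNorm_altSeq_permHarmonic_le (hq : 1 < q) {N : ℕ} (σ : Equiv.Perm (Fin N)) :
    lorentzNorm q (altSeq (permHarmonic σ : ℕ → 𝕜)) ≤
      2 * (∑ m ∈ range (2 * N), ((m : ℝ≥0∞) + 1)⁻¹) ^ (1 / q.toReal) := by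
  have hr := rearr_altSeq_permHarmonic_le (𝕜 := 𝕜) σ
  have hr0 : ∀ m ∉ range (2 * N), rearr (altSeq (permHarmonic σ : ℕ → 𝕜)) m = 0 := fun m hm =>
    rearr_eq_zero_of_support (A := range (2 * N))
      (fun n hn => altSeq_permHarmonic_eq_zero σ hn) (by simpa using hm)
  rw [lorentzNorm_eq]
  -- For q = ∞ the conventions `∞.toReal = 0` and 1/0 = 0 make the exponent 0, so the bound reads 2.
  -- For finite q the weights turn the Q-th powers into the harmonic series.
  by_cases hq' : q = ∞
  · subst hq'
    rw [lorentzSeq_top]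
    refine iSup_le fun m => ?_
    calc _ ≤ ((m : ℝ≥0∞) + 1) * (2 * ((m : ℝ≥0∞) + 1)⁻¹) := by gcongr; exact hr m
      _ = 2 * (((m : ℝ≥0∞) + 1) * ((m : ℝ≥0∞) + 1)⁻¹) := by ring
      _ = _ := by
          rw [ENNReal.mul_inv_cancel (natCast_succ_ne_zero m) (natCast_succ_ne_top m)]
          simp
  · have h1 := one_lt_toReal hq hq'
    rw [lorentzSeq_of_ne_top hq hq']
    set Q := q.toReal
    have hQ0 : 0 < Q := by linarith
    have e2 : (2 : ℝ≥0∞) = (2 ^ Q) ^ (1 / Q) := by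
      rw [← ENNReal.rpow_mul, mul_one_div_cancel hQ0.ne', ENNReal.rpow_one]
    conv_rhs => rw [e2]
    rw [← ENNReal.mul_rpow_of_nonneg _ _ (by positivity)]
    refine ENNReal.rpow_le_rpow ?_ (by positivity)
    rw [tsum_eq_sum (s := range (2 * N)), mul_sum]
    · refine sum_le_sum fun m _ => ?_
      calc _ ≤ ((m : ℝ≥0∞) + 1) ^ (Q - 1) * (2 * ((m : ℝ≥0∞) + 1)⁻¹) ^ Q := by
            gcongr; exact hr m
        _ = 2 ^ Q * (((m : ℝ≥0∞) + 1) ^ (Q - 1) * ((m : ℝ≥0∞) + 1) ^ (-Q)) := by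
            rw [ENNReal.mul_rpow_of_nonneg _ _ hQ0.le, ENNReal.inv_rpow, ← ENNReal.rpow_neg]
            ring
        _ = _ := by
            rw [← ENNReal.rpow_add _ _ (natCast_succ_ne_zero m) (natCast_succ_ne_top m),
              ← ENNReal.rpow_neg_one]
            congr 2
            ring
    · intro m hm
      rw [hr0 m hm, ENNReal.zero_rpow_of_pos hQ0, mul_zero]

/-- Partial sums of the harmonic series. -/
def harmonicSum (N : ℕ) : ℝ := ∑ k ∈ range N, ((k : ℝ) + 1)⁻¹

theorem tendsto_harmonicSum : Tendsto harmonicSum atTop atTop := by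
  have h := Real.tendsto_sum_range_one_div_nat_succ_atTop
  simp only [one_div] at h
  exact h

theorem one_le_harmonicSum {N : ℕ} (hN : 0 < N) : 1 ≤ harmonicSum N := by
  have := single_le_sum (f := fun k : ℕ => ((k : ℝ) + 1)⁻¹) (s := range N)
    (fun _ _ => by positivity) (mem_range.2 hN)
  simpa [harmonicSum] using this

theorem harmonicSum_two_mul_le {N : ℕ} (hN : 0 < N) : harmonicSum (2 * N) ≤ 2 * harmonicSum N := by
  have h1 := one_le_harmonicSum hN
  have h2 : ∑ k ∈ range N, (((N + k : ℕ) : ℝ) + 1)⁻¹ ≤ 1 := by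
    calc _ ≤ ∑ k ∈ range N, (N : ℝ)⁻¹ := by
          gcongr
          push_cast
          linarith [k.cast_nonneg (α := ℝ)]
      _ = 1 := by
          rw [sum_const, card_range, nsmul_eq_mul, mul_inv_cancel₀ (by positivity)]
  rw [harmonicSum, two_mul N, sum_range_add]
  change harmonicSum N + _ ≤ _
  linarith

theorem exists_spaceNorm_altSeq_permHarmonic_le (hq : 1 < q) : ∃ C : ℝ, 0 ≤ C ∧
    ∀ {N : ℕ}, 0 < N → ∀ σ : Equiv.Perm (Fin N), ∀ v : approxSpace 𝕜 hq,
      (v : ℕ → 𝕜) = altSeq (permHarmonic σ) →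
      spaceNorm hq v ≤ C * harmonicSum N ^ (1 / q.toReal) := by
  obtain ⟨C, hC, hG⟩ := exists_gauge_le (𝕜 := 𝕜) hq
  refine ⟨C.toReal * (2 * 2 ^ (1 / q.toReal)), by positivity, fun {N} hN σ v hv => ?_⟩
  have hH := one_le_harmonicSum hN
  have hH2 := harmonicSum_two_mul_le hN
  have hH2' : 1 ≤ harmonicSum (2 * N) := one_le_harmonicSum (by omega)
  have hθ : 0 ≤ 1 / q.toReal := by positivity
  have e : ∑ m ∈ range (2 * N), ((m : ℝ≥0∞) + 1)⁻¹ = ENNReal.ofReal (harmonicSum (2 * N)) := by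
    rw [harmonicSum, ENNReal.ofReal_sum_of_nonneg fun _ _ => by positivity]
    refine sum_congr rfl fun m _ => ?_
    rw [ENNReal.ofReal_inv_of_pos (by positivity), ENNReal.ofReal_add (by positivity) (by simp)]
    simp
  have hL := lorentzNorm_altSeq_permHarmonic_le (𝕜 := 𝕜) hq σ
  rw [e, ENNReal.ofReal_rpow_of_nonneg (by linarith) hθ] at hL
  have hT := truncNorm_altSeq_le (𝕜 := 𝕜) (norm_permHarmonic_le σ)
  have hle : truncGauge q (v : ℕ → 𝕜) ≤
      ENNReal.ofReal (2 * harmonicSum (2 * N) ^ (1 / q.toReal)) := by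
    rw [hv, ENNReal.ofReal_mul (by norm_num), ENNReal.ofReal_ofNat]
    refine max_le (hT.trans (le_mul_of_one_le_right zero_le ?_)) hL
    rw [ENNReal.one_le_ofReal]
    exact Real.one_le_rpow hH2' hθ
  refine spaceNorm_le hq (by positivity) ((hG _).2.trans ?_)
  calc C * truncGauge q (v : ℕ → 𝕜)
      ≤ C * ENNReal.ofReal (2 * harmonicSum (2 * N) ^ (1 / q.toReal)) := by gcongr
    _ = ENNReal.ofReal (C.toReal * (2 * harmonicSum (2 * N) ^ (1 / q.toReal))) := by
        rw [ENNReal.ofReal_mul ENNReal.toReal_nonneg, ENNReal.ofReal_toReal hC]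
    _ ≤ _ := by
        refine ENNReal.ofReal_le_ofReal ?_
        rw [mul_assoc, mul_assoc, ← Real.mul_rpow (by norm_num) (by linarith)]
        gcongr

/-- At a fixed position k the cyclic shifts bring every term 1/(j+1) exactly once, so the average
over shifts is constant in k. -/
theorem sum_permHarmonic_addRight {N : ℕ} [NeZero N] {k : ℕ} (hk : k < N) :
    ∑ i : Fin N, (permHarmonic (Equiv.addRight i) k : 𝕜) = (harmonicSum N : ℝ) := by
  simp only [permHarmonic, hk, dif_pos, Equiv.coe_addRight]
  have h := Equiv.sum_comp (Equiv.addLeft (⟨k, hk⟩ : Fin N))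
    (fun j : Fin N => (((j : ℕ) : 𝕜) + 1)⁻¹)
  simp only [Equiv.coe_addLeft] at h
  rw [h, Fin.sum_univ_eq_sum_range (fun j : ℕ => ((j : 𝕜) + 1)⁻¹), harmonicSum]
  push_cast
  rfl

end Alternating

/-! ### The unit vectors in the Banach envelope -/

section EnvelopeBasis

open Finset

variable {𝕜 : Type u} [RCLike 𝕜] {q : ℝ≥0∞}
  {E : Type u} [NormedAddCommGroup E] [NormedSpace 𝕜 E] [CompleteSpace E]

/-- The sum over an interval containing A is a functional of norm at most 1 on the quasi-Banach
space, hence on the envelope, and it takes the value |A| at the indicator. -/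
theorem indicatorsLinear_envelope (hq : 1 < q) {J : approxSpace 𝕜 hq →ₗ[𝕜] E}
    (hJ : IsBanachEnvelope 𝕜 (spaceNorm hq) J) :
    IndicatorsLinear (fun y : E => ‖y‖) fun n => J (unitVec hq n) := by
  refine ⟨1, 1, one_pos, fun A => ⟨?_, ?_⟩⟩
  · let φ : approxSpace 𝕜 hq →ₗ[𝕜] 𝕜 := ∑ n ∈ Icc 0 (A.sup id), coordFun hq n
    have hφ : ∀ f, φ f = ∑ n ∈ Icc 0 (A.sup id), (f : ℕ → 𝕜) n := fun f => by
      simp [φ, LinearMap.sum_apply]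
    have h := hJ.norm_apply_le (φ := φ) zero_le_one (fun f => by
      rw [one_mul, hφ]
      exact norm_le_spaceNorm_of_enorm_le hq (enorm_sum_Icc_le_gauge hq _ _ _))
      (∑ n ∈ A, unitVec hq n)
    rw [hφ, coe_sum_unitVec, sum_indicator_subset (1 : ℕ → 𝕜) fun n hn =>
      mem_Icc.2 ⟨Nat.zero_le _, le_sup (f := id) hn⟩, map_sum] at h
    simpa using h
  · have h := hJ.contraction (∑ n ∈ A, unitVec hq n)
    rw [spaceNorm_sum_unitVec, map_sum] at h
    simpa using h

theorem not_isUnconditionalForConstCoeffs_envelope (hq : 1 < q) {J : approxSpace 𝕜 hq →ₗ[𝕜] E}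
    (hJ : IsBanachEnvelope 𝕜 (spaceNorm hq) J) :
    ¬ IsUnconditionalForConstCoeffs 𝕜 (fun y : E => ‖y‖) fun n => J (unitVec hq n) := by
  rintro ⟨C, hC1, hC⟩
  obtain ⟨K, hK, hv⟩ := exists_spaceNorm_altSeq_permHarmonic_le (𝕜 := 𝕜) hq
  obtain ⟨c, _, hc, hlow⟩ := indicatorsLinear_envelope hq hJ
  set θ : ℝ := 1 / q.toReal with hθ
  -- This is the only point where q > 1 enters the growth comparison; for q = ∞ the convention gives
  -- θ = 0.
  have hθ1 : θ < 1 := by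
    by_cases hq' : q = ∞
    · simp [hθ, hq']
    · have := one_lt_toReal hq hq'
      rw [hθ, div_lt_one (by linarith)]
      exact this
  have key : ∀ N : ℕ, 0 < N → c * harmonicSum N ≤ C * K * harmonicSum N ^ θ := by
    intro N hN
    have : NeZero N := ⟨hN.ne'⟩
    have hH := one_le_harmonicSum hN
    set w : E := ∑ n ∈ range (2 * N), ((-1 : 𝕜) ^ n) • J (unitVec hq n) with hw
    -- All signs are +1 on the N even indices, so unconditionality compares w with the indicator of
    -- that set.
    have hlower : c * N ≤ C * ‖w‖ := by
      set A : Finset ℕ := (range N).map ⟨fun k => 2 * k, fun a b h => by simpa using h⟩ with hA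
      have hmem : ∀ n ∈ A, ∃ k < N, n = 2 * k := fun n hn => by
        obtain ⟨k, hk, rfl⟩ := Finset.mem_map.1 hn
        exact ⟨k, mem_range.1 hk, rfl⟩
      have h1 := hC A (range (2 * N)) (fun n hn => by
        obtain ⟨k, hk, rfl⟩ := hmem n hn
        rw [mem_range]
        omega) (fun n => (-1 : 𝕜) ^ n) (by simp)
      have h2 := (hlow A).1
      rw [hA, card_map, card_range, ← hA] at h2
      refine h2.trans (le_trans (le_of_eq (congrArg norm (sum_congr rfl fun n hn => ?_))) h1)
      obtain ⟨k, -, rfl⟩ := hmem n hn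
      simp [pow_mul]
    let V : Fin N → approxSpace 𝕜 hq := fun i =>
      ∑ n ∈ range (2 * N), (altSeq (permHarmonic (Equiv.addRight i)) n : 𝕜) • unitVec hq n
    have hV : ∀ i, (V i : ℕ → 𝕜) = altSeq (permHarmonic (Equiv.addRight i)) := fun i => by
      rw [coe_sum_smul_unitVec, Set.indicator_eq_self]
      intro n hn
      by_contra h
      exact hn (altSeq_permHarmonic_eq_zero _ h)
    -- The triangle inequality, available only in the envelope, can now be applied to the N shifted
    -- vectors, each of norm at most K · H^θ with H the harmonic sum.
    have hsum : (((harmonicSum N : ℝ) : 𝕜)) • w = ∑ i, J (V i) := by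
      simp only [V, map_sum, map_smul]
      rw [sum_comm, hw, smul_sum]
      refine sum_congr rfl fun n hn => ?_
      have hn2 : n / 2 < N := by rw [mem_range] at hn; omega
      rw [← sum_smul, smul_smul]
      simp only [altSeq]
      rw [← mul_sum, sum_permHarmonic_addRight hn2, mul_comm]
    have hupper : harmonicSum N * ‖w‖ ≤ N * (K * harmonicSum N ^ θ) := by
      calc harmonicSum N * ‖w‖ = ‖(((harmonicSum N : ℝ) : 𝕜)) • w‖ := by
            rw [norm_smul, RCLike.norm_ofReal, abs_of_nonneg (by linarith)]
        _ ≤ ∑ i : Fin N, ‖J (V i)‖ := by rw [hsum]; exact norm_sum_le _ _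
        _ ≤ ∑ i : Fin N, K * harmonicSum N ^ θ :=
            sum_le_sum fun i _ => (hJ.contraction _).trans (hv hN _ _ (hV i))
        _ = _ := by simp
    have hNpos : (0 : ℝ) < N := by exact_mod_cast hN
    have h3 : (c * harmonicSum N) * N ≤ (C * K * harmonicSum N ^ θ) * N := by
      calc (c * harmonicSum N) * N = harmonicSum N * (c * N) := by ring
        _ ≤ harmonicSum N * (C * ‖w‖) := by gcongr
        _ = C * (harmonicSum N * ‖w‖) := by ring
        _ ≤ C * (N * (K * harmonicSum N ^ θ)) := by gcongr
        _ = _ := by ring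
    exact le_of_mul_le_mul_right h3 hNpos
  have hlim : Tendsto (fun N => harmonicSum N ^ (1 - θ)) atTop atTop :=
    (tendsto_rpow_atTop (by linarith)).comp tendsto_harmonicSum
  obtain ⟨N, hN, hN0⟩ := ((hlim.eventually_gt_atTop (C * K / c)).and (eventually_gt_atTop 0)).exists
  have hH : 0 < harmonicSum N := by linarith [one_le_harmonicSum hN0]
  have h1 := key N hN0
  have h2 : harmonicSum N = harmonicSum N ^ (1 - θ) * harmonicSum N ^ θ := by
    rw [← Real.rpow_add hH, sub_add_cancel, Real.rpow_one]
  rw [div_lt_iff₀ hc] at hN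
  have h3 : 0 < harmonicSum N ^ θ := Real.rpow_pos_of_pos hH θ
  nlinarith [mul_lt_mul_of_pos_right hN h3]

end EnvelopeBasis

theorem isQuasiNorm_norm (𝕜 : Type u) [RCLike 𝕜] (E : Type v) [NormedAddCommGroup E]
    [NormedSpace 𝕜 E] : IsQuasiNorm 𝕜 fun y : E => ‖y‖ where
  nonneg := norm_nonneg
  pos f hf := norm_pos_iff.2 hf
  smul := norm_smul
  add := ⟨1, fun f g => by simpa using norm_add_le f g⟩

end TGA

end

theorem theorem3 {𝕜 : Type u} [RCLike 𝕜] (q : ℝ≥0∞) (hq : 1 < q) :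
    ∃ (X : Submodule 𝕜 (ℕ → 𝕜)) (N : X → ℝ) (x : ℕ → X),
      -- the space, its quasi-norm and the unit vectors
      (X : Set (ℕ → 𝕜)) = TGA.spaceB0 𝕜 ∩ TGA.lorentzSpace 𝕜 q ∧
      (∀ f : X, ENNReal.ofReal (N f) =
        max (TGA.normB (f : ℕ → 𝕜)) (TGA.lorentzNorm q (f : ℕ → 𝕜))) ∧
      (∀ n, (x n : ℕ → 𝕜) = Pi.single n 1) ∧
      -- properties of the space and of the basis
      TGA.IsQuasiBanach 𝕜 N ∧
      (∀ p : ℝ, 0 < p → p < 1 → TGA.LocallyPConvex 𝕜 N p) ∧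
      TGA.IsSchauderBasis 𝕜 N x ∧
      TGA.IsAlmostGreedy 𝕜 N x ∧
      TGA.IsQuasiGreedy 𝕜 N x ∧
      TGA.IndicatorsLinear N x ∧
      -- the Banach envelope exists, and the image of the basis in it behaves as claimed
      (∃ (E : Type u) (_ : NormedAddCommGroup E) (_ : NormedSpace 𝕜 E) (_ : CompleteSpace E)
        (J : X →ₗ[𝕜] E), TGA.IsBanachEnvelope 𝕜 N J) ∧
      ∀ (E : Type u) [NormedAddCommGroup E] [NormedSpace 𝕜 E] [CompleteSpace E]
        (J : X →ₗ[𝕜] E), TGA.IsBanachEnvelope 𝕜 N J →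
          (∃ xs : ℕ → E →ₗ[𝕜] 𝕜, TGA.IsWBasis 𝕜 (fun y : E => ‖y‖) (fun n => J (x n)) xs) ∧
          TGA.IsSchauderBasis 𝕜 (fun y : E => ‖y‖) (fun n => J (x n)) ∧
          TGA.IsDemocratic (fun y : E => ‖y‖) (fun n => J (x n)) ∧
          ¬ TGA.IsUnconditionalForConstCoeffs 𝕜 (fun y : E => ‖y‖) (fun n => J (x n)) ∧
          ¬ TGA.IsQuasiGreedy 𝕜 (fun y : E => ‖y‖) (fun n => J (x n)) ∧
          TGA.IndicatorsLinear (fun y : E => ‖y‖) (fun n => J (x n)) := by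
  refine ⟨TGA.approxSpace 𝕜 hq, TGA.spaceNorm hq, TGA.unitVec hq, TGA.coe_approxSpace hq,
    TGA.ofReal_spaceNorm hq, fun n => rfl, TGA.isQuasiBanach_spaceNorm hq,
    fun p hp0 hp1 => TGA.locallyPConvex_spaceNorm hq hp0 hp1, TGA.isSchauderBasis_unitVec hq,
    TGA.isAlmostGreedy_unitVec hq, (TGA.isAlmostGreedy_unitVec hq).isQuasiGreedy,
    TGA.indicatorsLinear_spaceNorm hq,
    TGA.exists_isBanachEnvelope _ (TGA.spaceNorm_nonneg hq), fun E _ _ _ J hJ => ?_⟩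
  obtain ⟨C, hC, hP⟩ := TGA.exists_spaceNorm_partialSum_le (𝕜 := 𝕜) hq
  obtain ⟨hW, hS⟩ := hJ.isWBasis_and_isSchauderBasis (xs := TGA.coordFun hq)
    (fun n f => TGA.norm_apply_le_spaceNorm hq f n) (TGA.isWBasis_unitVec hq).biorthogonal
    (fun n => (TGA.spaceNorm_unitVec hq n).le) hC hP (TGA.tendsto_partialSum hq)
  have hI := TGA.indicatorsLinear_envelope hq hJ
  have hU := TGA.not_isUnconditionalForConstCoeffs_envelope hq hJ
  exact ⟨hW, hS, hI.isDemocratic, hU,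
    fun h => hU (h.isUnconditionalForConstCoeffs (TGA.isQuasiNorm_norm 𝕜 E)), hI⟩
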